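/- Let $\Sigma$ be a finite alphabet with at least two letters. For every integer $k\ge 0$, $$C_k\mathbf{P}\subseteq \mathbf{DRMA}[k],$$ where the classes of languages over $\Sigma$ are defined as follows. **Counting hierarchy.** $C_0\mathbf P=\mathbf P$, $C_1\mathbf P=\mathbf{PP}$ and $C_{k+1}\mathbf P=\mathbf{PP}^{C_k\mathbf P}$ for $k\ge 1$. Here $A\in\mathbf{PP}$ if there are a polynomial-time decidable set $B$ of pairs $(x,y)\in\Sigma^*\times\{0,1\}^*$ and a polynomial $q$ such that for all $x\in\Sigma^*$ $$x\in A\iff 2^{-q(|x|)}\,\bigl|\{y\in\{0,1\}^{q(|x|)}:(x,y)\in B\}\bigr|\ \ge\ \tfrac12 ,$$ and $\mathbf{PP}^{\mathcal C}$, for a class $\mathcal C$ of languages over $\Sigma$, is defined in the same way, except that $B$ is decidable in polynomial time by an oracle Turing machine with oracle $C$ for some $C\in\mathcal C$. **Rational proofs.** A $k$-round rational interactive protocol consists of polynomial-time computable functions $V$ (Arthur's messages, values in $\Sigma^*$), $R$ (reward, values in $[0,1]$, written as finite binary fractions) and $\varphi$ (value function), together with polynomials that bound the length of Merlin's messages and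 give the length of Arthur's random strings, both in terms of $|x|$. On input $x\in\Sigma^*$ Arthur has independent, uniformly distributed private random bit strings $r_1,\dots,r_k$. In round $i+1$ Merlin sends a message $m_{i+1}\in\Sigma^*$ of at most the allowed length, and Arthur answers $$a_{i+1}=V(x;m_1,a_1,\dots,a_i,m_{i+1};r_1,\dots,r_{i+1}).$$ The reward is $R(x;m_1,r_1,\dots,m_k,r_k)$. The value computed is $\varphi(x;m_1,a_1,\dots,a_{k-1},m_k)$ (that is, $\varphi(x)$ if $k=0$). Merlin is rational if for all $i=0,\dots,k-1$ $$m_{i+1}\in\operatorname{Argmax}_{m}\ \mathbb E_{a_{i+1}}\max_{m_{i+2}}\mathbb E_{a_{i+2}}\cdots\max_{m_k}\mathbb E_{a_k}\,R,$$ where all maxima are over messages of allowed length and all expectations are conditional on the messages exchanged so far (the last one also averages over the random strings compatible with the complete transcript). A function $f$ on $\Sigma^*$ is computed by the protocol if, for every $x$, every rational behavior of Merlin and all random strings of Arthur, the value computed is $f(x)$. $\mathbf{DRMA}[k]$ is the class of all languages $S\subseteq\Sigma^*$ whose characteristic function $x\mapsto\mathbb I\{x\in S\}\in\{0,1\}$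 is computed by some $k$-round rational interactive protocol. -/

import Mathlib

open scoped BigOperators

noncomputable section

namespace RationalProofs

/-! ### Encodings of tuples of words

Words over the alphabet `α` and bit strings are written on the tape one after the other, each one
followed by its own end marker. -/

/-- Input symbols for tuples: letters of `α` (`inl (some a)`), bits (`inr (some b)`), the end marker
of a word over `α` (`inl none`) and the end marker of a bit string (`inr none`). -/
abbrev Sym (α : Type) : Type := Option α ⊕ Option Bool

/-- A word over `α`, followed by its end marker. -/
def encWord {α : Type} (w : List α) : List (Sym α) :=
  w.map (fun a => Sum.inl (some a)) ++ [Sum.inl none]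

/-- A bit string, followed by its end marker. -/
def encBits {α : Type} (r : List Bool) : List (Sym α) :=
  r.map (fun b => Sum.inr (some b)) ++ [Sum.inr none]

/-- The pair `(x, y)` of an input word and a certificate. -/
def encPair {α : Type} (p : List α × List Bool) : List (Sym α) :=
  encWord p.1 ++ encBits p.2

/-! ### Polynomial time, with and without an oracle -/

/-- `B` is decidable in polynomial time, instances `b` being presented to the machine as `enc b`. -/
def PolyTimeDecidable {β Γ₀ : Type} (enc : β → List Γ₀) (B : Set β) : Prop :=
  open scoped Classical in
  Nonempty (Turing.TM2ComputableInPolyTime enc Computability.encodeBool (fun b => decide (b ∈ B)))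

/-- Oracle machines with input alphabet `Γ₀` for oracles that are languages over `α`:
multi-stack Turing machines with a query stack, a query label and two answer labels. -/
structure OracleTM (Γ₀ α : Type) extends Turing.TM2ComputableAux Γ₀ Bool where
  /-- the stack on which queries are written -/
  queryStack : tm.K
  /-- queries are words over `α` -/
  queryAlphabet : tm.Γ queryStack ≃ α
  /-- the label at which the oracle is asked -/
  ask : tm.Λ
  /-- the label at which the machine continues after a positive answer -/
  yes : tm.Λ
  /-- the label at which the machine continues after a negative answer -/
  no : tm.Λ

open scoped Classical in
/-- One step with oracle `C`. At the label `ask` the word on the query stack (first letter on top)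
is erased and the machine continues at `yes` or `no`, according to whether this word is in `C`. At
every other label the machine performs a step of its program. -/
def OracleTM.step {Γ₀ α : Type} (M : OracleTM Γ₀ α) (C : Set (List α)) (c : M.tm.Cfg) :
    Option M.tm.Cfg :=
  if c.l = some M.ask then
    some
      { l := some (if (c.stk M.queryStack).map M.queryAlphabet ∈ C then M.yes else M.no)
        var := c.var
        stk := Function.update c.stk M.queryStack [] }
  else M.tm.step c

open scoped Classical in
/-- `B` is decidable in polynomial time with oracle `C`. -/
def PolyTimeDecidableIn {β Γ₀ α : Type} (enc : β → List Γ₀) (C : Set (List α)) (B : Set β) :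
    Prop :=
  ∃ (M : OracleTM Γ₀ α) (p : Polynomial ℕ), ∀ b : β,
    Nonempty (StateTransition.EvalsToInTime (M.step C)
      (Turing.initList M.tm ((enc b).map M.inputAlphabet.symm))
      (some (Turing.haltList M.tm
        ((Computability.encodeBool (decide (b ∈ B))).map M.outputAlphabet.symm)))
      (p.eval (enc b).length))

/-! ### The counting hierarchy -/

/-- The class `P` of languages over `α`. -/
def classP (α : Type) : Set (Set (List α)) :=
  {A | PolyTimeDecidable (fun x : List α => x) A}

open scoped Classical in
/-- The languages `A` for which there are `B ∈ 𝒟` and a polynomial `q` such that `x ∈ A` iff at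
least half of the strings `y ∈ {0,1}^{q(|x|)}` satisfy `(x, y) ∈ B`. -/
def majority {α : Type} (𝒟 : Set (Set (List α × List Bool))) : Set (Set (List α)) :=
  {A | ∃ B ∈ 𝒟, ∃ q : Polynomial ℕ, ∀ x : List α,
    x ∈ A ↔
      (1 / 2 : ℝ) ≤
        1 / 2 ^ q.eval x.length *
          ((Finset.univ.filter
            (fun y : Fin (q.eval x.length) → Bool => (x, List.ofFn y) ∈ B)).card : ℝ)}

/-- The class `PP`. -/
def classPP (α : Type) : Set (Set (List α)) :=
  majority {B | PolyTimeDecidable encPair B}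

/-- The relativised class `PP^𝒞`, for a class `𝒞` of languages. -/
def classPPRel {α : Type} (𝒞 : Set (Set (List α))) : Set (Set (List α)) :=
  majority {B | ∃ C ∈ 𝒞, PolyTimeDecidableIn encPair C B}

/-- The levels `C_k P` of the counting hierarchy. -/
def countingHierarchy (α : Type) : ℕ → Set (Set (List α))
  | 0 => classP α
  | 1 => classPP α
  | k + 2 => classPPRel (countingHierarchy α (k + 1))

/-! ### Rational interactive protocols -/

/-- The arguments of Arthur's message function: `(x; m₁, a₁, …, aᵢ, mᵢ₊₁; r₁, …, rᵢ₊₁)`. -/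
abbrev VInput (α : Type) : Type := List α × List (List α) × List (List Bool)

/-- The arguments of the reward function: `(x; m₁, r₁, …, mₖ, rₖ)`. -/
abbrev RInput (α : Type) : Type := List α × List (List α × List Bool)

/-- The arguments of the value function: `(x; m₁, a₁, …, mₖ)`. -/
abbrev ValInput (α : Type) : Type := List α × List (List α)

/-- Encoding of the arguments of Arthur's message function. -/
def encV {α : Type} (i : VInput α) : List (Sym α) :=
  encWord i.1 ++ i.2.1.flatMap encWord ++ i.2.2.flatMap encBits

/-- Encoding of the arguments of the reward function. -/
def encR {α : Type} (i : RInput α) : List (Sym α) :=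
  encWord i.1 ++ i.2.flatMap encPair

/-- Encoding of the arguments of the value function. -/
def encVal {α : Type} (i : ValInput α) : List (Sym α) :=
  encWord i.1 ++ i.2.flatMap encWord

/-- The finite binary fraction `b₀.b₁b₂…bₙ`. -/
def binFrac : List Bool → ℝ
  | [] => 0
  | b :: w => (if b then 1 else 0) + binFrac w / 2

/-- Rational interactive protocols with messages over `α` and values in `β*`. The number of rounds
is not part of the data. -/
structure Protocol (α β : Type) where
  /-- Arthur's message function -/
  V : VInput α → List α
  /-- the reward, written as a finite binary fraction -/
  R : RInput α → List Bool
  /-- the value function -/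
  φ : ValInput α → List β
  V_polyTime : Nonempty (Turing.TM2ComputableInPolyTime encV (fun w : List α => w) V)
  R_polyTime : Nonempty (Turing.TM2ComputableInPolyTime encR (fun w : List Bool => w) R)
  φ_polyTime : Nonempty (Turing.TM2ComputableInPolyTime encVal (fun w : List β => w) φ)
  R_le_one : ∀ i, binFrac (R i) ≤ 1
  /-- bound on the length of Merlin's messages -/
  msgLen : Polynomial ℕ
  /-- length of each of Arthur's random strings -/
  coinLen : Polynomial ℕ

namespace Protocol

variable {α β : Type} (Q : Protocol α β) (k : ℕ) (x : List α)

/-- The messages that Merlin may send on input `x`. -/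
abbrev Msg : Type := {m : List α // m.length ≤ Q.msgLen.eval x.length}

/-- Arthur's private random strings `r₁, …, rₖ` on input `x`. -/
abbrev Coins : Type := Fin k → Fin (Q.coinLen.eval x.length) → Bool

variable {k x}

/-- The list of the random strings `r₁, …, rₖ`. -/
def coinList (r : Q.Coins k x) : List (List Bool) := List.ofFn fun i => List.ofFn (r i)

/-- The messages of the transcript `(m₁, a₁), …, (mᵢ, aᵢ)` in the order in which they are sent. -/
def flatten (τ : List (List α × List α)) : List (List α) := τ.flatMap fun p => [p.1, p.2]

/-- The transcript `τ` of the first `i` rounds, prolonged by a round in which Merlin sends `m` and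
Arthur, using `r₁, …, rᵢ₊₁`, answers. -/
def extend (r : Q.Coins k x) (τ : List (List α × List α)) (m : List α) :
    List (List α × List α) :=
  τ ++ [(m, Q.V (x, flatten τ ++ [m], (Q.coinList r).take (τ.length + 1)))]

/-- The transcript of the rounds in which Merlin sends the messages `ms` and Arthur's random
strings are `r`. -/
def play (r : Q.Coins k x) (ms : List (List α)) : List (List α × List α) :=
  ms.foldl (Q.extend r) []

variable (k x)

open scoped Classical in
/-- The random strings that are compatible with the transcript `τ`. -/
def compatible (τ : List (List α × List α)) : Finset (Q.Coins k x) :=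
  Finset.univ.filter fun r => Q.play r (τ.map Prod.fst) = τ

/-- The maximal expected reward, conditional on the transcript `τ` of the past rounds, when `j`
rounds remain. -/
def expectedReward : ℕ → List (List α × List α) → ℝ
  | 0, τ => 𝔼 r ∈ Q.compatible k x τ,
      binFrac (Q.R (x, (τ.map Prod.fst).zip (Q.coinList r)))
  | j + 1, τ => ⨆ m : Q.Msg x, 𝔼 r ∈ Q.compatible k x τ, expectedReward j (Q.extend r τ m)

/-- The maximal expected reward, conditional on the transcript `τ` of the past rounds, after Merlin
has sent `m` in the present round. -/
def expectedRewardOf (τ : List (List α × List α)) (m : List α) : ℝ :=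
  𝔼 r ∈ Q.compatible k x τ, Q.expectedReward k x (k - (τ.length + 1)) (Q.extend r τ m)

/-- After the transcript `τ`, the message `m` maximizes the expected reward. -/
def IsRationalMessage (τ : List (List α × List α)) (m : List α) : Prop :=
  m.length ≤ Q.msgLen.eval x.length ∧
    ∀ m' : Q.Msg x, Q.expectedRewardOf k x τ m' ≤ Q.expectedRewardOf k x τ m

/-- `f` is computed by the `k`-round protocol `Q`: for every input, all random strings of Arthur
and all Merlin's messages `m₁, …, mₖ`, each of which is rational after the transcript of the
rounds before it, the value computed is `f x`. The value does not depend on Arthur's last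
message. -/
def Computes (f : List α → List β) : Prop :=
  ∀ (x : List α) (r : Q.Coins k x) (ms : List (List α)), ms.length = k →
    (∀ (i : ℕ) (hi : i < ms.length), Q.IsRationalMessage k x (Q.play r (ms.take i)) ms[i]) →
      Q.φ (x, (flatten (Q.play r ms)).dropLast) = f x

end Protocol

/-- The class `FRMA[k]` of functions `α* → β*`. -/
def FRMA (α β : Type) (k : ℕ) : Set (List α → List β) :=
  {f | ∃ Q : Protocol α β, Q.Computes k f}

open scoped Classical in
/-- The class `DRMA[k]` of languages over `α`: the characteristic function is in `FRMA[k]`. -/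
def DRMA (α : Type) (k : ℕ) : Set (Set (List α)) :=
  {S | (fun x => [decide (x ∈ S)]) ∈ FRMA α Bool k}

end RationalProofs

end

/-! Merlin claims a bit `b` for the statement `x ∈ A`, and the reward is designed so that the true
claim has a strictly larger optimal expected reward than the false one. The advantage may be
exponentially small, because a rational Merlin maximizes exactly; this is the predicate `Gap`. It is
proved by induction on the level of the hierarchy in `exists_gap`, and `mem_DRMA_of_gap` turns it
into a protocol.

One level without oracle: Arthur draws a certificate `y` and pays if `b` agrees with the test `(x,
y) ∈ B`, so that the majority answer is the better one. Since a share of exactly one half counts as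
acceptance, `D` further coins declare the test positive if all of them are `false`. This tips the
balance at one half, but its probability `2^(-D)` is too small to lift a share below one half, which
is at most `1/2 - 2^(-q)/2` (`majority_gap`).

One level with oracle `C`: Arthur cannot ask `C`. He publishes his coins, so Merlin knows `y`, and
the next message lists the answers to the questions of the computation on `(x, y)`. With `ε =
2^(-D)`, the next coins stop the simulation at step `t` with probability `ε^t (1 - ε)`, for `t < D`.
If a question is being asked there, its answer becomes a claim about `C`, to be examined recursively
with the unread coins; otherwise the reward is 0. With the remaining probability `ε^D` the
computation is followed to its end and `b` is tested against the output. If `γ` is the gap for `C`,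
then a first false answer loses at least `(1 - ε) γ`, and everything after it is worth at most `ε`.
For large `D` truthful answers are therefore optimal (`stepValue_le_trueStepValue`). Their value is
an amount independent of `b` plus `ε^D` times the outcome of the test (`trueStepValue_eq`), which
leaves the gap `ε^D ε` (`gap_cons`).

Each examination uses the coins of one round together with the message and coins of the next, except
that the lowest level asks nothing and needs no further round. So `k` levels fit into `k` rounds.
Because all past coins are public, the conditional expectations in the definition of rationality are
iterated averages over fresh coins (`expectedReward_play`). For `k = 0` the value function decides
the language itself.

That the reward is computable in polynomial time (`rewardBit_polyTime`) is shown with a small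
language of structured stack programs, which are compiled to `FinTM2` machines and can run other
machines step by step. -/

noncomputable section

namespace RationalProofs

set_option linter.unusedSectionVars false

section

open Turing TM2.Stmt

/-! ### Structured stack programs -/

instance (tm : FinTM2) : Finite tm.Λ := @Finite.of_fintype _ tm.ΛFin
instance (tm : FinTM2) : Finite tm.σ := @Finite.of_fintype _ tm.σFin
instance (tm : FinTM2) : Fintype tm.K := tm.kFin
instance (tm : FinTM2) : Fintype tm.Λ := tm.ΛFin

/-- A stack machine, possibly with labels at which a question about the word on a query stack is
asked. -/
structure QueryTM (Γ₀ α : Type) where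
  tm : FinTM2
  inp : Γ₀ → tm.Γ tm.k₀
  outBit : tm.Γ tm.k₁ → Bool
  isAsk : tm.Λ → Bool
  yes : tm.Λ
  no : tm.Λ
  qs : tm.K
  letter : tm.Γ qs → α

/-- Configurations of the underlying machine. -/
abbrev QueryTM.Config {Γ₀ α : Type} (T : QueryTM Γ₀ α) : Type := TM2.Cfg T.tm.Γ T.tm.Λ T.tm.σ

/-- The work stacks of a program. -/
inductive Own where
  | tape | z | zt | acc | tmp | y | r | m | t | d
  deriving DecidableEq

instance : Fintype Own where
  elems := {.tape, .z, .zt, .acc, .tmp, .y, .r, .m, .t, .d}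
  complete o := by cases o <;> decide

/-- The registers of a program. -/
@[ext] structure Reg (α : Type) where
  reg : Option (Sym α)
  b : Bool
  tie : Bool
  go : Bool
  done : Bool
  res : Bool

/-- The initial contents of the registers. -/
def Reg.init (α : Type) : Reg α := ⟨none, false, false, false, false, false⟩

instance {α : Type} [Finite α] : Finite (Reg α) :=
  Finite.of_injective
    (fun v : Reg α => (v.reg, v.b, v.tie, v.go, v.done, v.res)) fun v w h => by
      simp only [Prod.mk.injEq] at h
      ext1 <;> tauto

variable {ι α β : Type} [DecidableEq ι] (M : ι → QueryTM (Sym α) α)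

/-- The stacks of a program: work stacks, the output stack, the stacks of the machines `M i`. -/
abbrev StackIx : Type := Own ⊕ Unit ⊕ Σ i, (M i).tm.K

/-- The alphabets of the stacks of a program. -/
abbrev StackAlph (β : Type) : StackIx M → Type
  | Sum.inl _ => Sym α
  | Sum.inr (Sum.inl _) => β
  | Sum.inr (Sum.inr p) => (M p.1).tm.Γ p.2

/-- The internal state of a program. -/
abbrev VarType : Type := Reg α × ∀ i, (M i).tm.σ × Option (M i).tm.Λ

/-- Program states. -/
@[ext] structure PState (β : Type) where
  v : Reg α
  own : Own → List (Sym α)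
  out : List β
  mach : ∀ i, (M i).Config

variable {M}

namespace PState

/-- The internal state of the stack machine that runs a program. -/
def var (s : PState M β) : VarType M := (s.v, fun i => ((s.mach i).var, (s.mach i).l))

/-- The stacks of the stack machine that runs a program. -/
def stk (s : PState M β) : ∀ k : StackIx M, List (StackAlph M β k)
  | Sum.inl o => s.own o
  | Sum.inr (Sum.inl _) => s.out
  | Sum.inr (Sum.inr p) => (s.mach p.1).stk p.2

/-- Replace the contents of a work stack. -/
def setOwn (s : PState M β) (o : Own) (l : List (Sym α)) : PState M β :=
  { s with own := Function.update s.own o l }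

/-- Change the registers. -/
def setV (s : PState M β) (v : Reg α) : PState M β := { s with v := v }

/-- Replace the output. -/
def setOut (s : PState M β) (l : List β) : PState M β := { s with out := l }

/-- Replace the configuration of a machine. -/
def setMach (s : PState M β) (i : ι) (c : (M i).Config) : PState M β :=
  { s with mach := Function.update s.mach i c }

section simp
variable (s : PState M β) (o o' : Own) (l l' : List (Sym α)) (v : Reg α) (u : List β) (i : ι)
  (c : (M i).Config)

@[simp] lemma setOwn_v : (s.setOwn o l).v = s.v := rfl
@[simp] lemma setOwn_own : (s.setOwn o l).own o' = if o' = o then l else s.own o' := by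
  simp [setOwn, Function.update_apply]
@[simp] lemma setOwn_out : (s.setOwn o l).out = s.out := rfl
@[simp] lemma setOwn_mach : (s.setOwn o l).mach = s.mach := rfl
@[simp] lemma setV_v : (s.setV v).v = v := rfl
@[simp] lemma setV_own : (s.setV v).own = s.own := rfl
@[simp] lemma setV_out : (s.setV v).out = s.out := rfl
@[simp] lemma setV_mach : (s.setV v).mach = s.mach := rfl
@[simp] lemma setOut_v : (s.setOut u).v = s.v := rfl
@[simp] lemma setOut_own : (s.setOut u).own = s.own := rfl
@[simp] lemma setOut_out : (s.setOut u).out = u := rfl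
@[simp] lemma setOut_mach : (s.setOut u).mach = s.mach := rfl
@[simp] lemma setMach_v : (s.setMach i c).v = s.v := rfl
@[simp] lemma setMach_own : (s.setMach i c).own = s.own := rfl
@[simp] lemma setMach_out : (s.setMach i c).out = s.out := rfl
@[simp] lemma setMach_mach_self : (s.setMach i c).mach i = c := by simp [setMach]
lemma setMach_mach_ne {j : ι} (h : j ≠ i) : (s.setMach i c).mach j = s.mach j := by
  simp [setMach, h]

@[simp] lemma var_setOwn : (s.setOwn o l).var = s.var := rfl
@[simp] lemma var_setOut : (s.setOut u).var = s.var := rfl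
lemma var_setV : (s.setV v).var = (v, s.var.2) := rfl
lemma var_setMach :
    (s.setMach i c).var = (s.var.1, Function.update s.var.2 i (c.var, c.l)) := by
  refine Prod.ext rfl (funext fun j => ?_)
  by_cases h : j = i
  · subst h; simp [var]
  · simp [var, h, setMach_mach_ne]
@[simp] lemma stk_setV : (s.setV v).stk = s.stk := by
  funext k; rcases k with k | k | k <;> rfl
lemma stk_setOwn : (s.setOwn o l).stk = Function.update s.stk (Sum.inl o) l := by
  funext k
  rcases k with k | k | k
  · by_cases h : k = o
    · subst h; simp [stk]
    · simp [stk, h]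
  · simp [stk]
  · simp [stk]
lemma stk_setOut : (s.setOut u).stk = Function.update s.stk (Sum.inr (Sum.inl ())) u := by
  funext k
  rcases k with k | k | k <;> simp [stk]
lemma stk_setMach {k : (M i).tm.K} {w : List ((M i).tm.Γ k)}
    (h : c.stk = Function.update (s.mach i).stk k w) :
    (s.setMach i c).stk = Function.update s.stk (Sum.inr (Sum.inr ⟨i, k⟩)) w := by
  funext k'
  rcases k' with k' | k' | ⟨j, k'⟩
  · simp [stk]
  · simp [stk]
  · by_cases hj : j = i
    · subst hj
      by_cases hk : k' = k
      · subst hk; simp [stk, h]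
      · simp [stk, h, hk]
    · rw [Function.update_of_ne (by simp [hj])]
      simp [stk, setMach_mach_ne _ _ _ hj]
lemma stk_setCtl (a : Option (M i).tm.Λ) (w : (M i).tm.σ) :
    (s.setMach i ⟨a, w, (s.mach i).stk⟩).stk = s.stk := by
  funext k'
  rcases k' with k' | k' | ⟨j, k'⟩
  · simp [stk]
  · simp [stk]
  · by_cases hj : j = i
    · subst hj; simp [stk]
    · simp [stk, setMach_mach_ne _ _ _ hj]

@[simp] lemma setOwn_setOwn : (s.setOwn o l).setOwn o l' = s.setOwn o l' := by
  simp [setOwn]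
@[simp] lemma setV_setV (v' : Reg α) : (s.setV v).setV v' = s.setV v' := rfl
@[simp] lemma setMach_setMach (c' : (M i).Config) :
    (s.setMach i c).setMach i c' = s.setMach i c' := by simp [setMach]
@[simp] lemma setOwn_self : s.setOwn o (s.own o) = s := by simp [setOwn]
@[simp] lemma setMach_self : s.setMach i (s.mach i) = s := by simp [setMach]

end simp

variable [Fintype ι]

/-- The total length of the stacks of a configuration. -/
def _root_.RationalProofs.QueryTM.csize {Γ₀ α : Type} {T : QueryTM Γ₀ α} (c : T.Config) : ℕ :=
  ∑ k, (c.stk k).length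

/-- The total length of all stacks. -/
def size (s : PState M β) : ℕ :=
  ∑ o, (s.own o).length + s.out.length + ∑ i, QueryTM.csize (s.mach i)

lemma own_le_size (s : PState M β) (o : Own) : (s.own o).length ≤ s.size := by
  have := Finset.single_le_sum (f := fun o => (s.own o).length) (fun _ _ => Nat.zero_le _)
    (Finset.mem_univ o)
  unfold size; omega

lemma csize_le_size (s : PState M β) (i : ι) : QueryTM.csize (s.mach i) ≤ s.size := by
  have := Finset.single_le_sum (f := fun i => QueryTM.csize (s.mach i)) (fun _ _ => Nat.zero_le _)
    (Finset.mem_univ i)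
  unfold size; omega

lemma _root_.RationalProofs.QueryTM.stk_le_csize {Γ₀ α : Type} {T : QueryTM Γ₀ α} (c : T.Config)
    (k : T.tm.K) : (c.stk k).length ≤ QueryTM.csize c :=
  Finset.single_le_sum (f := fun k => (c.stk k).length) (fun _ _ => Nat.zero_le _)
    (Finset.mem_univ k)

@[simp] lemma size_setV (s : PState M β) (v : Reg α) : (s.setV v).size = s.size := rfl

/-- The old length stands on the left because subtraction in `ℕ` is truncated. -/
lemma size_setOwn (s : PState M β) (o : Own) (l : List (Sym α)) :
    (s.setOwn o l).size + (s.own o).length = s.size + l.length := by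
  have h1 := Finset.add_sum_erase Finset.univ (fun o => (s.own o).length) (Finset.mem_univ o)
  have h2 := Finset.add_sum_erase Finset.univ (fun o' => ((s.setOwn o l).own o').length)
    (Finset.mem_univ o)
  have h3 : ∑ x ∈ Finset.univ.erase o, ((s.setOwn o l).own x).length =
      ∑ x ∈ Finset.univ.erase o, (s.own x).length :=
    Finset.sum_congr rfl fun x hx => by simp [(Finset.mem_erase.1 hx).1]
  simp only [setOwn_own, if_true] at h2 h3
  unfold size
  simp only [setOwn_own, setOwn_out, setOwn_mach] at h1 ⊢
  omega

lemma size_setOut (s : PState M β) (u : List β) :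
    (s.setOut u).size + s.out.length = s.size + u.length := by
  unfold size; simp; omega

lemma size_setMach (s : PState M β) (i : ι) (c : (M i).Config) :
    (s.setMach i c).size + QueryTM.csize (s.mach i) = s.size + QueryTM.csize c := by
  have h1 := Finset.add_sum_erase Finset.univ (fun i => QueryTM.csize (s.mach i))
    (Finset.mem_univ i)
  have h2 := Finset.add_sum_erase Finset.univ (fun j => QueryTM.csize ((s.setMach i c).mach j))
    (Finset.mem_univ i)
  have h3 : ∑ x ∈ Finset.univ.erase i, QueryTM.csize ((s.setMach i c).mach x) =
      ∑ x ∈ Finset.univ.erase i, QueryTM.csize (s.mach x) :=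
    Finset.sum_congr rfl fun x hx => by rw [setMach_mach_ne _ _ _ (Finset.mem_erase.1 hx).1]
  simp only [setMach_mach_self] at h2
  unfold size
  simp only [setMach_own, setMach_out] at h1 ⊢
  omega

end PState

/-- The total length of the stacks changes by update. -/
lemma QueryTM.csize_update {Γ₀ : Type} {T : QueryTM Γ₀ α} (c : T.Config) (l) (v)
    (k : T.tm.K) (w : List (T.tm.Γ k)) :
    csize (T := T) ⟨l, v, Function.update c.stk k w⟩ + (c.stk k).length = csize c + w.length := by
  have h1 := Finset.add_sum_erase Finset.univ (fun o => (c.stk o).length) (Finset.mem_univ k)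
  have h2 := Finset.add_sum_erase Finset.univ
    (fun o' => ((Function.update c.stk k w) o').length) (Finset.mem_univ k)
  have h3 : ∑ x ∈ Finset.univ.erase k, ((Function.update c.stk k w) x).length =
      ∑ x ∈ Finset.univ.erase k, (c.stk x).length :=
    Finset.sum_congr rfl fun x hx => by simp [(Finset.mem_erase.1 hx).1]
  simp only [Function.update_self] at h2
  unfold csize
  simp only at h1 ⊢
  omega

/-- The number of pushes in a statement. -/
def pushes {K : Type} {Γ : K → Type} {Λ σ : Type} : TM2.Stmt Γ Λ σ → ℕ
  | push _ _ q => pushes q + 1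
  | peek _ _ q => pushes q
  | pop _ _ q => pushes q
  | load _ q => pushes q
  | branch _ q₁ q₂ => pushes q₁ + pushes q₂
  | goto _ => 0
  | halt => 0

/-- A statement contains no loops, so its syntactic number of pushes bounds the growth. Both
branches are counted, which only enlarges the constant. -/
lemma QueryTM.csize_stepAux {Γ₀ : Type} {T : QueryTM Γ₀ α}
    (q : TM2.Stmt T.tm.Γ T.tm.Λ T.tm.σ) (l) (v) (S) :
    csize (T := T) (TM2.stepAux q v S) ≤ csize (T := T) ⟨l, v, S⟩ + pushes q := by
  induction q generalizing v S with
  | push k f q ih =>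
    have := csize_update (T := T) ⟨l, v, S⟩ l v k (f v :: S k)
    simp only [List.length_cons] at this
    have := ih v (Function.update S k (f v :: S k))
    simp only [TM2.stepAux, pushes]; omega
  | peek k f q ih => exact ih _ _
  | pop k f q ih =>
    have h := csize_update (T := T) ⟨l, v, S⟩ l (f v (S k).head?) k (S k).tail
    simp only [List.length_tail] at h
    have := ih (f v (S k).head?) (Function.update S k (S k).tail)
    simp only [TM2.stepAux, pushes]; omega
  | load f q ih => exact ih _ _
  | branch f q₁ q₂ ih₁ ih₂ =>
    have h1 := ih₁ v S
    have h2 := ih₂ v S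
    simp only [TM2.stepAux, pushes]
    cases f v <;> simp <;> omega
  | goto f => simp [TM2.stepAux, pushes, csize]
  | halt => simp [TM2.stepAux, pushes, csize]

/-- The most that one step of the machine can push. -/
def QueryTM.growth {Γ₀ : Type} (T : QueryTM Γ₀ α) : ℕ := ∑ l, pushes (T.tm.m l)

/-- One step of the machine; a halted machine idles. -/
def QueryTM.idleStep {Γ₀ : Type} {T : QueryTM Γ₀ α} (c : T.Config) : T.Config :=
  (TM2.step T.tm.m c).getD c

lemma QueryTM.csize_idleStep {Γ₀ : Type} {T : QueryTM Γ₀ α} (c : T.Config) :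
    csize (idleStep c) ≤ csize c + T.growth := by
  rcases c with ⟨_ | l, v, S⟩
  · simp [idleStep, TM2.step]
  · have h1 := csize_stepAux (T := T) (T.tm.m l) (some l) v S
    have h2 := Finset.single_le_sum (f := fun l => pushes (T.tm.m l)) (fun _ _ => Nat.zero_le _)
      (Finset.mem_univ l)
    simp only [idleStep, TM2.step, Option.getD_some, growth]
    omega

end

/-! ### Structured programs: semantics, compilation and running time. -/

section

open Turing TM2.Stmt

variable {ι α β : Type} [DecidableEq ι] [Fintype ι] {M : ι → QueryTM (Sym α) α}

/-- An elementary action: a transformation of program states that is performed by one statement. -/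
structure Act (M : ι → QueryTM (Sym α) α) (β : Type) where
  F : PState M β → PState M β
  stmt : TM2.Stmt (StackAlph M β) Unit (VarType M)
  spec : ∀ s, TM2.stepAux stmt s.var s.stk = ⟨some (), (F s).var, (F s).stk⟩
  growth : ℕ
  size_le : ∀ s, (F s).size ≤ s.size + growth

/-- Structured programs. -/
inductive Prog (M : ι → QueryTM (Sym α) α) (β : Type) where
  | act (a : Act M β)
  | seq (p q : Prog M β)
  | ite (c : VarType M → Bool) (p q : Prog M β)
  | loop (c : VarType M → Bool) (p : Prog M β)

/-- `Exec p s n s'`: the program `p`, started in `s`, stops after `n` steps in `s'`. -/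
inductive Exec : Prog M β → PState M β → ℕ → PState M β → Prop
  | act (a : Act M β) (s) : Exec (.act a) s 1 (a.F s)
  | seq {p q s n s' n' s''} : Exec p s n s' → Exec q s' n' s'' → Exec (.seq p q) s (n' + n) s''
  | iteT {c p q s n s'} : c s.var = true → Exec p s n s' → Exec (.ite c p q) s (n + 1) s'
  | iteF {c p q s n s'} : c s.var = false → Exec q s n s' → Exec (.ite c p q) s (n + 1) s'
  | loopF {c p s} : c s.var = false → Exec (.loop c p) s 1 s
  | loopT {c p s n s' n' s''} : c s.var = true → Exec p s n s' → Exec (.loop c p) s' n' s'' →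
      Exec (.loop c p) s (n' + n + 1) s''

namespace Prog

/-- The labels of a program. -/
def Lbl : Prog M β → Type
  | act _ => Unit
  | seq p q => Lbl p ⊕ Lbl q
  | ite _ p q => Option (Lbl p ⊕ Lbl q)
  | loop _ p => Option (Lbl p)

lemma finite_lbl : ∀ p : Prog M β, Finite p.Lbl
  | act _ => inferInstanceAs (Finite Unit)
  | seq p q => by
    have := finite_lbl p; have := finite_lbl q
    exact inferInstanceAs (Finite (Lbl p ⊕ Lbl q))
  | ite _ p q => by
    have := finite_lbl p; have := finite_lbl q
    exact inferInstanceAs (Finite (Option (Lbl p ⊕ Lbl q)))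
  | loop _ p => by
    have := finite_lbl p
    exact inferInstanceAs (Finite (Option (Lbl p)))

/-- The label at which a program starts. -/
def entry : ∀ p : Prog M β, p.Lbl
  | act _ => ()
  | seq p _ => Sum.inl (entry p)
  | ite _ _ _ => none
  | loop _ _ => none

/-- Make every jump of a statement a jump to `x`. -/
def relabel {K Λ Λ' σ : Type} {Γ : K → Type} (x : Λ') : TM2.Stmt Γ Λ σ → TM2.Stmt Γ Λ' σ
  | push k f q => push k f (relabel x q)
  | peek k f q => peek k f (relabel x q)
  | pop k f q => pop k f (relabel x q)
  | load f q => load f (relabel x q)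
  | branch f q₁ q₂ => branch f (relabel x q₁) (relabel x q₂)
  | goto _ => goto fun _ => x
  | halt => halt

lemma stepAux_relabel {K Λ Λ' σ : Type} {Γ : K → Type} [DecidableEq K] (x : Λ')
    (q : TM2.Stmt Γ Λ σ) (v S) :
    TM2.stepAux (relabel x q) v S = ⟨(TM2.stepAux q v S).l.map fun _ => x,
      (TM2.stepAux q v S).var, (TM2.stepAux q v S).stk⟩ := by
  induction q generalizing v S with
  | branch f q₁ q₂ ih₁ ih₂ =>
    simp only [relabel, TM2.stepAux]
    cases f v
    · exact ih₂ _ _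
    · exact ih₁ _ _
  | goto f => simp [relabel]
  | halt => simp [relabel]
  | _ => simp only [relabel, TM2.stepAux]; simp [*]

/-- The statements of a program, its labels being renamed by `e`; it ends with a jump to `x`. -/
def code {L : Type} : ∀ p : Prog M β, (p.Lbl → L) → L → p.Lbl →
    TM2.Stmt (StackAlph M β) L (VarType M)
  | act a, _, x, _ => relabel x a.stmt
  | seq p q, e, _, Sum.inl l => code p (e ∘ Sum.inl) (e (Sum.inr (entry q))) l
  | seq _ q, e, x, Sum.inr l => code q (e ∘ Sum.inr) x l
  | ite c p q, e, _, none => branch c (goto fun _ => e (some (Sum.inl (entry p))))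
      (goto fun _ => e (some (Sum.inr (entry q))))
  | ite _ p _, e, x, some (Sum.inl l) => code p (e ∘ some ∘ Sum.inl) x l
  | ite _ _ q, e, x, some (Sum.inr l) => code q (e ∘ some ∘ Sum.inr) x l
  | loop c p, e, x, none => branch c (goto fun _ => e (some (entry p))) (goto fun _ => x)
  | loop _ p, e, _, some l => code p (e ∘ some) (e none) l

/-- The machine that runs a program performs the steps of its executions. -/
lemma steps_of_exec {L : Type} {p : Prog M β} {s s' : PState M β} {n : ℕ} (h : Exec p s n s')
    (m : L → TM2.Stmt (StackAlph M β) L (VarType M)) (e : p.Lbl → L) (x : L)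
    (hm : ∀ l, m (e l) = code p e x l) :
    (flip bind (TM2.step m))^[n] (some ⟨some (e p.entry), s.var, s.stk⟩) =
      some ⟨some x, s'.var, s'.stk⟩ := by
  induction h generalizing x with
  | act a s =>
    change some (TM2.stepAux (m (e ())) s.var s.stk) = _
    rw [hm ()]
    change some (TM2.stepAux (relabel x a.stmt) s.var s.stk) = _
    rw [stepAux_relabel, a.spec]; rfl
  | @seq p q s n s' n' s'' _ _ ih₁ ih₂ =>
    rw [Function.iterate_add_apply]
    exact (congrArg _ (ih₁ (e ∘ Sum.inl) (e (Sum.inr (entry q))) fun l => hm (Sum.inl l))).trans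
      (ih₂ (e ∘ Sum.inr) x fun l => hm (Sum.inr l))
  | @iteT c p q s n s' hc _ ih =>
    rw [Function.iterate_succ_apply]
    refine Eq.trans (congrArg _ ?_) (ih (e ∘ some ∘ Sum.inl) x fun l => hm (some (Sum.inl l)))
    change some (TM2.stepAux (m (e none)) s.var s.stk) = _
    rw [hm none]; simp only [code, TM2.stepAux, hc, cond_true]; rfl
  | @iteF c p q s n s' hc _ ih =>
    rw [Function.iterate_succ_apply]
    refine Eq.trans (congrArg _ ?_) (ih (e ∘ some ∘ Sum.inr) x fun l => hm (some (Sum.inr l)))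
    change some (TM2.stepAux (m (e none)) s.var s.stk) = _
    rw [hm none]; simp only [code, TM2.stepAux, hc, cond_false]; rfl
  | @loopF c p s hc =>
    change some (TM2.stepAux (m (e none)) s.var s.stk) = _
    rw [hm none]; simp only [code, TM2.stepAux, hc, cond_false]
  | @loopT c p s n s' n' s'' hc _ _ ih₁ ih₂ =>
    rw [Function.iterate_succ_apply, Function.iterate_add_apply]
    refine Eq.trans (congrArg _ ?_) (ih₂ e x hm)
    refine Eq.trans (congrArg _ ?_) (ih₁ (e ∘ some) (e none) fun l => hm (some l))
    change some (TM2.stepAux (m (e none)) s.var s.stk) = _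
    rw [hm none]; simp only [code, TM2.stepAux, hc, cond_true]; rfl

end Prog

/-- `p`, started in `s`, stops after at most `n` steps in `s'`. -/
def Runs (p : Prog M β) (s : PState M β) (n : ℕ) (s' : PState M β) : Prop :=
  ∃ t ≤ n, Exec p s t s'

/-- The program `p` leads from the state `f x` to the state `g x` in time polynomial in the size of
`f x`. -/
def PolyTime {X : Type*} (p : Prog M β) (f g : X → PState M β) : Prop :=
  ∃ P : Polynomial ℕ, ∀ x, Runs p (f x) (P.eval (f x).size) (g x)

lemma Runs.mono {p : Prog M β} {s s' : PState M β} {n n' : ℕ} (h : Runs p s n s')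
    (hn : n ≤ n') : Runs p s n' s' :=
  let ⟨t, ht, h⟩ := h; ⟨t, ht.trans hn, h⟩

lemma Runs.to {p : Prog M β} {s s' s'' : PState M β} {n n' : ℕ} (h : Runs p s n s')
    (hn : n ≤ n') (hs : s' = s'') : Runs p s n' s'' :=
  hs ▸ h.mono hn

lemma Runs.conv {p : Prog M β} {s₁ s s' s'' : PState M β} {n n' : ℕ} (h : Runs p s n s')
    (hs₁ : s = s₁) (hn : n ≤ n') (hs : s' = s'') : Runs p s₁ n' s'' :=
  hs₁ ▸ hs ▸ h.mono hn

lemma Runs.act (a : Act M β) (s : PState M β) : Runs (.act a) s 1 (a.F s) :=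
  ⟨1, le_rfl, .act a s⟩

lemma Runs.seq {p q : Prog M β} {s s' s'' : PState M β} {n n' : ℕ} (h : Runs p s n s')
    (h' : Runs q s' n' s'') : Runs (.seq p q) s (n + n') s'' :=
  let ⟨t, ht, h⟩ := h; let ⟨t', ht', h'⟩ := h'; ⟨t' + t, by omega, h.seq h'⟩

lemma Runs.iteT {c p q} {s s' : PState M β} {n : ℕ} (hc : c s.var = true) (h : Runs p s n s') :
    Runs (.ite c p q) s (n + 1) s' :=
  let ⟨t, ht, h⟩ := h; ⟨t + 1, by omega, .iteT hc h⟩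

lemma Runs.iteF {c p q} {s s' : PState M β} {n : ℕ} (hc : c s.var = false) (h : Runs q s n s') :
    Runs (.ite c p q) s (n + 1) s' :=
  let ⟨t, ht, h⟩ := h; ⟨t + 1, by omega, .iteF hc h⟩

lemma Runs.loopF {c p} {s : PState M β} (hc : c s.var = false) : Runs (.loop c p) s 1 s :=
  ⟨1, le_rfl, .loopF hc⟩

lemma Runs.loopT {c p} {s s' s'' : PState M β} {n n' : ℕ} (hc : c s.var = true)
    (h : Runs p s n s') (h' : Runs (.loop c p) s' n' s'') :
    Runs (.loop c p) s (n + n' + 1) s'' :=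
  let ⟨t, ht, h⟩ := h; let ⟨t', ht', h'⟩ := h'; ⟨t' + t + 1, by omega, .loopT hc h h'⟩

/-- The most that one step of a program can push. -/
def Prog.growth : Prog M β → ℕ
  | .act a => a.growth
  | .seq p q => p.growth + q.growth
  | .ite _ p q => p.growth + q.growth
  | .loop _ p => p.growth

/-- A step pushes at most `growth` symbols, so a polynomial time bound gives a polynomial bound for
the final size. This is what makes time bounds compose. -/
lemma Exec.size_le {p : Prog M β} {s s' : PState M β} {n : ℕ} (h : Exec p s n s') :
    s'.size ≤ s.size + p.growth * n := by
  induction h with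
  | act a s => simpa [Prog.growth] using a.size_le s
  | seq _ _ ih₁ ih₂ => simp only [Prog.growth]; nlinarith
  | iteT _ _ ih => simp only [Prog.growth]; nlinarith
  | iteF _ _ ih => simp only [Prog.growth]; nlinarith
  | loopF _ => simp
  | loopT _ _ _ ih₁ ih₂ => simp only [Prog.growth] at *; nlinarith

lemma Runs.size_le {p : Prog M β} {s s' : PState M β} {n : ℕ} (h : Runs p s n s') :
    s'.size ≤ s.size + p.growth * n :=
  let ⟨_, ht, h⟩ := h; h.size_le.trans (by gcongr)

lemma eval_mono (P : Polynomial ℕ) {m n : ℕ} (h : m ≤ n) : P.eval m ≤ P.eval n := by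
  simp only [Polynomial.eval_eq_sum, Polynomial.sum]
  gcongr

lemma PolyTime.act {X : Type*} (a : Act M β) {f g : X → PState M β} (h : ∀ x, a.F (f x) = g x) :
    PolyTime (.act a) f g :=
  ⟨1, fun x => by simpa [h] using Runs.act a (f x)⟩

/-- The second program starts in a state of size at most `X + growth * P`, and polynomials over `ℕ`
are monotone, so its time bound is composed with this polynomial. -/
lemma PolyTime.seq {X : Type*} {p q : Prog M β} {f g h : X → PState M β} (hp : PolyTime p f g)
    (hq : PolyTime q g h) : PolyTime (.seq p q) f h := by
  obtain ⟨P, hP⟩ := hp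
  obtain ⟨Q, hQ⟩ := hq
  refine ⟨P + Q.comp (.X + .C p.growth * P), fun x => ((hP x).seq (hQ x)).mono ?_⟩
  simp only [Polynomial.eval_add, Polynomial.eval_comp, Polynomial.eval_mul, Polynomial.eval_C,
    Polynomial.eval_X]
  exact Nat.add_le_add_left (eval_mono _ (hP x).size_le) _

/-- Each branch has to be correct only on the inputs that lead to it, hence the subtypes. -/
lemma PolyTime.ite {X : Type*} {c : VarType M → Bool} {p q : Prog M β} {f g : X → PState M β}
    (hp : PolyTime p (fun x : {x // c (f x).var = true} => f x) (fun x => g x))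
    (hq : PolyTime q (fun x : {x // c (f x).var = false} => f x) (fun x => g x)) :
    PolyTime (.ite c p q) f g := by
  obtain ⟨P, hP⟩ := hp
  obtain ⟨Q, hQ⟩ := hq
  refine ⟨P + Q + 1, fun x => ?_⟩
  cases hc : c (f x).var with
  | true => exact (Runs.iteT hc (hP ⟨x, hc⟩)).mono (by simp)
  | false => exact (Runs.iteF hc (hQ ⟨x, hc⟩)).mono (by simp)

lemma PolyTime.comp {X Y : Type*} {p : Prog M β} {f g : X → PState M β} (h : PolyTime p f g)
    (e : Y → X) : PolyTime p (fun y => f (e y)) (fun y => g (e y)) :=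
  let ⟨P, hP⟩ := h; ⟨P, fun y => hP (e y)⟩

lemma PolyTime.congr {X : Type*} {p : Prog M β} {f g f' g' : X → PState M β} (h : PolyTime p f g)
    (hf : ∀ x, f x = f' x) (hg : ∀ x, g x = g' x) : PolyTime p f' g' := by
  rwa [← funext hf, ← funext hg]

/-- The state in which a program starts on a given input. -/
def PState.initial (M : ι → QueryTM (Sym α) α) (β : Type) (l : List (Sym α)) : PState M β where
  v := Reg.init α
  own := fun o => if o = .tape then l else []
  out := []
  mach := fun i => ⟨none, (M i).tm.initialState, fun _ => []⟩

lemma PState.size_initial (l : List (Sym α)) : (PState.initial M β l).size = l.length := by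
  have : ∀ o : Own, (if o = .tape then l else []).length = if o = .tape then l.length else 0 := by
    intro o; split_ifs <;> rfl
  simp [PState.size, PState.initial, QueryTM.csize, this]

/-- The machine that runs a program. -/
def Prog.toFinTM2 [Finite α] (p : Prog M β) : FinTM2 where
  K := StackIx M
  k₀ := Sum.inl .tape
  k₁ := Sum.inr (Sum.inl ())
  Γ := StackAlph M β
  Λ := Option p.Lbl
  main := some p.entry
  ΛFin := have := p.finite_lbl; Fintype.ofFinite _
  σ := VarType M
  initialState := (PState.initial M β []).var
  σFin := Fintype.ofFinite _
  Γk₀Fin := Fintype.ofFinite (Sym α)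
  m
    | none => halt
    | some l => p.code some none l

/-- A function is computable in polynomial time if it is computed by a program. -/
lemma Prog.computable [Finite α] {γ δ : Type} (enc : γ → List (Sym α)) (dec : δ → List β)
    (f : γ → δ) (p : Prog M β) (P : Polynomial ℕ)
    (h : ∀ i, Runs p (PState.initial M β (enc i)) (P.eval (enc i).length)
      ((PState.initial M β []).setOut (dec (f i)))) :
    Nonempty (TM2ComputableInPolyTime enc dec f) := by
  -- The additional step is the `halt` at the exit label `none`.
  refine ⟨⟨⟨p.toFinTM2, Equiv.refl _, Equiv.refl _⟩, P + 1, fun i => ?_⟩⟩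
  choose t ht he using h
  refine ⟨⟨t i + 1, ?_⟩, by simpa using ht i⟩
  have h1 := Prog.steps_of_exec (he i) p.toFinTM2.m some none (fun l => rfl)
  have h0 : initList p.toFinTM2 ((enc i).map (Equiv.refl (Sym α)).invFun) =
      ⟨some (some p.entry), (PState.initial M β (enc i)).var,
        (PState.initial M β (enc i)).stk⟩ := by
    simp only [initList]
    congr 1
    funext k
    rcases k with k | k | k
    · by_cases hk : k = .tape
      · subst hk
        simp [PState.stk, PState.initial, Prog.toFinTM2]
        rfl
      · simp [PState.stk, PState.initial, hk, Prog.toFinTM2]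
    · simp [PState.stk, PState.initial, Prog.toFinTM2]
    · simp [PState.stk, PState.initial, Prog.toFinTM2]
  have h2 : haltList p.toFinTM2 ((dec (f i)).map (Equiv.refl β).invFun) =
      ⟨none, ((PState.initial M β []).setOut (dec (f i))).var,
        ((PState.initial M β []).setOut (dec (f i))).stk⟩ := by
    simp only [haltList]
    congr 1
    funext k
    rcases k with k | k | k
    · simp [PState.stk, PState.initial, Prog.toFinTM2]
    · simp [PState.stk, Prog.toFinTM2]
      rfl
    · simp [PState.stk, PState.initial, Prog.toFinTM2]
  rw [Function.iterate_succ_apply']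
  change flip bind p.toFinTM2.step ((flip bind (TM2.step p.toFinTM2.m))^[t i] (some (initList
    p.toFinTM2 ((enc i).map (Equiv.refl (Sym α)).invFun)))) =
      some (haltList p.toFinTM2 ((dec (f i)).map (Equiv.refl β).invFun))
  rw [h0, h2]
  exact congrArg (flip bind p.toFinTM2.step) h1

end

section

open Turing TM2.Stmt

variable {ι α β : Type} [DecidableEq ι] [Fintype ι] {M : ι → QueryTM (Sym α) α}

/-! ### Elementary actions -/

namespace Act

/-- Pop a symbol from a work stack. -/
def pop (o : Own) (f : Reg α → Option (Sym α) → Reg α) : Act M β where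
  F s := (s.setOwn o (s.own o).tail).setV (f s.v (s.own o).head?)
  stmt := TM2.Stmt.pop (Sum.inl o) (fun v x => (f v.1 x, v.2)) (goto fun _ => ())
  spec s := by
    simp [PState.var_setV, PState.stk_setOwn]
    simp [PState.stk, PState.var]
  growth := 0
  size_le s := by
    have := s.size_setOwn o (s.own o).tail
    simp at this ⊢
    omega

/-- Push a symbol, if there is one, on a work stack. -/
def push (o : Own) (f : Reg α → Option (Sym α)) : Act M β where
  F s := s.setOwn o ((f s.v).toList ++ s.own o)
  stmt := branch (fun v => (f v.1).isSome)
    -- The default symbol is never pushed, since the branch has found a symbol.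
    (TM2.Stmt.push (Sum.inl o) (fun v => (f v.1).getD (Sum.inl none)) (goto fun _ => ()))
    (goto fun _ => ())
  spec s := by
    have : s.var.1 = s.v := rfl
    cases h : f s.v <;> simp [this, h, PState.stk_setOwn] <;> simp [PState.stk]
  growth := 1
  size_le s := by
    have := s.size_setOwn o ((f s.v).toList ++ s.own o)
    cases h : f s.v <;> simp [h] at this ⊢ <;> omega

/-- Change the registers. -/
def load (f : Reg α → Reg α) : Act M β where
  F s := s.setV (f s.v)
  stmt := TM2.Stmt.load (fun v => (f v.1, v.2)) (goto fun _ => ())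
  spec s := by simp [PState.var_setV]; rfl
  growth := 0
  size_le s := by simp

/-- Push a symbol on the output stack. -/
def out (f : Reg α → β) : Act M β where
  F s := s.setOut (f s.v :: s.out)
  stmt := TM2.Stmt.push (Sum.inr (Sum.inl ())) (fun v => f v.1) (goto fun _ => ())
  spec s := by
    simp [PState.stk_setOut]
    simp [PState.stk, PState.var]
  growth := 1
  size_le s := by
    have := s.size_setOut (f s.v :: s.out)
    simp at this ⊢; omega

/-- Push a symbol, if there is one, on the input stack of a machine. -/
def feed (i : ι) (f : Reg α → Option (Sym α)) : Act M β where
  F s := s.setMach i ⟨(s.mach i).l, (s.mach i).var, Function.update (s.mach i).stk (M i).tm.k₀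
    (((f s.v).map (M i).inp).toList ++ (s.mach i).stk (M i).tm.k₀)⟩
  stmt := branch (fun v => (f v.1).isSome)
    (TM2.Stmt.push (Sum.inr (Sum.inr ⟨i, (M i).tm.k₀⟩))
      (fun v => (M i).inp ((f v.1).getD (Sum.inl none))) (goto fun _ => ()))
    (goto fun _ => ())
  spec s := by
    have : s.var.1 = s.v := rfl
    cases h : f s.v
    · have e : s.setMach i ⟨(s.mach i).l, (s.mach i).var, (s.mach i).stk⟩ = s := s.setMach_self i
      simp [this, h, e]
    · simp only [TM2.stepAux, this, h, Option.isSome_some, cond_true, Option.getD_some,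
        Option.map_some, Option.toList_some, List.singleton_append]
      rw [PState.stk_setMach _ _ _ rfl, PState.var_setMach]
      simp only [TM2.Cfg.mk.injEq, true_and]
      refine ⟨Prod.ext rfl ?_, rfl⟩
      simp [PState.var]
  growth := 1
  size_le s := by
    have h1 := s.size_setMach i ⟨(s.mach i).l, (s.mach i).var, Function.update (s.mach i).stk
      (M i).tm.k₀ (((f s.v).map (M i).inp).toList ++ (s.mach i).stk (M i).tm.k₀)⟩
    have h2 := QueryTM.csize_update (s.mach i) (s.mach i).l (s.mach i).var (M i).tm.k₀
      (((f s.v).map (M i).inp).toList ++ (s.mach i).stk (M i).tm.k₀)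
    cases h : f s.v <;> simp [h] at h1 h2 ⊢ <;> omega

/-- Pop a symbol from a stack of a machine. -/
def popMach (i : ι) (k : (M i).tm.K) (f : Reg α → Option ((M i).tm.Γ k) → Reg α) : Act M β where
  F s := (s.setMach i ⟨(s.mach i).l, (s.mach i).var,
    Function.update (s.mach i).stk k ((s.mach i).stk k).tail⟩).setV
      (f s.v ((s.mach i).stk k).head?)
  stmt := TM2.Stmt.pop (Sum.inr (Sum.inr ⟨i, k⟩)) (fun v x => (f v.1 x, v.2)) (goto fun _ => ())
  spec s := by
    simp only [TM2.stepAux, PState.stk_setV, PState.var_setV]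
    rw [PState.stk_setMach _ _ _ rfl, PState.var_setMach]
    simp only [TM2.Cfg.mk.injEq, true_and]
    refine ⟨Prod.ext rfl ?_, rfl⟩
    simp [PState.var]
  growth := 0
  size_le s := by
    have h1 := s.size_setMach i ⟨(s.mach i).l, (s.mach i).var, Function.update (s.mach i).stk
      k ((s.mach i).stk k).tail⟩
    have h2 := QueryTM.csize_update (s.mach i) (s.mach i).l (s.mach i).var k
      ((s.mach i).stk k).tail
    simp at h1 h2 ⊢; omega

/-- Change the control of a machine. -/
def ctl (i : ι) (f : Reg α → (M i).tm.σ → Option (M i).tm.Λ → (M i).tm.σ × Option (M i).tm.Λ) :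
    Act M β where
  F s := s.setMach i ⟨(f s.v (s.mach i).var (s.mach i).l).2, (f s.v (s.mach i).var (s.mach i).l).1,
    (s.mach i).stk⟩
  stmt := TM2.Stmt.load (fun v => (v.1, Function.update v.2 i (f v.1 (v.2 i).1 (v.2 i).2)))
    (goto fun _ => ())
  spec s := by
    simp only [TM2.stepAux, TM2.Cfg.mk.injEq, true_and]
    rw [PState.stk_setCtl, PState.var_setMach]
    exact ⟨rfl, rfl⟩
  growth := 0
  size_le s := by
    have h1 := s.size_setMach i ⟨(f s.v (s.mach i).var (s.mach i).l).2,
      (f s.v (s.mach i).var (s.mach i).l).1, (s.mach i).stk⟩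
    simp only [QueryTM.csize] at h1
    omega

/-- A statement of a machine, as a statement of a program. -/
def embed (β : Type) (i : ι) : TM2.Stmt (M i).tm.Γ (M i).tm.Λ (M i).tm.σ →
    TM2.Stmt (StackAlph M β) Unit (VarType M)
  | TM2.Stmt.push k f q => TM2.Stmt.push (Sum.inr (Sum.inr ⟨i, k⟩)) (fun v => f (v.2 i).1) (embed β i q)
  | peek k f q => peek (Sum.inr (Sum.inr ⟨i, k⟩))
      (fun v x => (v.1, Function.update v.2 i (f (v.2 i).1 x, (v.2 i).2))) (embed β i q)
  | TM2.Stmt.pop k f q => TM2.Stmt.pop (Sum.inr (Sum.inr ⟨i, k⟩))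
      (fun v x => (v.1, Function.update v.2 i (f (v.2 i).1 x, (v.2 i).2))) (embed β i q)
  | TM2.Stmt.load f q => TM2.Stmt.load
      (fun v => (v.1, Function.update v.2 i (f (v.2 i).1, (v.2 i).2))) (embed β i q)
  | branch f q₁ q₂ => branch (fun v => f (v.2 i).1) (embed β i q₁) (embed β i q₂)
  | goto f => TM2.Stmt.load
      (fun v => (v.1, Function.update v.2 i ((v.2 i).1, some (f (v.2 i).1)))) (goto fun _ => ())
  | halt => TM2.Stmt.load
      (fun v => (v.1, Function.update v.2 i ((v.2 i).1, none))) (goto fun _ => ())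

/-- Label and internal state of machine `i` are kept in the component `v.2 i` of the program's own
state. A jump or a halt of the machine thus becomes an assignment, and the embedded statement always
ends with the same jump. -/
lemma stepAux_embed (i : ι) (q : TM2.Stmt (M i).tm.Γ (M i).tm.Λ (M i).tm.σ) (s : PState M β) :
    TM2.stepAux (embed β i q) s.var s.stk = ⟨some (),
      (s.setMach i (TM2.stepAux q (s.mach i).var (s.mach i).stk)).var,
      (s.setMach i (TM2.stepAux q (s.mach i).var (s.mach i).stk)).stk⟩ := by
  induction q generalizing s with
  | push k f q ih =>
    have h := ih (s.setMach i ⟨(s.mach i).l, (s.mach i).var,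
      Function.update (s.mach i).stk k (f (s.mach i).var :: (s.mach i).stk k)⟩)
    rw [PState.stk_setMach s i _ rfl, PState.var_setMach s] at h
    simp only [PState.setMach_mach_self, PState.setMach_setMach] at h
    rw [TM2.stepAux, ← h, embed, TM2.stepAux]
    congr 1
    exact Prod.ext rfl (by simp [PState.var])
  | peek k f q ih =>
    have h := ih (s.setMach i ⟨(s.mach i).l, f (s.mach i).var ((s.mach i).stk k).head?,
      (s.mach i).stk⟩)
    rw [PState.stk_setCtl, PState.var_setMach s] at h
    simp only [PState.setMach_mach_self, PState.setMach_setMach] at h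
    rw [TM2.stepAux, ← h, embed, TM2.stepAux]
    rfl
  | pop k f q ih =>
    have h := ih (s.setMach i ⟨(s.mach i).l, f (s.mach i).var ((s.mach i).stk k).head?,
      Function.update (s.mach i).stk k ((s.mach i).stk k).tail⟩)
    rw [PState.stk_setMach s i _ rfl, PState.var_setMach s] at h
    simp only [PState.setMach_mach_self, PState.setMach_setMach] at h
    rw [TM2.stepAux, ← h, embed, TM2.stepAux]
    rfl
  | load f q ih =>
    have h := ih (s.setMach i ⟨(s.mach i).l, f (s.mach i).var, (s.mach i).stk⟩)
    rw [PState.stk_setCtl, PState.var_setMach s] at h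
    simp only [PState.setMach_mach_self, PState.setMach_setMach] at h
    rw [TM2.stepAux, ← h, embed, TM2.stepAux]
    rfl
  | branch f q₁ q₂ ih₁ ih₂ =>
    have : (s.var.2 i).1 = (s.mach i).var := rfl
    simp only [embed, TM2.stepAux, this]
    cases f (s.mach i).var
    · exact ih₂ s
    · exact ih₁ s
  | goto f =>
    simp only [embed, TM2.stepAux]
    rw [PState.stk_setCtl, PState.var_setMach]
    rfl
  | halt =>
    simp only [embed, TM2.stepAux]
    rw [PState.stk_setCtl, PState.var_setMach]
    rfl

open scoped Classical in
/-- Select the statement that belongs to the present label of a machine. -/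
def select (β : Type) (i : ι) :
    List (M i).tm.Λ → TM2.Stmt (StackAlph M β) Unit (VarType M)
  | [] => goto fun _ => ()
  | l :: ls => branch (fun v => decide ((v.2 i).2 = some l)) (embed β i ((M i).tm.m l))
      (select β i ls)

/-- The labels are tried in turn. If none of them is the present one, the hypothesis leaves only a
halted machine, for which `idleStep` is the identity. -/
lemma stepAux_select (i : ι) (ls : List (M i).tm.Λ) (s : PState M β)
    (h : ∀ l, (s.mach i).l = some l → l ∈ ls) :
    TM2.stepAux (select β i ls) s.var s.stk = ⟨some (),
      (s.setMach i (QueryTM.idleStep (s.mach i))).var,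
      (s.setMach i (QueryTM.idleStep (s.mach i))).stk⟩ := by
  induction ls with
  | nil =>
    have hl : (s.mach i).l = none := by
      cases hl : (s.mach i).l with
      | none => rfl
      | some l => simpa using h l hl
    have : QueryTM.idleStep (s.mach i) = s.mach i := by
      rcases hc : s.mach i with ⟨_ | l, v, S⟩
      · rfl
      · simp [hc] at hl
    simp [select, this]
  | cons l ls ih =>
    have hv : (s.var.2 i).2 = (s.mach i).l := rfl
    by_cases hl : (s.mach i).l = some l
    · have : QueryTM.idleStep (s.mach i) =
          TM2.stepAux ((M i).tm.m l) (s.mach i).var (s.mach i).stk := by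
        rcases hc : s.mach i with ⟨_ | l', v, S⟩
        · simp [hc] at hl
        · simp only [hc, Option.some.injEq] at hl
          subst hl; rfl
      simp only [select, TM2.stepAux, hv, hl, decide_true, cond_true, this, stepAux_embed]
    · simp only [select, TM2.stepAux, hv, hl, decide_false, cond_false]
      exact ih fun l' hl' => (List.mem_cons.1 (h l' hl')).resolve_left fun e =>
        hl (e ▸ hl')

/-- Perform a step of a machine. -/
def tick (i : ι) : Act M β where
  F s := s.setMach i (QueryTM.idleStep (s.mach i))
  stmt := select β i Finset.univ.toList
  spec s := stepAux_select i _ s fun l _ => by simp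
  growth := (M i).growth
  size_le s := by
    have h1 := s.size_setMach i (QueryTM.idleStep (s.mach i))
    have h2 := QueryTM.csize_idleStep (s.mach i)
    omega

end Act

end

section

open Turing

variable {ι α β : Type} [DecidableEq ι] [Fintype ι] {M : ι → QueryTM (Sym α) α}

/-! ### Basic programs -/

/-- Store a symbol in the main register. -/
def Reg.setReg (v : Reg α) (x : Option (Sym α)) : Reg α := { v with reg := x }

@[simp] lemma Reg.setReg_reg (v : Reg α) (x) : (v.setReg x).reg = x := rfl
@[simp] lemma Reg.setReg_setReg (v : Reg α) (x y) : (v.setReg x).setReg y = v.setReg y := rfl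
@[simp] lemma Reg.setReg_b (v : Reg α) (x) : (v.setReg x).b = v.b := rfl
@[simp] lemma Reg.setReg_tie (v : Reg α) (x) : (v.setReg x).tie = v.tie := rfl
@[simp] lemma Reg.setReg_go (v : Reg α) (x) : (v.setReg x).go = v.go := rfl
@[simp] lemma Reg.setReg_done (v : Reg α) (x) : (v.setReg x).done = v.done := rfl
@[simp] lemma Reg.setReg_res (v : Reg α) (x) : (v.setReg x).res = v.res := rfl
lemma Reg.setReg_of_eq {v : Reg α} {x} (h : v.reg = x) : v.setReg x = v := by subst h; rfl

/-- The symbol used to write numbers in unary. -/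
def mark : Sym α := Sum.inl none

lemma PState.eq_of {s s' : PState M β} (hv : s.v = s'.v) (hown : ∀ o, s.own o = s'.own o)
    (hout : s.out = s'.out) (hmach : s.mach = s'.mach) : s = s' :=
  PState.ext hv (funext hown) hout hmach

namespace Prog

/-- Do nothing. -/
def nop : Prog M β := .act (Act.load id)

/-- Pop a symbol into the main register. -/
def popR (o : Own) : Prog M β := .act (Act.pop o Reg.setReg)

/-- Push the main register. -/
def pushR (o : Own) : Prog M β := .act (Act.push o Reg.reg)

/-- Push a fixed symbol. -/
def pushC (o : Own) (x : Sym α) : Prog M β := .act (Act.push o fun _ => some x)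

/-- Is there a symbol in the main register? -/
def isReg (v : VarType M) : Bool := v.1.reg.isSome

/-- Empty a work stack, running `body` for every symbol. -/
def drain (o : Own) (body : Prog M β) : Prog M β :=
  .seq (popR o) (.loop isReg (.seq body (popR o)))

end Prog

open Prog

/-- The state after a symbol has been popped into the main register. -/
def PState.popped (s : PState M β) (o : Own) (x : Option (Sym α)) (l : List (Sym α)) :
    PState M β :=
  (s.setOwn o l).setV (s.v.setReg x)

/-- The effect of emptying a work stack. -/
def drainF (o : Own) (G : PState M β → PState M β) : List (Sym α) → PState M β → PState M β
  | [], s => s.popped o none []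
  | x :: l, s => drainF o G l (G (s.popped o (some x) l))

lemma runs_nop (s : PState M β) : Runs nop s 1 s := Runs.act _ s

lemma runs_popR (o : Own) (s : PState M β) :
    Runs (popR o) s 1 (s.popped o (s.own o).head? (s.own o).tail) := Runs.act _ s

lemma runs_pushR (o : Own) (s : PState M β) :
    Runs (pushR o) s 1 (s.setOwn o (s.v.reg.toList ++ s.own o)) := Runs.act _ s

lemma runs_pushC (o : Own) (x : Sym α) (s : PState M β) :
    Runs (pushC o x) s 1 (s.setOwn o (x :: s.own o)) := Runs.act _ s

@[simp] lemma PState.popped_v (s : PState M β) (o x l) : (s.popped o x l).v = s.v.setReg x := rfl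
@[simp] lemma PState.popped_own (s : PState M β) (o o' x l) :
    (s.popped o x l).own o' = if o' = o then l else s.own o' := s.setOwn_own o o' l
@[simp] lemma PState.popped_out (s : PState M β) (o x l) : (s.popped o x l).out = s.out := rfl
@[simp] lemma PState.popped_mach (s : PState M β) (o x l) : (s.popped o x l).mach = s.mach := rfl

/-- `I l s` is an invariant, `l` being the symbols still on the stack. Every symbol costs the body,
the next pop and a test, in all `c + 2`; the final `2` is the first pop and the last test. -/
lemma runs_drain {o : Own} {body : Prog M β} {G : PState M β → PState M β} {c : ℕ}
    (I : List (Sym α) → PState M β → Prop)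
    (h : ∀ x l s, I (x :: l) s → Runs body (s.popped o (some x) l) c (G (s.popped o (some x) l)) ∧
      (G (s.popped o (some x) l)).own o = l ∧ I l (G (s.popped o (some x) l)))
    {s : PState M β} (hI : I (s.own o) s) :
    Runs (drain o body) s ((c + 2) * (s.own o).length + 2) (drainF o G (s.own o) s) := by
  have key : ∀ l s, s.own o = l → I l s →
      Runs (.loop isReg (.seq body (popR o))) (s.popped o l.head? l.tail) ((c + 2) * l.length + 1)
        (drainF o G l s) := by
    intro l
    induction l with
    | nil => exact fun s _ _ => (Runs.loopF rfl).mono (by simp)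
    | cons x l ih =>
      intro s hs hI
      obtain ⟨h1, h2, h3⟩ := h x l s hI
      have h4 : Runs (popR o) (G (s.popped o (some x) l)) 1
          ((G (s.popped o (some x) l)).popped o l.head? l.tail) := by
        simpa only [h2] using runs_popR o (G (s.popped o (some x) l))
      exact (Runs.loopT rfl (h1.seq h4) (ih _ h2 h3)).mono (by simp only [List.length_cons]; ring_nf; omega)
  exact ((runs_popR o s).seq (key _ s rfl hI)).mono (by omega)

/-- Empty a stack. -/
def Prog.clear (a : Own) : Prog M β := drain a nop

lemma runs_clear (a : Own) (s : PState M β) :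
    Runs (clear a) s (3 * (s.own a).length + 2) (s.popped a none []) := by
  have h := runs_drain (o := a) (body := nop) (G := id) (c := 1) (fun _ _ => True)
    (fun x l s _ => ⟨runs_nop _, by simp, trivial⟩) (s := s) trivial
  have : ∀ l (s : PState M β), drainF a id l s = s.popped a none [] := by
    intro l
    induction l with
    | nil => exact fun s => rfl
    | cons x l ih => intro s; rw [drainF, ih]; simp [PState.popped, PState.setOwn, PState.setV]
  rwa [this] at h

/-- Move the contents of a stack to another stack, in reverse order. -/
def Prog.move (a b : Own) : Prog M β := drain a (pushR b)

lemma runs_move {a b : Own} (hab : a ≠ b) (s : PState M β) :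
    Runs (move a b) s (3 * (s.own a).length + 2)
      ((s.popped a none []).setOwn b ((s.own a).reverse ++ s.own b)) := by
  have h := runs_drain (o := a) (body := pushR b) (c := 1) (fun _ _ => True)
    (G := fun s => s.setOwn b (s.v.reg.toList ++ s.own b))
    (fun x l s _ => ⟨runs_pushR b _, by simp [hab], trivial⟩) (s := s)
    trivial
  have : ∀ l (s : PState M β), drainF a (fun s => s.setOwn b (s.v.reg.toList ++ s.own b)) l s =
      (s.popped a none []).setOwn b (l.reverse ++ s.own b) := by
    intro l
    induction l with
    | nil => intro s; simp [drainF, PState.popped, PState.setOwn, PState.setV, hab.symm]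
    | cons x l ih =>
      intro s; rw [drainF, ih]
      refine PState.eq_of (by simp) (fun o => ?_) rfl rfl
      by_cases ha : o = a <;> by_cases hb : o = b <;> simp [hab, ha, hb, hab.symm]
  rwa [this] at h

/-- Add the length of stack `z` in unary to `tmp`. -/
def Prog.addLength : Prog M β :=
  .seq (drain .z (.seq (pushR .zt) (pushC .tmp mark))) (move .zt .z)

/-- Counting empties `z` onto `zt`, and moving back restores it; this gives the original contents of
`z` only if `zt` was empty. -/
lemma runs_addLength {s : PState M β} (h : s.own .zt = []) :
    Runs addLength s (7 * (s.own .z).length + 4)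
      ((s.setV (s.v.setReg none)).setOwn .tmp
        (List.replicate (s.own .z).length mark ++ s.own .tmp)) := by
  have h1 := runs_drain (o := .z) (body := .seq (pushR .zt) (pushC .tmp mark)) (c := 2)
    (G := fun s => (s.setOwn .zt (s.v.reg.toList ++ s.own .zt)).setOwn .tmp (mark :: s.own .tmp))
    (fun _ _ => True) (fun x l s _ => ⟨((runs_pushR _ _).seq (runs_pushC _ _ _)).to le_rfl
      (by simp), by simp, trivial⟩) (s := s) trivial
  have : ∀ l (s : PState M β), drainF .z
      (fun s => (s.setOwn .zt (s.v.reg.toList ++ s.own .zt)).setOwn .tmp (mark :: s.own .tmp)) l s =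
      ((s.popped .z none []).setOwn .zt (l.reverse ++ s.own .zt)).setOwn .tmp
        (List.replicate l.length mark ++ s.own .tmp) := by
    intro l
    induction l with
    | nil =>
      intro s
      refine PState.eq_of rfl (fun o => ?_) rfl rfl
      cases o <;> simp [drainF]
    | cons x l ih =>
      intro s; rw [drainF, ih]
      refine PState.eq_of (by simp) (fun o => ?_) rfl rfl
      cases o <;> simp
      rw [List.replicate_succ', List.append_assoc]; rfl
  rw [this] at h1
  refine (h1.seq (runs_move (by decide) _)).to ?_ ?_
  · simp [h]; omega
  · refine PState.eq_of (by simp) (fun o => ?_) rfl rfl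
    cases o <;> simp [h]

/-- Push `c` marks. -/
def Prog.pushMarks : ℕ → Prog M β
  | 0 => nop
  | c + 1 => .seq (pushC .acc mark) (pushMarks c)

lemma runs_pushMarks (c : ℕ) (s : PState M β) :
    Runs (pushMarks c) s (c + 1) (s.setOwn .acc (List.replicate c mark ++ s.own .acc)) := by
  induction c generalizing s with
  | zero => exact (runs_nop s).to le_rfl (by simp)
  | succ c ih =>
    refine ((runs_pushC _ _ _).seq (ih _)).to (by omega) ?_
    rw [List.replicate_succ', List.append_assoc]; simp

/-- One step of Horner's scheme, at the length of stack `z`. -/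
def Prog.horner (c : ℕ) : Prog M β :=
  .seq (drain .acc addLength) (.seq (move .tmp .acc) (pushMarks c))

/-- Multiplication by repeated addition: every mark on `acc` contributes one copy of the length of
`z` to `tmp`. -/
lemma runs_horner {s : PState M β} (c : ℕ) (h : s.own .zt = []) (ht : s.own .tmp = [])
    (hr : s.v.reg = none) :
    Runs (horner c) s (10 * ((s.own .z).length + 1) * ((s.own .acc).length + 1) + c + 5)
      (s.setOwn .acc (List.replicate ((s.own .acc).length * (s.own .z).length + c) mark)) := by
  have h1 := runs_drain (o := .acc) (body := addLength) (c := 7 * (s.own .z).length + 4)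
    (G := fun s => (s.setV (s.v.setReg none)).setOwn .tmp
        (List.replicate (s.own .z).length mark ++ s.own .tmp))
    (fun _ s' => s'.own .zt = [] ∧ s'.own .z = s.own .z)
    (fun x l s' hs => by
      refine ⟨?_, ?_, ?_⟩
      · have := runs_addLength (s := s'.popped .acc (some x) l) (by simp [hs])
        simpa [hs.2] using this
      · simp
      · simpa using hs) (s := s) ⟨h, rfl⟩
  have : ∀ l (s : PState M β), drainF .acc
      (fun s => (s.setV (s.v.setReg none)).setOwn .tmp
        (List.replicate (s.own .z).length mark ++ s.own .tmp)) l s =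
      (s.popped .acc none []).setOwn .tmp
        (List.replicate (l.length * (s.own .z).length) mark ++ s.own .tmp) := by
    intro l
    induction l with
    | nil => intro s; simp [drainF, PState.popped, PState.setOwn, PState.setV]
    | cons x l ih =>
      intro s; rw [drainF, ih]
      refine PState.eq_of (by simp) (fun o => ?_) rfl rfl
      cases o <;> simp
      rw [← List.append_assoc, ← List.replicate_add, Nat.succ_mul]
  rw [this] at h1
  refine (h1.seq ((runs_move (by decide) _).seq (runs_pushMarks c _))).to ?_ ?_
  · simp [ht]
    ring_nf; omega
  · refine PState.eq_of (by simp [Reg.setReg_of_eq hr]) (fun o => ?_) rfl rfl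
    cases o <;> simp [ht]
    exact Nat.add_comm _ _

/-- Horner's scheme for a list of coefficients. -/
def Prog.hornerList : List ℕ → Prog M β
  | [] => nop
  | c :: cs => .seq (horner c) (hornerList cs)

/-- Replace `acc` by a number in unary. -/
def PState.setAcc (s : PState M β) (n : ℕ) : PState M β :=
  s.setOwn .acc (List.replicate n mark)

lemma polyTime_hornerList (cs : List ℕ) :
    PolyTime (X := {s : PState M β // s.own .zt = [] ∧ s.own .tmp = [] ∧ s.v.reg = none} × ℕ)
      (hornerList cs) (fun x => x.1.1.setAcc x.2)
      (fun x => x.1.1.setAcc (cs.foldl (fun a c => a * (x.1.1.own .z).length + c) x.2)) := by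
  induction cs with
  | nil => exact PolyTime.act _ fun x => rfl
  | cons c cs ih =>
    refine PolyTime.seq (g := fun x => x.1.1.setAcc (x.2 * (x.1.1.own .z).length + c)) ?_ ?_
    · refine ⟨10 * (.X + 1) * (.X + 1) + .C c + 5, fun ⟨⟨s, h1, h2, h3⟩, n⟩ => ?_⟩
      have h := runs_horner (s := s.setAcc n) c (by simp [PState.setAcc, h1])
        (by simp [PState.setAcc, h2]) (by simp [PState.setAcc, h3])
      have e1 := (s.setAcc n).own_le_size .z
      have e2 := (s.setAcc n).own_le_size .acc
      refine h.to ?_ (by simp [PState.setAcc])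
      simp only [Polynomial.eval_add, Polynomial.eval_mul, Polynomial.eval_X, Polynomial.eval_one,
        Polynomial.eval_C, Polynomial.eval_ofNat]
      gcongr
    · have h := ih.comp
        (fun x : {s : PState M β // s.own .zt = [] ∧ s.own .tmp = [] ∧ s.v.reg = none} × ℕ =>
          (x.1, x.2 * (x.1.1.own .z).length + c))
      exact h

lemma exists_horner (p : Polynomial ℕ) :
    ∃ cs : List ℕ, ∀ n, cs.foldl (fun a c => a * n + c) 0 = p.eval n := by
  -- The summand `a` absorbs constant terms, so that a coefficient is written down only when a
  -- factor `X` has been split off or nothing else is left.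
  suffices h : ∀ a, ∃ cs : List ℕ, ∀ n, cs.foldl (fun a c => a * n + c) 0 = p.eval n + a by
    simpa using h 0
  induction p using Polynomial.recOnHorner with
  | M0 => exact fun a => ⟨[a], by simp⟩
  | MC p b _ _ ih =>
    intro a
    obtain ⟨cs, h⟩ := ih (b + a)
    exact ⟨cs, fun n => by rw [h]; simp; ring⟩
  | MX p _ ih =>
    intro a
    obtain ⟨cs, h⟩ := ih 0
    exact ⟨cs ++ [a], fun n => by simp [h]⟩

/-- Write the value of a polynomial at the length of stack `z` in unary. -/
def Prog.unary (p : Polynomial ℕ) : Prog M β := hornerList (exists_horner p).choose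

lemma polyTime_unary (p : Polynomial ℕ) :
    PolyTime (X := {s : PState M β // s.own .zt = [] ∧ s.own .tmp = [] ∧ s.v.reg = none})
      (unary p) (fun x => x.1.setAcc 0) (fun x => x.1.setAcc (p.eval (x.1.own .z).length)) := by
  have h := (polyTime_hornerList (M := M) (β := β) (exists_horner p).choose).comp
    (fun x : {s : PState M β // s.own .zt = [] ∧ s.own .tmp = [] ∧ s.v.reg = none} => (x, 0))
  have e := (exists_horner p).choose_spec
  unfold unary
  generalize (exists_horner p).choose = cs at h e
  simp only [e] at h
  exact h

end

section

open Turing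

/-! ### The reward function -/

namespace QueryTM

variable {α : Type} {T : QueryTM (Sym α) α}

/-- Does the machine ask a question? -/
def asks (c : T.Config) : Bool := c.l.elim false T.isAsk

/-- The word on the query stack. -/
def query (c : T.Config) : List α := (c.stk T.qs).map T.letter

/-- The configuration after an answer. -/
def answer (c : T.Config) (b : Bool) : T.Config :=
  ⟨some (if b then T.yes else T.no), c.var, Function.update c.stk T.qs []⟩

/-- The output bit. -/
def output (c : T.Config) : Bool := ((c.stk T.tm.k₁).head?).elim false T.outBit

variable (T) in
/-- The configuration with empty stacks. -/
def rest : T.Config := ⟨none, T.tm.initialState, fun _ => []⟩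

variable (T) in
/-- The initial configuration on a given input. -/
def start (l : List (Sym α)) : T.Config :=
  ⟨some T.tm.main, T.tm.initialState, Function.update (fun _ => []) T.tm.k₀ (l.map T.inp)⟩

end QueryTM

/-- The bit that is expressed by the first letter of a message: `a₀` is the letter for `true`. -/
def headBit {α : Type} (a₀ : α) (m : List α) : Bool :=
  open scoped Classical in decide (m.head? = some a₀)

/-- One step of a machine whose questions are answered according to a message. -/
def QueryTM.tickWith {α : Type} {T : QueryTM (Sym α) α} (a₀ : α) (p : T.Config × List α) :
    T.Config × List α :=
  if asks p.1 then (answer p.1 (headBit a₀ p.2), p.2.tail) else (idleStep p.1, p.2)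

/-- The number of leading blocks of length `D` without `true`, at most `d`; whether all the `d`
blocks are of this kind; the bits after the blocks that have been read. -/
def blocks (D : ℕ) : ℕ → List Bool → ℕ × Bool × List Bool
  | 0, r => (0, true, r)
  | d + 1, r => if (r.take D).all (!·) then
      ((blocks D d (r.drop D)).1 + 1, (blocks D d (r.drop D)).2)
    else (0, false, r.drop D)

/-- One level of the protocol: a machine, the length of the certificates, the number of steps to be
simulated. -/
structure Level (α : Type) where
  T : QueryTM (Sym α) α
  q : Polynomial ℕ
  D : Polynomial ℕ

namespace Level

variable {α : Type} (a₀ : α) (L : Level α)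

/-- The certificate. -/
def cert (z : List α) (r : List Bool) : List Bool := r.take (L.q.eval z.length)

/-- The bits after the certificate, which are used to break ties. -/
def tie (z : List α) (r : List Bool) : Bool :=
  ((r.drop (L.q.eval z.length)).take (L.D.eval z.length)).all (!·)

/-- The configuration that is reached in the simulation, and the unread part of the message. -/
def simulate (z : List α) (y : List Bool) (m : List α) (t : ℕ) : L.T.Config × List α :=
  (QueryTM.tickWith a₀)^[t] (L.T.start (encPair (z, y)), m)

/-- The examination of the claim `b` about the word `z`, with the random bits `r`, using the
message `m` and the subsequent random bits `r'`: either the reward, or the next claim. -/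
def stage (z : List α) (b : Bool) (r : List Bool) (p : List α × List Bool) :
    Bool ⊕ (List α × Bool × List Bool) :=
  let u := blocks (L.D.eval z.length) (L.D.eval z.length) p.2
  let c := L.simulate a₀ z (L.cert z r) p.1 u.1
  if u.2.1 then .inl (b == (QueryTM.output c.1 || L.tie z r))
  else if QueryTM.asks c.1 then .inr (QueryTM.query c.1, headBit a₀ c.2, u.2.2)
  else .inl false

end Level

/-- The reward bit for the claim `b` about the word `z`. -/
def claimReward {α : Type} (a₀ : α) : List (Level α) → List α × Bool × List Bool →
    List (List α × List Bool) → Bool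
  | [], _, _ => false
  | L :: Ls, x, h =>
    (L.stage a₀ x.1 x.2.1 x.2.2 (h.headD ([], []))).elim id fun x' => claimReward a₀ Ls x' h.tail

/-- The reward bit. -/
def rewardBit {α : Type} (a₀ : α) (Ls : List (Level α)) (i : RInput α) : Bool :=
  claimReward a₀ Ls
    (i.1, headBit a₀ (i.2.headD ([], [])).1, (i.2.headD ([], [])).2) i.2.tail

end

section

open Turing Prog

variable {ι α β : Type} [DecidableEq ι] [Fintype ι] {M : ι → QueryTM (Sym α) α}

/-! ### Programs for the reward function -/

/-- A letter on a stack. -/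
def letterSym (a : α) : Sym α := Sum.inl (some a)

/-- A bit on a stack. -/
def bitSym (b : Bool) : Sym α := Sum.inr (some b)

/-- Is the symbol a letter? -/
def isLetter : Sym α → Bool
  | Sum.inl (some _) => true
  | _ => false

/-- Is the symbol a bit? -/
def isBit : Sym α → Bool
  | Sum.inr (some _) => true
  | _ => false

/-- Is the symbol the bit `true`? -/
def isOne : Sym α → Bool
  | Sum.inr (some b) => b
  | _ => false

namespace Prog

/-- Read from the input as long as the symbols satisfy `c`, and one more symbol. -/
def readWhile (c : Sym α → Bool) (o : Own) : Prog M β :=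
  .seq (popR .tape) (.seq (.loop (fun v => v.1.reg.elim false c)
    (.seq (pushR o) (popR .tape))) (.act (Act.load fun v => v.setReg none)))

end Prog

/-- The symbol that stops the loop, in practice an end marker, is consumed as well, hence `l'.tail`.
An empty `l'` also stops the loop, since the popped register is then `none`. -/
lemma runs_readWhile {c : Sym α → Bool} {o : Own} (ho : o ≠ .tape) {l l' : List (Sym α)}
    (hl : ∀ x ∈ l, c x = true) (hl' : l'.head?.elim false c = false) {s : PState M β}
    (hs : s.own .tape = l ++ l') :
    Runs (readWhile c o) s (3 * l.length + 3)
      ((s.popped .tape none l'.tail).setOwn o (l.reverse ++ s.own o)) := by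
  have key : ∀ l, (∀ x ∈ l, c x = true) → ∀ s : PState M β,
      Runs (.loop (fun v => v.1.reg.elim false c) (.seq (pushR o) (popR .tape)))
        (s.popped .tape (l ++ l').head? (l ++ l').tail) (3 * l.length + 1)
        ((s.popped .tape l'.head? l'.tail).setOwn o (l.reverse ++ s.own o)) := by
    intro l
    induction l with
    | nil => exact fun _ s => (Runs.loopF hl').to (by simp) (by
        refine PState.eq_of rfl (fun o' => ?_) rfl rfl
        by_cases h1 : o' = o
        · simp [h1, ho]
        · simp [h1])
    | cons x l ih =>
      intro hl s
      have h2 := ih (fun y hy => hl y (by simp [hy])) (s.setOwn o (x :: s.own o))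
      refine (Runs.loopT (hl x (by simp)) ((runs_pushR o _).seq (runs_popR _ _))
        (h2.conv ?_ le_rfl rfl)).to ?_ ?_
      · refine PState.eq_of (by simp [ho.symm]) (fun o' => ?_) rfl rfl
        by_cases h1 : o' = o
        · simp [h1, ho]
        · by_cases h2 : o' = .tape <;> simp [h1, h2, ho.symm]
      · simp only [List.length_cons]; omega
      · refine PState.eq_of (by simp) (fun o' => ?_) rfl rfl
        by_cases h1 : o' = o
        · simp [h1]
        · by_cases h2 : o' = .tape <;> simp [h1, h2, ho.symm]
  have h := key l hl s
  rw [← hs] at h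
  refine ((runs_popR _ s).seq (h.seq (Runs.act _ _))).to (by omega) ?_
  refine PState.eq_of (by simp [Act.load]) (fun o' => ?_) rfl rfl
  by_cases h1 : o' = o <;> simp [Act.load, h1]

namespace Prog

/-- Move as many symbols from `r` to `y` as `acc` says. -/
def takeBits : Prog M β := drain .acc (.seq (popR .r) (pushR .y))

/-- Test whether the next symbols of `r`, as many as `acc` says, are different from `true`. -/
def testBlock : Prog M β :=
  drain .acc (.seq (.act (Act.pop .r fun v x => { v with go := v.go && !(x.elim false isOne) }))
    (pushC .tmp mark))

/-- Feed the contents of a work stack to a machine. -/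
def feedAll (i : ι) (o : Own) : Prog M β := drain o (.act (Act.feed i Reg.reg))

/-- Move the contents of a stack of a machine to a work stack. -/
def moveMach (i : ι) (k : (M i).tm.K) (f : (M i).tm.Γ k → Sym α) (o : Own) : Prog M β :=
  .seq (.act (Act.popMach i k fun v x => v.setReg (x.map f)))
    (.loop isReg (.seq (pushR o) (.act (Act.popMach i k fun v x => v.setReg (x.map f)))))

end Prog

lemma runs_takeBits (s : PState M β) :
    Runs takeBits s (4 * (s.own .acc).length + 2)
      (((s.popped .acc none []).setOwn .r ((s.own .r).drop (s.own .acc).length)).setOwn .y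
        (((s.own .r).take (s.own .acc).length).reverse ++ s.own .y)) := by
  have h := runs_drain (o := .acc) (body := .seq (popR .r) (pushR .y)) (c := 2)
    (G := fun s => (s.popped .r (s.own .r).head? (s.own .r).tail).setOwn .y
      ((s.own .r).head?.toList ++ s.own .y)) (fun _ _ => True)
    (fun x l s _ => ⟨((runs_popR _ _).seq (runs_pushR _ _)).to le_rfl (by simp), by simp, trivial⟩)
    (s := s) trivial
  have : ∀ l (s : PState M β), drainF .acc
      (fun s => (s.popped .r (s.own .r).head? (s.own .r).tail).setOwn .y
        ((s.own .r).head?.toList ++ s.own .y)) l s =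
      (((s.popped .acc none []).setOwn .r ((s.own .r).drop l.length)).setOwn .y
        (((s.own .r).take l.length).reverse ++ s.own .y)) := by
    intro l
    induction l with
    | nil =>
      intro s
      refine PState.eq_of rfl (fun o => ?_) rfl rfl
      cases o <;> simp [drainF]
    | cons x l ih =>
      intro s; rw [drainF, ih]
      refine PState.eq_of (by simp) (fun o => ?_) rfl rfl
      cases o <;> simp
      cases s.own .r <;> simp
  rwa [this] at h

/-- The marks consumed from `acc` are copied to `tmp`, so that the block length can be restored for
the next block. The flag `go` can only be switched off. -/
lemma runs_testBlock (s : PState M β) :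
    Runs testBlock s (4 * (s.own .acc).length + 2)
      ((((s.popped .acc none []).setOwn .r ((s.own .r).drop (s.own .acc).length)).setOwn .tmp
        (List.replicate (s.own .acc).length mark ++ s.own .tmp)).setV
        { s.v.setReg none with
          go := s.v.go && ((s.own .r).take (s.own .acc).length).all (!isOne ·) }) := by
  have h := runs_drain (o := .acc) (body := .seq (.act (Act.pop .r fun v x =>
      { v with go := v.go && !(x.elim false isOne) })) (pushC .tmp mark)) (c := 2)
    (G := fun s => ((s.setOwn .r (s.own .r).tail).setOwn .tmp (mark :: s.own .tmp)).setV
      { s.v with go := s.v.go && !((s.own .r).head?.elim false isOne) }) (fun _ _ => True)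
    (fun x l s _ => ⟨((Runs.act _ _).seq (runs_pushC _ _ _)).to le_rfl rfl, by simp, trivial⟩)
    (s := s) trivial
  have : ∀ l (s : PState M β), drainF .acc
      (fun s => ((s.setOwn .r (s.own .r).tail).setOwn .tmp (mark :: s.own .tmp)).setV
        { s.v with go := s.v.go && !((s.own .r).head?.elim false isOne) }) l s =
      ((((s.popped .acc none []).setOwn .r ((s.own .r).drop l.length)).setOwn .tmp
        (List.replicate l.length mark ++ s.own .tmp)).setV
        { s.v.setReg none with go := s.v.go && ((s.own .r).take l.length).all (!isOne ·) }) := by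
    intro l
    induction l with
    | nil =>
      intro s
      refine PState.eq_of (by simp [drainF]; rfl) (fun o => ?_) rfl rfl
      cases o <;> simp [drainF]
    | cons x l ih =>
      intro s; rw [drainF, ih]
      refine PState.eq_of ?_ (fun o => ?_) rfl rfl
      · cases hr : s.own .r <;> simp [hr, Reg.setReg, Bool.and_assoc]
      · cases o <;> simp
        rw [List.replicate_succ', List.append_assoc]; rfl
  rwa [this] at h

lemma runs_feedAll (i : ι) (o : Own) (s : PState M β) :
    Runs (feedAll i o) s (3 * (s.own o).length + 2)
      ((s.popped o none []).setMach i ⟨(s.mach i).l, (s.mach i).var,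
        Function.update (s.mach i).stk (M i).tm.k₀
          (((s.own o).map (M i).inp).reverse ++ (s.mach i).stk (M i).tm.k₀)⟩) := by
  have h := runs_drain (o := o) (body := .act (Act.feed i Reg.reg)) (c := 1) (fun _ _ => True)
    (fun x l s _ => ⟨Runs.act _ _, by simp [Act.feed], trivial⟩)
    (s := s) trivial
  have : ∀ l (s : PState M β), drainF o (Act.feed i Reg.reg).F l s =
      ((s.popped o none []).setMach i ⟨(s.mach i).l, (s.mach i).var,
        Function.update (s.mach i).stk (M i).tm.k₀
          ((l.map (M i).inp).reverse ++ (s.mach i).stk (M i).tm.k₀)⟩) := by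
    intro l
    induction l with
    | nil =>
      intro s
      refine PState.eq_of rfl (fun o => rfl) rfl ?_
      have : (⟨(s.mach i).l, (s.mach i).var, (s.mach i).stk⟩ : (M i).Config) = s.mach i := rfl
      simp [drainF, PState.setMach, this]
    | cons x l ih =>
      intro s; rw [drainF, ih]
      refine PState.eq_of (by simp [Act.feed]) (fun o => ?_) rfl ?_
      · simp [Act.feed]; split_ifs <;> rfl
      · simp [Act.feed, PState.setMach]
  rwa [this] at h

lemma runs_moveMach (i : ι) (k : (M i).tm.K) (f : (M i).tm.Γ k → Sym α) (o : Own)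
    (s : PState M β) :
    Runs (moveMach i k f o) s (3 * ((s.mach i).stk k).length + 2)
      (((s.setV (s.v.setReg none)).setOwn o ((((s.mach i).stk k).map f).reverse ++ s.own o)).setMach
        i ⟨(s.mach i).l, (s.mach i).var, Function.update (s.mach i).stk k []⟩) := by
  have key : ∀ l (s : PState M β), (s.mach i).stk k = l →
      Runs (.loop isReg (.seq (pushR o) (.act (Act.popMach i k fun v x => v.setReg (x.map f)))))
        ((s.setMach i ⟨(s.mach i).l, (s.mach i).var, Function.update (s.mach i).stk k l.tail⟩).setV
          (s.v.setReg (l.head?.map f))) (3 * l.length + 1)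
      (((s.setV (s.v.setReg none)).setOwn o ((l.map f).reverse ++ s.own o)).setMach
        i ⟨(s.mach i).l, (s.mach i).var, Function.update (s.mach i).stk k []⟩) := by
    intro l
    induction l with
    | nil =>
      intro s _
      refine (Runs.loopF rfl).to (by simp) ?_
      exact PState.eq_of rfl (fun o' => by simp; rintro rfl; rfl) rfl rfl
    | cons x l ih =>
      intro s hs
      have h1 := ih ((s.setMach i ⟨(s.mach i).l, (s.mach i).var,
        Function.update (s.mach i).stk k l⟩).setOwn o (f x :: s.own o)) (by simp)
      refine (Runs.loopT rfl ((runs_pushR o _).seq (Runs.act _ _))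
        (h1.conv ?_ le_rfl rfl)).to ?_ ?_
      · refine PState.eq_of (by simp [Act.popMach]) (fun o' => ?_) rfl ?_
        · simp [Act.popMach]
        · simp [Act.popMach, PState.setMach]
      · simp only [List.length_cons]; omega
      · refine PState.eq_of rfl (fun o' => ?_) rfl ?_
        · simp; split_ifs <;> rfl
        · simp [PState.setMach]
  exact ((Runs.act _ s).seq (key _ s rfl)).mono (by omega)

end

/-! ### Programs that count the blocks of coins and simulate a machine. -/

section

open Turing Prog

variable {ι α β : Type} [DecidableEq ι] [Fintype ι] {M : ι → QueryTM (Sym α) α}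

lemma all_take_bits (n : ℕ) (r : List Bool) :
    (((r.map bitSym : List (Sym α)).take n).all (!isOne ·)) = (r.take n).all (!·) := by
  rw [← List.map_take, List.all_map]; rfl

namespace Prog

/-- Read the next block of `r`, of the length given by `acc`, unless a block with `true` has been
read. -/
def nextBlock : Prog M β :=
  .ite (fun v => v.1.go)
    (.seq testBlock (.seq (move .tmp .acc) (.ite (fun v => v.1.go) (pushC .t mark) nop))) nop

end Prog

/-- The effect of `nextBlock`. -/
def nextBlockF (s : PState M β) : PState M β :=
  if s.v.go then
    ((s.setOwn .r ((s.own .r).drop (s.own .acc).length)).setOwn .t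
      (if ((s.own .r).take (s.own .acc).length).all (!isOne ·) then mark :: s.own .t
        else s.own .t)).setV
      { s.v.setReg none with go := ((s.own .r).take (s.own .acc).length).all (!isOne ·) }
  else s

lemma runs_nextBlock {s : PState M β} {n : ℕ} (hacc : s.own .acc = List.replicate n mark)
    (htmp : s.own .tmp = []) : Runs nextBlock s (7 * n + 8) (nextBlockF s) := by
  unfold nextBlockF
  cases hg : s.v.go with
  | false => exact (Runs.iteF hg (runs_nop s)).to (by omega) (by simp)
  | true =>
    have h1 := runs_testBlock s
    have h2 := runs_move (a := .tmp) (b := .acc) (by decide) ((((s.popped .acc none []).setOwn .r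
        ((s.own .r).drop (s.own .acc).length)).setOwn .tmp
        (List.replicate (s.own .acc).length mark ++ s.own .tmp)).setV
        { s.v.setReg none with
          go := s.v.go && ((s.own .r).take (s.own .acc).length).all (!isOne ·) })
    refine Runs.to (n := 4 * (s.own .acc).length + 2 + (3 * (s.own .acc).length + 2 + 2) + 1)
      (Runs.iteT hg (h1.seq ((h2.mono ?_).seq (s'' := (s.setOwn .r
        ((s.own .r).drop (s.own .acc).length)).setOwn .t
      (if ((s.own .r).take (s.own .acc).length).all (!isOne ·) then mark :: s.own .t
        else s.own .t) |>.setV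
      { s.v.setReg none with go := ((s.own .r).take (s.own .acc).length).all (!isOne ·) }) ?_)))
      ?_ rfl
    · simp [htmp]
    · cases hb : ((s.own .r).take (s.own .acc).length).all (!isOne ·) with
      | true =>
        refine (Runs.iteT ?_ (runs_pushC _ _ _)).to le_rfl ?_
        · simp [PState.var, hg, Reg.setReg]
        · refine PState.eq_of (by simp [hg, Reg.setReg]) (fun o => ?_) rfl rfl
          cases o <;> simp [htmp, hacc]
      | false =>
        refine (Runs.iteF ?_ (runs_nop _)).to le_rfl ?_
        · simp [PState.var, hg, Reg.setReg]
        · refine PState.eq_of (by simp [hg, Reg.setReg]) (fun o => ?_) rfl rfl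
          cases o <;> simp [htmp, hacc]
    · simp [hacc]; omega

lemma runs_blocks {s : PState M β} {n : ℕ} {R : List Bool}
    (hacc : s.own .acc = List.replicate n mark) (htmp : s.own .tmp = []) (hgo : s.v.go = true)
    (hr : s.own .r = R.map bitSym) :
    Runs (drain .d nextBlock) s ((7 * n + 10) * (s.own .d).length + 2)
      ((((s.popped .d none []).setOwn .r ((blocks n (s.own .d).length R).2.2.map bitSym)).setOwn .t
        (List.replicate (blocks n (s.own .d).length R).1 mark ++ s.own .t)).setV
        { s.v.setReg none with go := (blocks n (s.own .d).length R).2.1 }) := by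
  have h := runs_drain (o := .d) (body := nextBlock) (c := 7 * n + 8) (G := nextBlockF)
    (fun _ s => s.own .acc = List.replicate n mark ∧ s.own .tmp = [])
    (fun x l s hs => ⟨runs_nextBlock (by simp [hs.1]) (by simp [hs.2]),
      by unfold nextBlockF; split_ifs <;> simp,
      by unfold nextBlockF; split_ifs <;> simp [hs.1, hs.2]⟩) (s := s) ⟨hacc, htmp⟩
  -- After a block containing `true` the flag `go` stays off, and the rest of the counter `d` is
  -- drained without reading coins.
  have hfix : ∀ l (s : PState M β), s.v.go = false →
      drainF .d nextBlockF l s = s.popped .d none [] := by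
    intro l
    induction l with
    | nil => exact fun s _ => rfl
    | cons x l ih =>
      intro s hs
      have : nextBlockF (s.popped .d (some x) l) = s.popped .d (some x) l := by
        simp [nextBlockF, hs]
      rw [drainF, this, ih _ (by simp [hs])]
      exact PState.eq_of rfl (fun o => by simp; split_ifs <;> rfl) rfl rfl
  have : ∀ l (s : PState M β) (R : List Bool), s.own .acc = List.replicate n mark →
      s.v.go = true → s.own .r = R.map bitSym → drainF .d nextBlockF l s =
      ((((s.popped .d none []).setOwn .r ((blocks n l.length R).2.2.map bitSym)).setOwn .t
        (List.replicate (blocks n l.length R).1 mark ++ s.own .t)).setV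
        { s.v.setReg none with go := (blocks n l.length R).2.1 }) := by
    intro l
    induction l with
    | nil =>
      intro s R _ hgo hr
      refine PState.eq_of (by simp [drainF, blocks, ← hgo]; rfl) (fun o => ?_) rfl rfl
      cases o <;> simp [drainF, blocks, hr]
    | cons x l ih =>
      intro s R hacc hgo hr
      rw [drainF, List.length_cons, blocks]
      cases hb : (R.take n).all (!·) with
      | true =>
        rw [ih _ (R.drop n) (by simp [nextBlockF, hgo, hacc])
          (by simp only [nextBlockF, PState.popped_v, Reg.setReg_go, hgo, PState.popped_own, hr,
                hacc, if_true]; simp [all_take_bits, hb])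
          (by simp [nextBlockF, hgo, hacc, hr])]
        refine PState.eq_of ?_ (fun o => ?_) ?_ ?_
        · simp [nextBlockF, hgo, Reg.setReg]
        · cases o <;> simp [nextBlockF, hgo, hr, hacc, all_take_bits, hb]
          rw [List.replicate_succ', List.append_assoc]; rfl
        · simp [nextBlockF, hgo]
        · simp [nextBlockF, hgo]
      | false =>
        rw [hfix _ _ (by simp [nextBlockF, hgo, hr, hacc, all_take_bits, hb])]
        refine PState.eq_of ?_ (fun o => ?_) ?_ ?_
        · simp [nextBlockF, hgo, hr, hacc, all_take_bits, hb, Reg.setReg]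
        · cases o <;> simp [nextBlockF, hgo, hr, hacc, all_take_bits, hb]
        · simp [nextBlockF, hgo]
        · simp [nextBlockF, hgo]
  rwa [this _ _ R hacc hgo hr] at h

/-- Is the content of the register the letter `a₀`? -/
def isYes (a₀ : α) (x : Option (Sym α)) : Bool :=
  open scoped Classical in decide (x = some (letterSym a₀))

lemma isYes_head (a₀ : α) (m : List α) :
    isYes a₀ (m.map letterSym).head? = headBit a₀ m := by
  unfold isYes headBit
  refine decide_eq_decide.2 ?_
  cases m <;> simp [letterSym]

lemma QueryTM.csize_answer {T : QueryTM (Sym α) α} (c : T.Config) (b : Bool) :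
    csize (answer c b) ≤ csize c := by
  have := csize_update c (some (if b then T.yes else T.no)) c.var T.qs []
  simp only [List.length_nil] at this
  unfold answer; omega

namespace Prog

/-- Empty a stack of a machine. -/
def clearMach (i : ι) (k : (M i).tm.K) : Prog M β :=
  .seq (moveMach i k (fun _ => mark) .tmp) (clear .tmp)

/-- One step of the simulation of a machine. -/
def tickBody (a₀ : α) (i : ι) : Prog M β :=
  .ite (fun v => (v.2 i).2.elim false (M i).isAsk)
    (.seq (popR .m) (.seq (.act (Act.ctl i fun v w _ =>
      (w, some (if isYes a₀ v.reg then (M i).yes else (M i).no)))) (clearMach i (M i).qs)))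
    (.act (Act.tick i))

end Prog

lemma runs_clearMach (i : ι) (k : (M i).tm.K) {s : PState M β} (htmp : s.own .tmp = []) :
    Runs (clearMach i k) s (6 * ((s.mach i).stk k).length + 4)
      ((s.setV (s.v.setReg none)).setMach i
        ⟨(s.mach i).l, (s.mach i).var, Function.update (s.mach i).stk k []⟩) := by
  refine ((runs_moveMach i k _ _ s).seq (runs_clear _ _)).to ?_ ?_
  · simp [htmp]; omega
  · refine PState.eq_of rfl (fun o => ?_) rfl rfl
    cases o <;> simp [htmp]

/-- The effect of `tickBody`. -/
def tickBodyF (a₀ : α) (i : ι) (s : PState M β) : PState M β :=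
  if QueryTM.asks (s.mach i) then
    ((s.setMach i (QueryTM.answer (s.mach i) (isYes a₀ (s.own .m).head?))).setOwn .m
      (s.own .m).tail).setV (s.v.setReg none)
  else s.setMach i (QueryTM.idleStep (s.mach i))

lemma runs_tickBody (a₀ : α) (i : ι) {s : PState M β} (htmp : s.own .tmp = []) :
    Runs (tickBody a₀ i) s (6 * QueryTM.csize (s.mach i) + 7) (tickBodyF a₀ i s) := by
  unfold tickBodyF
  cases ha : QueryTM.asks (s.mach i) with
  | false => exact (Runs.iteF ha (Runs.act _ s)).to (by omega) rfl
  | true =>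
    refine (Runs.iteT ha ((runs_popR .m s).seq ((Runs.act _ _).seq
      (runs_clearMach i _ ?_)))).to ?_ ?_
    · simp [Act.ctl, htmp]
    · have := QueryTM.stk_le_csize (s.mach i) (M i).qs
      simp [Act.ctl]; omega
    · refine PState.eq_of (by simp [Act.ctl]) (fun o => ?_) rfl ?_
      · cases o <;> simp [Act.ctl]
      · simp [Act.ctl, PState.setMach, QueryTM.answer]; rfl

/-- Answering a question includes erasing it, so the cost of a step depends on the size of the
configuration. The invariant adds to this size the growth allowed for the remaining steps, which
yields one bound for all steps. -/
lemma runs_ticks (a₀ : α) (i : ι) {s : PState M β} {m : List α} (htmp : s.own .tmp = [])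
    (hm : s.own .m = m.map letterSym) :
    Runs (drain .t (tickBody a₀ i)) s
      ((6 * (QueryTM.csize (s.mach i) + (M i).growth * (s.own .t).length) + 9) *
        (s.own .t).length + 2)
      (((s.popped .t none []).setMach i
        ((QueryTM.tickWith a₀)^[(s.own .t).length] (s.mach i, m)).1).setOwn .m
        (((QueryTM.tickWith a₀)^[(s.own .t).length] (s.mach i, m)).2.map letterSym)) := by
  have hsize : ∀ s : PState M β, QueryTM.csize ((tickBodyF a₀ i s).mach i) ≤
      QueryTM.csize (s.mach i) + (M i).growth := by
    intro s
    unfold tickBodyF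
    split_ifs
    · simpa using (QueryTM.csize_answer _ _).trans (by omega)
    · simpa using QueryTM.csize_idleStep _
  have h := runs_drain (o := .t) (body := tickBody a₀ i)
    (c := 6 * (QueryTM.csize (s.mach i) + (M i).growth * (s.own .t).length) + 7)
    (G := tickBodyF a₀ i)
    (fun l s' => s'.own .tmp = [] ∧ QueryTM.csize (s'.mach i) + (M i).growth * l.length ≤
      QueryTM.csize (s.mach i) + (M i).growth * (s.own .t).length)
    (fun x l s' hs => by
      refine ⟨(runs_tickBody a₀ i (by simp [hs.1])).mono ?_, ?_, ?_, ?_⟩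
      · have := hs.2
        simp only [PState.popped_mach]
        omega
      · unfold tickBodyF; split_ifs <;> simp
      · unfold tickBodyF; split_ifs <;> simp [hs.1]
      · have h1 := hsize (s'.popped .t (some x) l)
        have h2 := hs.2
        simp only [PState.popped_mach, List.length_cons, Nat.mul_add, Nat.mul_one] at h1 h2
        omega) (s := s) ⟨htmp, le_rfl⟩
  have : ∀ l (s : PState M β) (m : List α), s.own .m = m.map letterSym →
      drainF .t (tickBodyF a₀ i) l s = (((s.popped .t none []).setMach i
        ((QueryTM.tickWith a₀)^[l.length] (s.mach i, m)).1).setOwn .m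
        (((QueryTM.tickWith a₀)^[l.length] (s.mach i, m)).2.map letterSym)) := by
    intro l
    induction l with
    | nil =>
      intro s m hm
      refine PState.eq_of rfl (fun o => ?_) rfl (by simp [drainF, PState.setMach])
      cases o <;> simp [drainF, hm]
    | cons x l ih =>
      intro s m hm
      rw [drainF, List.length_cons, Function.iterate_succ_apply]
      cases ha : QueryTM.asks (s.mach i) with
      | true =>
        rw [ih _ m.tail (by simp [tickBodyF, ha, hm])]
        have e : QueryTM.tickWith a₀ (s.mach i, m) =
            (QueryTM.answer (s.mach i) (headBit a₀ m), m.tail) := by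
          simp [QueryTM.tickWith, ha]
        have e' : (tickBodyF a₀ i (s.popped .t (some x) l)).mach i =
            QueryTM.answer (s.mach i) (headBit a₀ m) := by
          simp [tickBodyF, ha, hm, ← isYes_head]
        rw [e, e']
        refine PState.eq_of (by simp [tickBodyF, ha]) (fun o => ?_) ?_ ?_
        · cases o <;> simp [tickBodyF, ha]
        · simp [tickBodyF, ha]
        · simp [tickBodyF, ha, PState.setMach]
      | false =>
        rw [ih _ m (by simp [tickBodyF, ha, hm])]
        have e : QueryTM.tickWith a₀ (s.mach i, m) = (QueryTM.idleStep (s.mach i), m) := by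
          simp [QueryTM.tickWith, ha]
        have e' : (tickBodyF a₀ i (s.popped .t (some x) l)).mach i =
            QueryTM.idleStep (s.mach i) := by
          simp [tickBodyF, ha]
        rw [e, e']
        refine PState.eq_of (by simp [tickBodyF, ha]) (fun o => ?_) ?_ ?_
        · cases o <;> simp [tickBodyF, ha]
        · simp [tickBodyF, ha]
        · simp [tickBodyF, ha, PState.setMach]
  rwa [this _ _ m hm] at h

end

/-! ### Polynomial time bounds for the basic programs, and normal forms of states. -/

section

open Turing Prog

variable {ι α β : Type} [DecidableEq ι] [Fintype ι] {M : ι → QueryTM (Sym α) α}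

/-- A linear time bound is polynomial. -/
lemma PolyTime.of_linear {X : Type*} {p : Prog M β} {f g : X → PState M β} (c : ℕ)
    (h : ∀ x, ∃ n ≤ c * ((f x).size + 1), Runs p (f x) n (g x)) : PolyTime p f g := by
  refine ⟨.C c * (.X + 1), fun x => ?_⟩
  obtain ⟨n, hn, h⟩ := h x
  exact h.mono (by simpa using hn)

section
variable {X : Type*} {f g : X → PState M β}

lemma polyTime_clear (o : Own) (h : ∀ x, (f x).popped o none [] = g x) :
    PolyTime (clear o) f g :=
  .of_linear 3 fun x => ⟨_, by have := (f x).own_le_size o; omega, h x ▸ runs_clear o (f x)⟩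

lemma polyTime_move {a b : Own} (hab : a ≠ b) (h : ∀ x, ((f x).popped a none []).setOwn b
    (((f x).own a).reverse ++ (f x).own b) = g x) : PolyTime (move a b) f g :=
  .of_linear 3 fun x => ⟨_, by have := (f x).own_le_size a; omega, h x ▸ runs_move hab (f x)⟩

lemma polyTime_takeBits (h : ∀ x, (((f x).popped .acc none []).setOwn .r
      (((f x).own .r).drop ((f x).own .acc).length)).setOwn .y
        ((((f x).own .r).take ((f x).own .acc).length).reverse ++ (f x).own .y) = g x) :
    PolyTime takeBits f g :=
  .of_linear 4 fun x => ⟨_, by have := (f x).own_le_size .acc; omega, h x ▸ runs_takeBits (f x)⟩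

lemma polyTime_testBlock (h : ∀ x, ((((f x).popped .acc none []).setOwn .r
      (((f x).own .r).drop ((f x).own .acc).length)).setOwn .tmp
        (List.replicate ((f x).own .acc).length mark ++ (f x).own .tmp)).setV
        { (f x).v.setReg none with
          go := (f x).v.go && (((f x).own .r).take ((f x).own .acc).length).all (!isOne ·) }
        = g x) :
    PolyTime testBlock f g :=
  .of_linear 4 fun x => ⟨_, by have := (f x).own_le_size .acc; omega, h x ▸ runs_testBlock (f x)⟩

lemma polyTime_blocks {n : X → ℕ} {R : X → List Bool}
    (hacc : ∀ x, (f x).own .acc = List.replicate (n x) mark) (htmp : ∀ x, (f x).own .tmp = [])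
    (hgo : ∀ x, (f x).v.go = true) (hr : ∀ x, (f x).own .r = (R x).map bitSym)
    (h : ∀ x, (((((f x).popped .d none []).setOwn .r
      ((blocks (n x) ((f x).own .d).length (R x)).2.2.map bitSym)).setOwn .t
        (List.replicate (blocks (n x) ((f x).own .d).length (R x)).1 mark ++ (f x).own .t)).setV
        { (f x).v.setReg none with go := (blocks (n x) ((f x).own .d).length (R x)).2.1 }) = g x) :
    PolyTime (drain .d nextBlock) f g := by
  refine ⟨(7 * .X + 10) * .X + 2, fun x => (runs_blocks (hacc x) (htmp x) (hgo x) (hr x)).to ?_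
    (h x)⟩
  have h1 := (f x).own_le_size .d
  have h2 := (f x).own_le_size .acc
  rw [hacc x, List.length_replicate] at h2
  simp only [Polynomial.eval_add, Polynomial.eval_mul, Polynomial.eval_X, Polynomial.eval_ofNat]
  gcongr

lemma polyTime_feedAll (i : ι) (o : Own) (h : ∀ x, (((f x).popped o none []).setMach i
      ⟨((f x).mach i).l, ((f x).mach i).var, Function.update ((f x).mach i).stk (M i).tm.k₀
          ((((f x).own o).map (M i).inp).reverse ++ ((f x).mach i).stk (M i).tm.k₀)⟩) = g x) :
    PolyTime (feedAll i o) f g :=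
  .of_linear 3 fun x => ⟨_, by have := (f x).own_le_size o; omega, h x ▸ runs_feedAll i o (f x)⟩

lemma polyTime_ticks (a₀ : α) (i : ι) {m : X → List α} (htmp : ∀ x, (f x).own .tmp = [])
    (hm : ∀ x, (f x).own .m = (m x).map letterSym)
    (h : ∀ x, (((f x).popped .t none []).setMach i
        ((QueryTM.tickWith a₀)^[((f x).own .t).length] ((f x).mach i, m x)).1).setOwn .m
        (((QueryTM.tickWith a₀)^[((f x).own .t).length] ((f x).mach i, m x)).2.map letterSym)
        = g x) :
    PolyTime (drain .t (tickBody a₀ i)) f g := by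
  refine ⟨(6 * (.X + .C (M i).growth * .X) + 9) * .X + 2,
    fun x => (runs_ticks a₀ i (htmp x) (hm x)).to ?_ (h x)⟩
  have h1 := (f x).own_le_size .t
  have h2 := (f x).csize_le_size i
  simp only [Polynomial.eval_add, Polynomial.eval_mul, Polynomial.eval_X, Polynomial.eval_ofNat,
    Polynomial.eval_C]
  gcongr

lemma polyTime_load (φ : Reg α → Reg α) (h : ∀ x, (f x).setV (φ (f x).v) = g x) :
    PolyTime (.act (Act.load φ)) f g := PolyTime.act _ h

lemma polyTime_unary' (p : Polynomial ℕ) (hacc : ∀ x, (f x).own .acc = [])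
    (hzt : ∀ x, (f x).own .zt = []) (htmp : ∀ x, (f x).own .tmp = [])
    (hreg : ∀ x, (f x).v.reg = none)
    (h : ∀ x, (f x).setOwn .acc (List.replicate (p.eval ((f x).own .z).length) mark) = g x) :
    PolyTime (unary p) f g :=
  ((polyTime_unary p).comp fun x => ⟨f x, hzt x, htmp x, hreg x⟩).congr
    (fun x => by
      have := (f x).setOwn_self .acc
      rw [hacc x] at this
      exact this) h

lemma polyTime_readWhile {c : Sym α → Bool} {o : Own} (ho : o ≠ .tape) {l l' : X → List (Sym α)}
    (hl : ∀ x, ∀ y ∈ l x, c y = true) (hl' : ∀ x, (l' x).head?.elim false c = false)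
    (hs : ∀ x, (f x).own .tape = l x ++ l' x)
    (h : ∀ x, ((f x).popped .tape none (l' x).tail).setOwn o ((l x).reverse ++ (f x).own o) = g x) :
    PolyTime (readWhile c o) f g :=
  .of_linear 3 fun x => ⟨_, by
    have := (f x).own_le_size .tape
    rw [hs, List.length_append] at this; omega, h x ▸ runs_readWhile ho (hl x) (hl' x) (hs x)⟩

end

/-- Program states without auxiliary data. -/
structure Shape (M : ι → QueryTM (Sym α) α) where
  v : Reg α := Reg.init α
  tape : List (Sym α) := []
  z : List (Sym α) := []
  acc : List (Sym α) := []
  y : List (Sym α) := []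
  r : List (Sym α) := []
  m : List (Sym α) := []
  t : List (Sym α) := []
  d : List (Sym α) := []
  tmp : List (Sym α) := []
  mach : ∀ i, (M i).Config := fun i => (M i).rest

/-- The program state of a given shape. -/
def Shape.st (β : Type) (x : Shape M) : PState M β where
  v := x.v
  own
    | .tape => x.tape
    | .z => x.z
    | .zt => []
    | .acc => x.acc
    | .tmp => x.tmp
    | .y => x.y
    | .r => x.r
    | .m => x.m
    | .t => x.t
    | .d => x.d
  out := []
  mach := x.mach

section
variable (x : Shape M)
@[simp] lemma Shape.st_v : (x.st β).v = x.v := rfl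
@[simp] lemma Shape.st_tape : (x.st β).own .tape = x.tape := rfl
@[simp] lemma Shape.st_z : (x.st β).own .z = x.z := rfl
@[simp] lemma Shape.st_zt : (x.st β).own .zt = [] := rfl
@[simp] lemma Shape.st_acc : (x.st β).own .acc = x.acc := rfl
@[simp] lemma Shape.st_tmp : (x.st β).own .tmp = x.tmp := rfl
@[simp] lemma Shape.st_y : (x.st β).own .y = x.y := rfl
@[simp] lemma Shape.st_r : (x.st β).own .r = x.r := rfl
@[simp] lemma Shape.st_m : (x.st β).own .m = x.m := rfl
@[simp] lemma Shape.st_t : (x.st β).own .t = x.t := rfl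
@[simp] lemma Shape.st_d : (x.st β).own .d = x.d := rfl
@[simp] lemma Shape.st_out : (x.st β).out = [] := rfl
@[simp] lemma Shape.st_mach : (x.st β).mach = x.mach := rfl
end

lemma PState.initial_eq (l : List (Sym α)) :
    PState.initial M β l = Shape.st β { tape := l } := by
  refine PState.eq_of rfl (fun o => ?_) rfl rfl
  cases o <;> simp [PState.initial]

/-- Read a pair of a word and a bit string. -/
def Prog.loadPair : Prog M β :=
  .seq (readWhile isLetter .tmp) (.seq (move .tmp .m) (.seq (readWhile isBit .tmp) (move .tmp .r)))

/-- Written so that the case without rounds is included: reading from an empty tape yields two empty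
words, which is the default pair used in the reward function. -/
lemma encPairs_split (h : List (List α × List Bool)) :
    h.flatMap encPair = (h.headD ([], [])).1.map letterSym ++
      (if h = [] then [] else Sum.inl none :: (((h.headD ([], [])).2.map bitSym) ++
        Sum.inr none :: h.tail.flatMap encPair)) := by
  cases h with
  | nil => simp
  | cons p h =>
    simp only [List.flatMap_cons, encPair, encWord, encBits, List.headD_cons, List.tail_cons,
      reduceCtorEq, if_false, List.append_assoc]
    rfl

lemma polyTime_loadPair {X : Type*} {f : X → Shape M} {h : X → List (List α × List Bool)}
    (hreg : ∀ x, (f x).v.reg = none) (hm : ∀ x, (f x).m = []) (hr : ∀ x, (f x).r = [])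
    (htmp : ∀ x, (f x).tmp = []) (ht : ∀ x, (f x).tape = (h x).flatMap encPair) :
    PolyTime loadPair (fun x => (f x).st β) (fun x => Shape.st β { f x with
      m := ((h x).headD ([], [])).1.map letterSym
      r := ((h x).headD ([], [])).2.map bitSym
      tape := (h x).tail.flatMap encPair }) := by
  refine PolyTime.seq (g := fun x => Shape.st β { f x with
      tmp := (((h x).headD ([], [])).1.map letterSym).reverse
      tape := if h x = [] then [] else (((h x).headD ([], [])).2.map bitSym) ++
        Sum.inr none :: (h x).tail.flatMap encPair }) ?_ (PolyTime.seq (g := fun x => Shape.st β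
      { f x with
        m := ((h x).headD ([], [])).1.map letterSym
        tape := if h x = [] then [] else (((h x).headD ([], [])).2.map bitSym) ++
          Sum.inr none :: (h x).tail.flatMap encPair }) ?_ (PolyTime.seq (g := fun x => Shape.st β
      { f x with
        m := ((h x).headD ([], [])).1.map letterSym
        tmp := (((h x).headD ([], [])).2.map bitSym).reverse
        tape := (h x).tail.flatMap encPair }) ?_ ?_))
  · refine polyTime_readWhile (by decide) (l := fun x => ((h x).headD ([], [])).1.map letterSym)
      ?_ ?_ (fun x => (ht x).trans (encPairs_split _)) ?_
    · intro x y hy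
      obtain ⟨a, _, rfl⟩ := List.mem_map.1 hy
      rfl
    · intro x; split_ifs <;> rfl
    · intro x
      refine PState.eq_of (by simp [Reg.setReg_of_eq (hreg x)]) (fun o => ?_) rfl rfl
      cases o <;> simp [htmp]
      split_ifs <;> simp
  · refine polyTime_move (by decide) fun x => ?_
    refine PState.eq_of (by simp [Reg.setReg_of_eq (hreg x)]) (fun o => ?_) rfl rfl
    cases o <;> simp [htmp, hm]
  · refine polyTime_readWhile (by decide) (l := fun x => ((h x).headD ([], [])).2.map bitSym)
      (l' := fun x => if h x = [] then [] else Sum.inr none :: (h x).tail.flatMap encPair)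
      ?_ ?_ ?_ ?_
    · intro x y hy
      obtain ⟨a, _, rfl⟩ := List.mem_map.1 hy
      rfl
    · intro x; split_ifs <;> rfl
    · intro x
      by_cases hx : h x = [] <;> simp [hx]
    · intro x
      refine PState.eq_of (by simp [Reg.setReg_of_eq (hreg x)]) (fun o => ?_) rfl rfl
      by_cases hx : h x = [] <;> cases o <;> simp [htmp, hx]
  · refine polyTime_move (by decide) fun x => ?_
    refine PState.eq_of (by simp [Reg.setReg_of_eq (hreg x)]) (fun o => ?_) rfl rfl
    cases o <;> simp [htmp, hr]

namespace Prog

/-- Empty some of the stacks of a machine. -/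
def clearMachs (i : ι) : List (M i).tm.K → Prog M β
  | [] => .act (Act.load fun v => v.setReg none)
  | k :: ks => .seq (clearMach i k) (clearMachs i ks)

/-- Put a machine into the state of rest. -/
def reset (i : ι) : Prog M β :=
  .seq (clearMachs i Finset.univ.toList) (.act (Act.ctl i fun _ _ _ => ((M i).tm.initialState, none)))

end Prog

lemma polyTime_clearMachs (i : ι) (ks : List (M i).tm.K) :
    PolyTime (clearMachs i ks) (fun s : {s : PState M β // s.own .tmp = []} => s.1)
      (fun s => (s.1.setV (s.1.v.setReg none)).setMach i ⟨(s.1.mach i).l, (s.1.mach i).var,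
        fun k => if k ∈ ks then [] else (s.1.mach i).stk k⟩) := by
  induction ks with
  | nil =>
    refine PolyTime.act _ fun x => PState.eq_of rfl (fun _ => rfl) rfl ?_
    simp [Act.load, PState.setMach]
  | cons k ks ih =>
    have h2 := ih.comp (fun s : {s : PState M β // s.own .tmp = []} =>
      ⟨(s.1.setV (s.1.v.setReg none)).setMach i
        ⟨(s.1.mach i).l, (s.1.mach i).var, Function.update (s.1.mach i).stk k []⟩, by simp [s.2]⟩)
    refine PolyTime.seq (PolyTime.of_linear 6 fun s => ⟨_, ?_, runs_clearMach i k s.2⟩)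
      (h2.congr (fun _ => rfl) fun s => ?_)
    · have h1 := QueryTM.stk_le_csize (s.1.mach i) k
      have h2 := s.1.csize_le_size i
      omega
    · refine PState.eq_of rfl (fun _ => rfl) rfl ?_
      simp only [PState.setMach, PState.setV_mach, Function.update_self, Function.update_idem]
      congr 1
      congr 1
      funext k'
      by_cases h : k' = k
      · subst h; simp
      · simp [h]

/-- Every stage must find all machines at rest, so the one that has been used is cleaned up whatever
configuration it was left in. -/
lemma polyTime_reset (i : ι) :
    PolyTime (reset i) (fun s : {s : PState M β // s.own .tmp = []} => s.1)
      (fun s => (s.1.setV (s.1.v.setReg none)).setMach i (M i).rest) := by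
  refine (polyTime_clearMachs i _).seq (PolyTime.act _ fun s => ?_)
  refine PState.eq_of rfl (fun _ => rfl) rfl ?_
  simp [Act.ctl, PState.setMach, QueryTM.rest]

end

/-! ### The program that examines one claim. -/

section

open Turing Prog

variable {ι α β : Type} [DecidableEq ι] [Fintype ι] {M : ι → QueryTM (Sym α) α}

/-- A claim: a word, the claimed bit, and the random bits for its examination. -/
abbrev Claim (α : Type) : Type := List α × Bool × List Bool

/-- The rounds that have not been read. -/
abbrev Rounds (α : Type) : Type := List (List α × List Bool)

namespace Prog

/-- Prepare the examination of a claim: read the certificate and the bits that break ties. -/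
def prepare (q D : Polynomial ℕ) : Prog M β :=
  .seq (unary q) (.seq takeBits (.seq (unary D) (.seq (.act (Act.load fun v => { v with go := true }))
    (.seq testBlock (.seq (clear .tmp) (.seq (clear .r)
      (.act (Act.load fun v => { v with tie := v.go, go := true }))))))))

/-- Determine the number of steps to be simulated. -/
def countSteps (D : Polynomial ℕ) : Prog M β :=
  .seq (unary D) (.seq (move .acc .d) (.seq (unary D) (.seq (drain .d nextBlock) (clear .acc))))

/-- Start a machine. -/
def launch (i : ι) : Prog M β :=
  .seq (.act (Act.feed i fun _ => some (Sum.inr none))) (.seq (feedAll i .y)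
    (.seq (.act (Act.feed i fun _ => some (Sum.inl none))) (.seq (feedAll i .z)
      (.act (Act.ctl i fun _ w _ => (w, some (M i).tm.main))))))

/-- Evaluate the simulation. -/
def evaluate (a₀ : α) (i : ι) : Prog M β :=
  .ite (fun v => v.1.go)
    (.seq (.act (Act.popMach i (M i).tm.k₁ fun v x =>
      { Reg.init α with done := true, res := v.b == (x.elim false (M i).outBit || v.tie) }))
      (clear .r))
    (.ite (fun v => (v.2 i).2.elim false (M i).isAsk)
      (.seq (popR .m) (.seq (.act (Act.load fun v => { Reg.init α with b := isYes a₀ v.reg }))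
        (moveMach i (M i).qs (fun x => letterSym ((M i).letter x)) .z)))
      (.seq (.act (Act.load fun _ => { Reg.init α with done := true })) (clear .r)))

/-- Examine a claim. -/
def stage (a₀ : α) (q D : Polynomial ℕ) (i : ι) : Prog M β :=
  .seq (prepare q D) (.seq loadPair (.seq (countSteps D) (.seq (launch i)
    (.seq (drain .t (tickBody a₀ i)) (.seq (evaluate a₀ i) (.seq (clear .m) (reset i)))))))

end Prog

/-- The state before the examination of a claim. -/
def Claim.shape (x : Claim α) (h : Rounds α) : Shape M where
  v := { Reg.init α with b := x.2.1 }
  tape := h.flatMap encPair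
  z := (x.1.map letterSym).reverse
  r := x.2.2.map bitSym

/-- The state after the examination of a claim. -/
def outcomeShape (o : Bool ⊕ Claim α) (h : Rounds α) : Shape M :=
  o.elim (fun b => { v := { Reg.init α with done := true, res := b }, tape := h.flatMap encPair })
    fun x => x.shape h

section
variable (a₀ : α) (q D : Polynomial ℕ) (i : ι)

/-- The tie bits are tested like a block; the resulting flag `go` is then saved as `tie`, and `go`
is set again for the count of blocks. The unread coins of the claim are discarded, since the blocks
come from the next round. -/
lemma polyTime_prepare :
    PolyTime (prepare q D) (fun x : Claim α × Rounds α => (x.1.shape x.2 : Shape M).st β)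
      (fun x => Shape.st β { (x.1.shape x.2 : Shape M) with
        r := []
        y := ((Level.cert ⟨M i, q, D⟩ x.1.1 x.1.2.2).map bitSym).reverse
        v := { Reg.init α with
          b := x.1.2.1, tie := Level.tie ⟨M i, q, D⟩ x.1.1 x.1.2.2, go := true } }) := by
  refine PolyTime.seq (g := fun x => Shape.st β { (x.1.shape x.2 : Shape M) with
      acc := List.replicate (q.eval x.1.1.length) mark }) ?_ (PolyTime.seq (g := fun x =>
    Shape.st β { (x.1.shape x.2 : Shape M) with
      r := (x.1.2.2.drop (q.eval x.1.1.length)).map bitSym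
      y := ((x.1.2.2.take (q.eval x.1.1.length)).map bitSym).reverse }) ?_
    (PolyTime.seq (g := fun x =>
    Shape.st β { (x.1.shape x.2 : Shape M) with
      acc := List.replicate (D.eval x.1.1.length) mark
      r := (x.1.2.2.drop (q.eval x.1.1.length)).map bitSym
      y := ((x.1.2.2.take (q.eval x.1.1.length)).map bitSym).reverse }) ?_
    (PolyTime.seq (g := fun x =>
    Shape.st β { (x.1.shape x.2 : Shape M) with
      v := { Reg.init α with b := x.1.2.1, go := true }
      acc := List.replicate (D.eval x.1.1.length) mark
      r := (x.1.2.2.drop (q.eval x.1.1.length)).map bitSym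
      y := ((x.1.2.2.take (q.eval x.1.1.length)).map bitSym).reverse }) ?_
    (PolyTime.seq (g := fun x =>
    Shape.st β { (x.1.shape x.2 : Shape M) with
      v := { Reg.init α with b := x.1.2.1, go := Level.tie ⟨M i, q, D⟩ x.1.1 x.1.2.2 }
      tmp := List.replicate (D.eval x.1.1.length) mark
      r := ((x.1.2.2.drop (q.eval x.1.1.length)).drop (D.eval x.1.1.length)).map bitSym
      y := ((x.1.2.2.take (q.eval x.1.1.length)).map bitSym).reverse }) ?_
    (PolyTime.seq (g := fun x =>
    Shape.st β { (x.1.shape x.2 : Shape M) with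
      v := { Reg.init α with b := x.1.2.1, go := Level.tie ⟨M i, q, D⟩ x.1.1 x.1.2.2 }
      r := ((x.1.2.2.drop (q.eval x.1.1.length)).drop (D.eval x.1.1.length)).map bitSym
      y := ((x.1.2.2.take (q.eval x.1.1.length)).map bitSym).reverse }) ?_
    (PolyTime.seq (g := fun x =>
    Shape.st β { (x.1.shape x.2 : Shape M) with
      v := { Reg.init α with b := x.1.2.1, go := Level.tie ⟨M i, q, D⟩ x.1.1 x.1.2.2 }
      r := []
      y := ((x.1.2.2.take (q.eval x.1.1.length)).map bitSym).reverse }) ?_ ?_))))))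
  · refine polyTime_unary' q ?_ ?_ ?_ ?_ ?_ <;> intro x
    iterate 4 rfl
    refine PState.eq_of rfl (fun o => ?_) rfl rfl
    cases o <;> simp [Claim.shape]
  · refine polyTime_takeBits fun x => PState.eq_of rfl (fun o => ?_) rfl rfl
    cases o <;> simp [Claim.shape]
  · refine polyTime_unary' D ?_ ?_ ?_ ?_ ?_ <;> intro x
    iterate 4 rfl
    refine PState.eq_of rfl (fun o => ?_) rfl rfl
    cases o <;> simp [Claim.shape]
  · exact polyTime_load _ fun x => rfl
  · refine polyTime_testBlock fun x => PState.eq_of ?_ (fun o => ?_) rfl rfl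
    · simp [Reg.setReg, Reg.init, Level.tie]
      rw [← List.map_drop, all_take_bits]
    · cases o <;> simp [Claim.shape]
  · refine polyTime_clear _ fun x => PState.eq_of rfl (fun o => ?_) rfl rfl
    cases o <;> simp [Claim.shape]
  · refine polyTime_clear _ fun x => PState.eq_of rfl (fun o => ?_) rfl rfl
    cases o <;> simp [Claim.shape]
  · exact polyTime_load _ fun x => rfl

/-- The value of `D` is computed twice: it serves in `d` as the number of blocks and in `acc` as
their length. -/
lemma polyTime_countSteps {X : Type*} {f : X → Shape M} {n : X → ℕ} {R : X → List Bool}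
    (hz : ∀ x, (f x).z.length = n x) (hreg : ∀ x, (f x).v.reg = none)
    (hgo : ∀ x, (f x).v.go = true) (hr : ∀ x, (f x).r = (R x).map bitSym)
    (hacc : ∀ x, (f x).acc = []) (htmp : ∀ x, (f x).tmp = []) (hd : ∀ x, (f x).d = [])
    (ht : ∀ x, (f x).t = []) :
    PolyTime (countSteps D) (fun x => (f x).st β) (fun x => Shape.st β { f x with
      t := List.replicate (blocks (D.eval (n x)) (D.eval (n x)) (R x)).1 mark
      r := (blocks (D.eval (n x)) (D.eval (n x)) (R x)).2.2.map bitSym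
      v := { (f x).v with go := (blocks (D.eval (n x)) (D.eval (n x)) (R x)).2.1 } }) := by
  refine PolyTime.seq (g := fun x => Shape.st β { f x with
      acc := List.replicate (D.eval (n x)) mark }) ?_ (PolyTime.seq (g := fun x =>
    Shape.st β { f x with d := List.replicate (D.eval (n x)) mark }) ?_
    (PolyTime.seq (g := fun x => Shape.st β { f x with
      d := List.replicate (D.eval (n x)) mark
      acc := List.replicate (D.eval (n x)) mark }) ?_
    (PolyTime.seq (g := fun x => Shape.st β { f x with
      acc := List.replicate (D.eval (n x)) mark
      t := List.replicate (blocks (D.eval (n x)) (D.eval (n x)) (R x)).1 mark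
      r := (blocks (D.eval (n x)) (D.eval (n x)) (R x)).2.2.map bitSym
      v := { (f x).v with go := (blocks (D.eval (n x)) (D.eval (n x)) (R x)).2.1 } }) ?_ ?_)))
  · refine polyTime_unary' D hacc (fun x => rfl) htmp hreg fun x => ?_
    refine PState.eq_of rfl (fun o => ?_) rfl rfl
    cases o <;> simp [hz]
  · refine polyTime_move (by decide) fun x =>
      PState.eq_of (by simp [Reg.setReg_of_eq (hreg x)]) (fun o => ?_) rfl rfl
    cases o <;> simp [hd, hacc]
  · refine polyTime_unary' D hacc (fun x => rfl) htmp hreg fun x => ?_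
    refine PState.eq_of rfl (fun o => ?_) rfl rfl
    cases o <;> simp [hz]
  · refine polyTime_blocks (n := fun x => D.eval (n x)) (R := R) (fun x => rfl) htmp hgo hr
      fun x => ?_
    refine PState.eq_of ?_ (fun o => ?_) rfl rfl
    · simp [Reg.setReg_of_eq (hreg x)]
    · cases o <;> simp [hd, ht]
  · refine polyTime_clear _ fun x =>
      PState.eq_of (by simp [Reg.setReg, hreg x]) (fun o => ?_) rfl rfl
    cases o <;> simp [hacc]

/-- The input stack is filled from its bottom, so the end markers are pushed before the words to
which they belong. The words are stored in reverse order, and feeding them reverses them again. -/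
lemma polyTime_launch {X : Type*} {f : X → Shape M} {z : X → List α} {y : X → List Bool}
    (hz : ∀ x, (f x).z = ((z x).map letterSym).reverse)
    (hy : ∀ x, (f x).y = ((y x).map bitSym).reverse) (hreg : ∀ x, (f x).v.reg = none)
    (hmach : ∀ x, (f x).mach = fun i => (M i).rest) :
    PolyTime (launch i) (fun x => (f x).st β) (fun x => Shape.st β { f x with
      z := []
      y := []
      mach := Function.update (fun i => (M i).rest) i ((M i).start (encPair (z x, y x))) }) := by
  have hm : ∀ l : List (Sym α), (⟨none, (M i).tm.initialState,
      Function.update (fun _ => []) (M i).tm.k₀ (l.map (M i).inp)⟩ : (M i).Config) =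
      ⟨none, (M i).tm.initialState, ((M i).start l).stk⟩ := fun l => rfl
  refine PolyTime.seq (g := fun x => Shape.st β { f x with
      mach := Function.update (fun i => (M i).rest) i
        ⟨none, (M i).tm.initialState, ((M i).start [Sum.inr none]).stk⟩ }) ?_
    (PolyTime.seq (g := fun x => Shape.st β { f x with
      y := []
      mach := Function.update (fun i => (M i).rest) i
        ⟨none, (M i).tm.initialState, ((M i).start (encBits (y x))).stk⟩ }) ?_
    (PolyTime.seq (g := fun x => Shape.st β { f x with
      y := []
      mach := Function.update (fun i => (M i).rest) i
        ⟨none, (M i).tm.initialState, ((M i).start (Sum.inl none :: encBits (y x))).stk⟩ }) ?_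
    (PolyTime.seq (g := fun x => Shape.st β { f x with
      y := []
      z := []
      mach := Function.update (fun i => (M i).rest) i
        ⟨none, (M i).tm.initialState, ((M i).start (encPair (z x, y x))).stk⟩ }) ?_ ?_)))
  · refine PolyTime.act _ fun x => PState.eq_of rfl (fun o => ?_) rfl ?_
    · cases o <;> simp [Act.feed]
    · simp [Act.feed, PState.setMach, hmach, QueryTM.rest, QueryTM.start]
  · refine polyTime_feedAll i .y fun x =>
      PState.eq_of (by simp [Reg.setReg_of_eq (hreg x)]) (fun o => ?_) rfl ?_
    · cases o <;> simp
    · simp [PState.setMach, hy, QueryTM.start, encBits]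
      rfl
  · refine PolyTime.act _ fun x => PState.eq_of rfl (fun o => ?_) rfl ?_
    · cases o <;> simp [Act.feed]
    · simp [Act.feed, PState.setMach, QueryTM.start]
  · refine polyTime_feedAll i .z fun x =>
      PState.eq_of (by simp [Reg.setReg_of_eq (hreg x)]) (fun o => ?_) rfl ?_
    · cases o <;> simp
    · simp [PState.setMach, hz, QueryTM.start, encPair, encWord]
      rfl
  · refine PolyTime.act _ fun x => PState.eq_of rfl (fun o => ?_) rfl ?_
    · cases o <;> simp [Act.ctl]
    · simp [Act.ctl, PState.setMach, QueryTM.start]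

end

end

section

open Turing Prog

variable {ι α β : Type} [DecidableEq ι] [Fintype ι] {M : ι → QueryTM (Sym α) α}

/-- The outcome of an examination. -/
def outcome {T : QueryTM (Sym α) α} (a₀ : α) (b tie go : Bool) (r : List Bool) (m : List α)
    (c : T.Config) : Bool ⊕ Claim α :=
  if go then .inl (b == (QueryTM.output c || tie))
  else if QueryTM.asks c then .inr (QueryTM.query c, headBit a₀ m, r)
  else .inl false

/-- The rest of the message and the last configuration vary with the case, but both are erased
afterwards; it suffices that they exist. -/
lemma runs_evaluate (a₀ : α) (i : ι) (b tie go : Bool) (r : List Bool) (m : List α)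
    (h : Rounds α) (c : (M i).Config) :
    ∃ (m' : List (Sym α)) (c' : (M i).Config), ∃ n ≤ 10 * ((Shape.st β
      { v := { Reg.init α with b := b, tie := tie, go := go }
        tape := h.flatMap encPair
        r := r.map bitSym
        m := m.map letterSym
        mach := Function.update (fun i => (M i).rest) i c }).size + 1),
      Runs (evaluate a₀ i) (Shape.st β
      { v := { Reg.init α with b := b, tie := tie, go := go }
        tape := h.flatMap encPair
        r := r.map bitSym
        m := m.map letterSym
        mach := Function.update (fun i => (M i).rest) i c }) n (Shape.st β
      { (outcomeShape (outcome a₀ b tie go r m c) h : Shape M) with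
        m := m'
        mach := Function.update (fun i => (M i).rest) i c' }) := by
  set f : PState M β := Shape.st β
      { v := { Reg.init α with b := b, tie := tie, go := go }
        tape := h.flatMap encPair
        r := r.map bitSym
        m := m.map letterSym
        mach := Function.update (fun i => (M i).rest) i c } with hf
  have hr : r.length ≤ f.size := by simpa [hf] using f.own_le_size .r
  have hc : (c.stk (M i).qs).length ≤ f.size := by
    have h1 := QueryTM.stk_le_csize c (M i).qs
    have h2 := f.csize_le_size i
    simp only [hf, Shape.st_mach, Function.update_self] at h2
    exact h1.trans h2
  cases hg : go with
  | true =>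
    refine ⟨m.map letterSym, ⟨c.l, c.var, Function.update c.stk (M i).tm.k₁
      (c.stk (M i).tm.k₁).tail⟩, 1 + (3 * r.length + 2) + 1,
      by omega, ?_⟩
    refine (Runs.iteT ?_ ((Runs.act _ _).seq ((runs_clear .r _).mono ?_))).to le_rfl ?_
    · exact hg
    · simp [Act.popMach, hf]
    · refine PState.eq_of ?_ (fun o => ?_) rfl ?_
      · simp [outcomeShape, outcome, hg, Act.popMach, hf, QueryTM.output, Reg.setReg, Reg.init]
      · cases o <;> simp [outcomeShape, outcome, hg, Act.popMach, hf]
      · simp [Act.popMach, hf, PState.setMach]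
  | false =>
    cases ha : QueryTM.asks c with
    | true =>
      refine ⟨(m.map letterSym).tail, ⟨c.l, c.var, Function.update c.stk (M i).qs []⟩,
        1 + (1 + (3 * (c.stk (M i).qs).length + 2)) + 1 + 1, by omega, ?_⟩
      refine (Runs.iteF hg (Runs.iteT ?_ ((runs_popR .m _).seq ((Runs.act _ _).seq
        ((runs_moveMach i _ _ _ _).mono ?_))))).to le_rfl ?_
      · simpa [PState.var, hf, QueryTM.asks] using ha
      · simp [Act.load, hf]
      · refine PState.eq_of ?_ (fun o => ?_) rfl ?_
        · simp [outcomeShape, outcome, ha, Act.load, hf, Reg.init, Claim.shape,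
            ← isYes_head]
          rfl
        · cases o <;> simp [outcomeShape, outcome, ha, Act.load, hf, Claim.shape, QueryTM.query]
           
        · simp [Act.load, hf, PState.setMach]
    | false =>
      refine ⟨m.map letterSym, c, 1 + (3 * r.length + 2) + 1 + 1, by omega, ?_⟩
      refine (Runs.iteF hg (Runs.iteF ?_ ((Runs.act _ _).seq ((runs_clear .r _).mono ?_)))).to
        le_rfl ?_
      · simpa [PState.var, hf, QueryTM.asks] using ha
      · simp [Act.load, hf]
      · refine PState.eq_of ?_ (fun o => ?_) rfl ?_
        · simp [outcomeShape, outcome, ha, Act.load, hf, Reg.init, Reg.setReg]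
        · cases o <;> simp [outcomeShape, outcome, ha, Act.load, hf]
        · simp [Act.load, hf]

lemma polyTime_stage (a₀ : α) (q D : Polynomial ℕ) (i : ι) :
    PolyTime (stage a₀ q D i) (fun x : Claim α × Rounds α => (x.1.shape x.2 : Shape M).st β)
      (fun x => Shape.st β (outcomeShape (Level.stage a₀ ⟨M i, q, D⟩ x.1.1 x.1.2.1 x.1.2.2
        (x.2.headD ([], []))) x.2.tail)) := by
  let L : Level α := ⟨M i, q, D⟩
  let u := fun x : Claim α × Rounds α =>
    blocks (D.eval x.1.1.length) (D.eval x.1.1.length) (x.2.headD ([], [])).2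
  let c := fun x : Claim α × Rounds α =>
    L.simulate a₀ x.1.1 (L.cert x.1.1 x.1.2.2) (x.2.headD ([], [])).1 (u x).1
  have key := fun x : Claim α × Rounds α => runs_evaluate (β := β) a₀ i x.1.2.1
    (L.tie x.1.1 x.1.2.2) (u x).2.1 (u x).2.2 (c x).2 x.2.tail (c x).1
  choose m' c' n hn hruns using key
  have ho : ∀ x, outcome a₀ x.1.2.1 (L.tie x.1.1 x.1.2.2) (u x).2.1 (u x).2.2 (c x).2 (c x).1 =
      Level.stage a₀ L x.1.1 x.1.2.1 x.1.2.2 (x.2.headD ([], [])) := fun x => rfl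
  simp only [ho] at hruns
  refine (polyTime_prepare q D i).seq (PolyTime.seq
    (polyTime_loadPair (h := fun x => x.2) (fun x => rfl) (fun x => rfl) (fun x => rfl)
      (fun x => rfl) (fun x => rfl)) (PolyTime.seq
    (polyTime_countSteps D (n := fun x => x.1.1.length) (R := fun x => (x.2.headD ([], [])).2)
      (fun x => by simp [Claim.shape]) (fun x => rfl) (fun x => rfl) (fun x => rfl) (fun x => rfl)
      (fun x => rfl) (fun x => rfl) (fun x => rfl)) (PolyTime.seq
    (polyTime_launch i (z := fun x => x.1.1) (y := fun x => L.cert x.1.1 x.1.2.2) (fun x => rfl)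
      (fun x => rfl) (fun x => rfl) (fun x => rfl)) (PolyTime.seq
    (polyTime_ticks a₀ i (m := fun x => (x.2.headD ([], [])).1) (fun x => rfl) (fun x => rfl)
      (g := fun x => Shape.st β
        { v := { Reg.init α with b := x.1.2.1, tie := L.tie x.1.1 x.1.2.2, go := (u x).2.1 }
          tape := x.2.tail.flatMap encPair
          r := (u x).2.2.map bitSym
          m := (c x).2.map letterSym
          mach := Function.update (fun i => (M i).rest) i (c x).1 })
      (fun x => ?_)) (PolyTime.seq
    (PolyTime.of_linear 10 fun x => ⟨n x, hn x, hruns x⟩) (PolyTime.seq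
    (polyTime_clear .m (g := fun x => Shape.st β
      { (outcomeShape (Level.stage a₀ L x.1.1 x.1.2.1 x.1.2.2 (x.2.headD ([], []))) x.2.tail :
          Shape M) with
        mach := Function.update (fun i => (M i).rest) i (c' x) }) (fun x => ?_))
    (((polyTime_reset i).comp fun x => ⟨Shape.st β
      { (outcomeShape (Level.stage a₀ L x.1.1 x.1.2.1 x.1.2.2 (x.2.headD ([], []))) x.2.tail :
          Shape M) with
        mach := Function.update (fun i => (M i).rest) i (c' x) }, ?_⟩).congr (fun x => rfl)
      fun x => ?_)))))))
  · refine PState.eq_of rfl (fun o => ?_) rfl ?_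
    · cases o <;> simp [c, u, Level.simulate, Claim.shape, L]
    · simp [c, u, Level.simulate, PState.setMach, L]
  · refine PState.eq_of ?_ (fun o => ?_) rfl rfl
    · generalize Level.stage _ _ _ _ _ _ = o
      cases o <;> rfl
    · generalize Level.stage _ _ _ _ _ _ = o'
      cases o <;> cases o' <;> simp [outcomeShape, Claim.shape]
  · generalize Level.stage _ _ _ _ _ _ = o
    cases o <;> rfl
  · refine PState.eq_of ?_ (fun o => ?_) rfl ?_
    · generalize Level.stage _ _ _ _ _ _ = o
      cases o <;> rfl
    · rfl
    · generalize Level.stage _ _ _ _ _ _ = o'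
      cases o' <;> simp [outcomeShape, Claim.shape, PState.setMach]

end

/-! ### The program for the reward bit. -/

section

open Turing Prog

variable {ι α β : Type} [DecidableEq ι] [Fintype ι] {M : ι → QueryTM (Sym α) α}

namespace Prog

/-- Read the input and the first round. -/
def readInput (a₀ : α) : Prog M β :=
  .seq (readWhile isLetter .z) (.seq loadPair (.seq (popR .m)
    (.seq (.act (Act.load fun v => { Reg.init α with b := isYes a₀ v.reg })) (clear .m))))

/-- Examine claims until the reward is known. -/
def examine (a₀ : α) (q D : ι → Polynomial ℕ) : List ι → Prog M β
  | [] => nop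
  | i :: is => .seq (.ite (fun v => v.1.done) nop (stage a₀ (q i) (D i) i)) (examine a₀ q D is)

/-- Output the reward. -/
def finish : Prog M Bool :=
  .seq (clear .tape) (.seq (clear .z) (.seq (clear .r) (.seq (.act (Act.out Reg.res))
    (.act (Act.load fun _ => Reg.init α)))))

end Prog

/-- The examination of a claim, if there is one. -/
def examineNext (a₀ : α) (L : Level α) (s : (Bool ⊕ Claim α) × Rounds α) :
    (Bool ⊕ Claim α) × Rounds α :=
  match s.1 with
  | .inl b => (.inl b, s.2)
  | .inr x => (L.stage a₀ x.1 x.2.1 x.2.2 (s.2.headD ([], [])), s.2.tail)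

/-- The outcome of the examinations on the given levels. -/
def examination (a₀ : α) : List (Level α) → (Bool ⊕ Claim α) × Rounds α →
    (Bool ⊕ Claim α) × Rounds α
  | [], s => s
  | L :: Ls, s => examination a₀ Ls (examineNext a₀ L s)

lemma examination_inl (a₀ : α) (Ls : List (Level α)) (b : Bool) (h : Rounds α) :
    examination a₀ Ls (.inl b, h) = (.inl b, h) := by
  induction Ls with
  | nil => rfl
  | cons L Ls ih => exact ih

/-- The program runs through all levels and idles once there is a verdict, whereas `claimReward`
stops there. A claim that is still open after the last level earns nothing in both descriptions. -/
lemma examination_fst (a₀ : α) (Ls : List (Level α)) (x : Claim α) (h : Rounds α) :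
    (examination a₀ Ls (.inr x, h)).1.elim id (fun _ => false) = claimReward a₀ Ls x h := by
  induction Ls generalizing x h with
  | nil => rfl
  | cons L Ls ih =>
    simp only [examination, examineNext, claimReward]
    cases L.stage a₀ x.1 x.2.1 x.2.2 (h.headD ([], [])) with
    | inl b => simp [examination_inl]
    | inr x' => simp [ih]

lemma polyTime_readInput (a₀ : α) :
    PolyTime (readInput a₀) (fun i : RInput α => PState.initial M β (encR i))
      (fun i => Shape.st β (Claim.shape (i.1, headBit a₀ (i.2.headD ([], [])).1,
        (i.2.headD ([], [])).2) i.2.tail)) := by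
  refine PolyTime.seq (g := fun i => Shape.st β
      { z := (i.1.map letterSym).reverse, tape := i.2.flatMap encPair }) ?_
    (PolyTime.seq (polyTime_loadPair (h := fun i => i.2) (fun i => rfl) (fun i => rfl)
      (fun i => rfl) (fun i => rfl) (fun i => rfl)) (PolyTime.seq (PolyTime.act _ fun i => rfl)
      (PolyTime.seq (PolyTime.act _ fun i => rfl) (polyTime_clear .m fun i => ?_))))
  · refine polyTime_readWhile (by decide) (l := fun i => i.1.map letterSym)
      (l' := fun i => Sum.inl none :: i.2.flatMap encPair) ?_ ?_ ?_ ?_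
    · intro i y hy
      obtain ⟨a, _, rfl⟩ := List.mem_map.1 hy
      rfl
    · exact fun i => rfl
    · intro i
      rw [PState.initial_eq]
      simp [encR, encWord]
      exact fun _ _ => rfl
    · intro i
      rw [PState.initial_eq]
      refine PState.eq_of rfl (fun o => ?_) rfl rfl
      cases o <;> simp
  · refine PState.eq_of ?_ (fun o => ?_) rfl rfl
    · simp [Act.load, Act.pop, Claim.shape, Reg.setReg, Reg.init, ← isYes_head]
    · cases o <;> simp [Act.load, Act.pop, Claim.shape]

lemma polyTime_examineNext (a₀ : α) (q D : Polynomial ℕ) (i : ι) :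
    PolyTime (.ite (fun v => v.1.done) nop (stage a₀ q D i))
      (fun s : (Bool ⊕ Claim α) × Rounds α => Shape.st β (outcomeShape s.1 s.2 : Shape M))
      (fun s => Shape.st β (outcomeShape (examineNext a₀ ⟨M i, q, D⟩ s).1
        (examineNext a₀ ⟨M i, q, D⟩ s).2)) := by
  refine PolyTime.ite (PolyTime.act _ ?_) ?_
  · rintro ⟨⟨b | x, h⟩, hs⟩
    · rfl
    · simp [PState.var, outcomeShape, Claim.shape, Reg.init] at hs
  · have : ∀ s : {s : (Bool ⊕ Claim α) × Rounds α //
        (Shape.st β (outcomeShape s.1 s.2 : Shape M)).var.1.done = false}, ∃ x, s.1.1 = .inr x := by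
      rintro ⟨⟨b | x, h⟩, hs⟩
      · simp [PState.var, outcomeShape] at hs
      · exact ⟨x, rfl⟩
    choose x hx using this
    refine ((polyTime_stage a₀ q D i).comp fun s => (x s, s.1.2)).congr ?_ ?_ <;>
      intro s <;> simp only [hx, outcomeShape, examineNext, Sum.elim_inr]

lemma polyTime_examine (a₀ : α) (q D : ι → Polynomial ℕ) (is : List ι) :
    PolyTime (examine a₀ q D is)
      (fun s : (Bool ⊕ Claim α) × Rounds α => Shape.st β (outcomeShape s.1 s.2 : Shape M))
      (fun s => Shape.st β
        (outcomeShape (examination a₀ (is.map fun i => ⟨M i, q i, D i⟩) s).1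
          (examination a₀ (is.map fun i => ⟨M i, q i, D i⟩) s).2)) := by
  induction is with
  | nil => exact PolyTime.act _ fun s => rfl
  | cons i is ih => exact (polyTime_examineNext a₀ (q i) (D i) i).seq (ih.comp _)

lemma polyTime_finish :
    PolyTime (M := M) finish (fun s : (Bool ⊕ Claim α) × Rounds α =>
        Shape.st Bool (outcomeShape s.1 s.2 : Shape M))
      (fun s => (PState.initial M Bool []).setOut [s.1.elim id fun _ => false]) := by
  refine PolyTime.seq (polyTime_clear .tape fun s => rfl) (PolyTime.seq
    (polyTime_clear .z fun s => rfl) (PolyTime.seq (polyTime_clear .r fun s => rfl) (PolyTime.seq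
    (PolyTime.act _ fun s => rfl) (PolyTime.act _ fun s => ?_))))
  rw [PState.initial_eq]
  obtain ⟨b | x, h⟩ := s
  · refine PState.eq_of rfl (fun o => ?_) rfl rfl
    cases o <;> rfl
  · refine PState.eq_of rfl (fun o => ?_) rfl rfl
    cases o <;> rfl

lemma PolyTime.computable [Finite α] {γ δ : Type} {p : Prog M β} (enc : γ → List (Sym α))
    (dec : δ → List β) (f : γ → δ) (h : PolyTime p (fun i => PState.initial M β (enc i))
      (fun i => (PState.initial M β []).setOut (dec (f i)))) :
    Nonempty (TM2ComputableInPolyTime enc dec f) :=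
  let ⟨P, hP⟩ := h
  Prog.computable enc dec f p P fun i => by simpa only [PState.size_initial] using hP i

/-- The reward can be computed in polynomial time. -/
theorem rewardBit_polyTime [Finite α] (a₀ : α) (Ls : List (Level α)) :
    Nonempty (TM2ComputableInPolyTime encR (fun w : List Bool => w)
      fun i => [rewardBit a₀ Ls i]) := by
  let M : Fin Ls.length → QueryTM (Sym α) α := fun i => (Ls.get i).T
  let q : Fin Ls.length → Polynomial ℕ := fun i => (Ls.get i).q
  let D : Fin Ls.length → Polynomial ℕ := fun i => (Ls.get i).D
  have hLs : (List.finRange Ls.length).map (fun i => (⟨M i, q i, D i⟩ : Level α)) = Ls :=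
    List.map_get_finRange Ls
  let s : RInput α → (Bool ⊕ Claim α) × Rounds α := fun i =>
    (.inr (i.1, headBit a₀ (i.2.headD ([], [])).1, (i.2.headD ([], [])).2), i.2.tail)
  have h2 := (polyTime_examine (M := M) (β := Bool) a₀ q D (List.finRange Ls.length)).comp s
  have h3 := (polyTime_finish (M := M)).comp fun i => examination a₀
    ((List.finRange Ls.length).map fun i => (⟨M i, q i, D i⟩ : Level α)) (s i)
  have h := (polyTime_readInput (M := M) (β := Bool) a₀).seq (h2.seq h3)
  simp only [s, hLs, examination_fst] at h
  exact h.computable _ (fun w : List Bool => w) (fun i => [rewardBit a₀ Ls i])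

end

section

open Turing Prog

variable {ι α β : Type} [DecidableEq ι] [Fintype ι] {M : ι → QueryTM (Sym α) α}

/-! ### The message function and the value function -/

/-- Arthur's message: all his random bits, written with two letters. -/
def publish (a₀ a₁ : α) (i : VInput α) : List α :=
  i.2.2.flatten.map fun b => if b then a₀ else a₁

/-- The bit that is expressed by the first message. -/
def firstBit (a₀ : α) (i : ValInput α) : List Bool := [headBit a₀ (i.2.headD [])]

namespace Prog

/-- Collect the bits of the input. -/
def collect : Prog M β :=
  drain .tape (.ite (fun v => v.1.reg.elim false isBit) (pushR .tmp) nop)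

/-- Write bits on the output stack. -/
def writeBits (a₀ a₁ : β) : Prog M β :=
  drain .tmp (.act (Act.out fun v => if v.reg.elim false isOne then a₀ else a₁))

end Prog

lemma runs_collect (s : PState M β) :
    Runs collect s (4 * (s.own .tape).length + 2)
      ((s.popped .tape none []).setOwn .tmp
        (((s.own .tape).filter isBit).reverse ++ s.own .tmp)) := by
  have h := runs_drain (o := .tape) (c := 2) (fun _ _ => True)
    (G := fun s : PState M β => if s.v.reg.elim false isBit then
      s.setOwn .tmp (s.v.reg.toList ++ s.own .tmp) else s)
    (body := .ite (fun v => v.1.reg.elim false isBit) (pushR .tmp) nop)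
    (fun x l s _ => by
      cases hx : isBit x with
      | true =>
        have : (s.popped .tape (some x) l).v.reg.elim false isBit = true := by simpa using hx
        rw [if_pos this]
        exact ⟨Runs.iteT this (runs_pushR .tmp _), by simp, trivial⟩
      | false =>
        have : (s.popped .tape (some x) l).v.reg.elim false isBit = false := by simpa using hx
        rw [if_neg (by simpa using hx)]
        exact ⟨Runs.iteF this (runs_nop _), by simp, trivial⟩) (s := s) trivial
  have key : ∀ l (s : PState M β), drainF .tape (fun s : PState M β =>
      if s.v.reg.elim false isBit then s.setOwn .tmp (s.v.reg.toList ++ s.own .tmp) else s) l s =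
      (s.popped .tape none []).setOwn .tmp ((l.filter isBit).reverse ++ s.own .tmp) := by
    intro l
    induction l with
    | nil =>
      intro s
      refine PState.eq_of rfl (fun o => ?_) rfl rfl
      cases o <;> simp [drainF]
    | cons x l ih =>
      intro s
      rw [drainF, ih]
      cases hx : isBit x
      all_goals
        refine PState.eq_of (by simp [hx]) (fun o => ?_) (by simp [hx]) (by simp [hx])
        cases o <;> simp [hx]
  rwa [key] at h

lemma runs_writeBits (a₀ a₁ : β) {s : PState M β} (R : List Bool) (h : s.own .tmp = R.map bitSym) :
    Runs (writeBits a₀ a₁) s (3 * R.length + 2)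
      ((s.popped .tmp none []).setOut ((R.map fun b => if b then a₀ else a₁).reverse ++ s.out)) := by
  have h1 := runs_drain (o := .tmp) (c := 1) (fun _ _ => True)
    (G := fun s : PState M β => s.setOut ((if s.v.reg.elim false isOne then a₀ else a₁) :: s.out))
    (body := .act (Act.out fun v => if v.reg.elim false isOne then a₀ else a₁))
    (fun x l s _ => ⟨Runs.act _ _, by simp, trivial⟩) (s := s) trivial
  have key : ∀ (R : List Bool) (s : PState M β), drainF .tmp (fun s : PState M β =>
      s.setOut ((if s.v.reg.elim false isOne then a₀ else a₁) :: s.out)) (R.map bitSym) s =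
      (s.popped .tmp none []).setOut ((R.map fun b => if b then a₀ else a₁).reverse ++ s.out) := by
    intro R
    induction R with
    | nil => exact fun s => rfl
    | cons b R ih =>
      intro s
      rw [List.map_cons, drainF, ih]
      refine PState.eq_of (by simp) (fun o => ?_) (by cases b <;> simp [bitSym, isOne]) rfl
      cases o <;> simp
  rw [h, key, List.length_map] at h1
  exact h1

/-- Bits and letters are tagged differently in the encoding, so the coins can be extracted without
parsing the messages. -/
lemma filter_encV (i : VInput α) : (encV i).filter isBit = i.2.2.flatten.map bitSym := by
  have h1 : ∀ w : List α, (encWord w).filter isBit = [] := by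
    intro w
    simp [encWord, isBit]
  have h2 : ∀ r : List Bool, (encBits (α := α) r).filter isBit = r.map bitSym := by
    intro r
    simp [encBits, isBit]
    exact List.filter_eq_self.2 fun x hx => by
      obtain ⟨b, _, rfl⟩ := List.mem_map.1 hx; rfl
  have h3 : ∀ l : List (List α), (l.flatMap encWord).filter isBit = [] := by
    intro l
    induction l <;> simp [*]
  have h4 : ∀ l : List (List Bool), (l.flatMap (encBits (α := α))).filter isBit =
      l.flatten.map bitSym := by
    intro l
    induction l <;> simp [*]
  simp [encV, h1, h3, h4]

/-- Arthur's message can be computed in polynomial time. -/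
theorem publish_polyTime [Finite α] (a₀ a₁ : α) :
    Nonempty (TM2ComputableInPolyTime encV (fun w : List α => w) (publish a₀ a₁)) := by
  let M : Empty → QueryTM (Sym α) α := Empty.elim
  have h : PolyTime (M := M) (β := α) (.seq collect (writeBits a₀ a₁))
      (fun i : VInput α => PState.initial M α (encV i))
      (fun i => (PState.initial M α []).setOut (publish a₀ a₁ i)) := by
    -- `collect` leaves the bits in reverse order, and pushing them on the output stack reverses
    -- them again.
    refine PolyTime.seq (PolyTime.of_linear 4 fun i => ⟨_, ?_, runs_collect _⟩)
      (PolyTime.of_linear 3 fun i => ⟨_, ?_, (runs_writeBits a₀ a₁ i.2.2.flatten.reverse ?_).to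
        le_rfl ?_⟩)
    · have := (PState.initial M α (encV i)).own_le_size .tape
      omega
    · have := PState.own_le_size (((PState.initial M α (encV i)).popped .tape none []).setOwn .tmp
        ((((PState.initial M α (encV i)).own .tape).filter isBit).reverse ++
          (PState.initial M α (encV i)).own .tmp)) .tmp
      simp only [PState.initial_eq, PState.setOwn_own, if_true, PState.popped_own, Shape.st_tape,
        Shape.st_tmp, filter_encV, List.append_nil, List.length_reverse, List.length_map,
        reduceCtorEq, if_false] at this ⊢
      omega
    · simp [PState.initial_eq, filter_encV]
    · rw [PState.initial_eq, PState.initial_eq]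
      refine PState.eq_of rfl (fun o => ?_) (by simp [publish]) rfl
      cases o <;> simp
  exact h.computable encV (fun w : List α => w) _

/-- The first bit can be computed in polynomial time. -/
theorem firstBit_polyTime [Finite α] (a₀ : α) :
    Nonempty (TM2ComputableInPolyTime encVal (fun w : List Bool => w) (firstBit a₀)) := by
  let M : Empty → QueryTM (Sym α) α := Empty.elim
  have h : PolyTime (M := M) (β := Bool) (.seq (readWhile isLetter .z) (.seq (popR .tape)
      (.seq (.act (Act.out fun v => isYes a₀ v.reg)) (.seq (clear .tape) (clear .z)))))
      (fun i : ValInput α => PState.initial M Bool (encVal i))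
      (fun i => (PState.initial M Bool []).setOut (firstBit a₀ i)) := by
    refine PolyTime.seq (g := fun i => Shape.st Bool
      { z := (i.1.map letterSym).reverse, tape := i.2.flatMap encWord }) ?_
      (PolyTime.seq (PolyTime.act _ fun i => rfl) (PolyTime.seq (PolyTime.act _ fun i => rfl)
      (PolyTime.seq (polyTime_clear .tape fun i => rfl) (polyTime_clear .z fun i => ?_))))
    · refine polyTime_readWhile (by decide) (l := fun i => i.1.map letterSym)
        (l' := fun i => Sum.inl none :: i.2.flatMap encWord) ?_ ?_ ?_ ?_
      · intro i y hy
        obtain ⟨a, _, rfl⟩ := List.mem_map.1 hy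
        rfl
      · exact fun i => rfl
      · intro i
        rw [PState.initial_eq]
        simp [encVal, encWord]
        exact fun _ _ => rfl
      · intro i
        rw [PState.initial_eq]
        refine PState.eq_of rfl (fun o => ?_) rfl rfl
        cases o <;> simp
    · rw [PState.initial_eq]
      refine PState.eq_of rfl (fun o => ?_) ?_ rfl
      · cases o <;> simp [Act.out, Act.pop]
      · simp [Act.out, Act.pop, firstBit]
        rcases i with ⟨x, _ | ⟨m, ms⟩⟩
        · simp [isYes, headBit]
        · rcases m with _ | ⟨a, m⟩
          · simp [isYes, headBit, encWord, letterSym]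
          · refine decide_eq_decide.2 ?_
            change some (Sum.inl (some a)) = some (letterSym a₀) ↔ _
            simp [letterSym]
  exact h.computable encVal (fun w : List Bool => w) _

end

section

open Turing Prog

/-! ### Machines for decidable sets -/

/-- With an idling step function a halted computation stays where it is, so the exact number of
steps can be replaced by any upper bound. -/
lemma iterate_getD {σ : Type*} (f : σ → Option σ) {n m : ℕ} {a b : σ}
    (h : (flip bind f)^[n] (some a) = some b) (hb : f b = none) (hm : n ≤ m) :
    (fun c => (f c).getD c)^[m] a = b := by
  induction n generalizing a m with
  | zero =>
    obtain rfl : a = b := by simpa using h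
    exact Function.iterate_fixed (by simp [hb]) m
  | succ n ih =>
    obtain ⟨m, rfl⟩ : ∃ k, m = k + 1 := ⟨m - 1, by omega⟩
    rw [Function.iterate_succ_apply] at h ⊢
    change (flip bind f)^[n] (f a) = some b at h
    cases ha : f a with
    | none =>
      rw [ha, Function.iterate_fixed (show flip bind f none = none from rfl)] at h
      simp at h
    | some a' =>
      rw [ha] at h
      simpa using ih h (by omega : n ≤ m)

lemma initList_eq (tm : FinTM2) (l : List (tm.Γ tm.k₀)) :
    initList tm l =
      ⟨some tm.main, tm.initialState, Function.update (fun _ => []) tm.k₀ l⟩ := by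
  simp only [initList]
  congr 1
  funext k
  by_cases hk : k = tm.k₀
  · subst hk; simp
  · simp [hk]

lemma haltList_eq (tm : FinTM2) (l : List (tm.Γ tm.k₁)) :
    haltList tm l = ⟨none, tm.initialState, Function.update (fun _ => []) tm.k₁ l⟩ := by
  simp only [haltList]
  congr 1
  funext k
  by_cases hk : k = tm.k₁
  · subst hk; simp
  · simp [hk]

namespace QueryTM

variable {α : Type} {T : QueryTM (Sym α) α}

open scoped Classical in
/-- One step of a machine with oracle `C`. -/
def trueStep (C : Set (List α)) (c : T.Config) : T.Config :=
  if asks c then answer c (decide (query c ∈ C)) else idleStep c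

/-- The configuration with an output bit `b`. -/
def IsFinal (c : T.Config) (b : Bool) : Prop := asks c = false ∧ output c = b

/-- With oracle `C`, the machine decides `B` in time `p`. -/
def Decides (T : QueryTM (Sym α) α) (C : Set (List α)) (p : Polynomial ℕ)
    (B : Set (List α × List Bool)) : Prop :=
  open scoped Classical in
  ∀ i, ∀ t ≥ p.eval (encPair i).length,
    IsFinal ((trueStep C)^[t] (T.start (encPair i))) (decide (i ∈ B))

lemma csize_trueStep (C : Set (List α)) (c : T.Config) :
    csize (trueStep C c) ≤ csize c + T.growth := by
  unfold trueStep
  split_ifs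
  · exact (csize_answer _ _).trans (Nat.le_add_right _ _)
  · exact csize_idleStep c

lemma csize_iterate (C : Set (List α)) (l : List (Sym α)) (t : ℕ) :
    csize ((trueStep C)^[t] (T.start l)) ≤ l.length + T.growth * t := by
  induction t with
  | zero =>
    have := csize_update T.rest (some T.tm.main) T.tm.initialState T.tm.k₀ (l.map T.inp)
    simp [csize, rest, start] at this ⊢
    omega
  | succ t ih =>
    rw [Function.iterate_succ_apply']
    have := csize_trueStep C ((trueStep C)^[t] (T.start l))
    rw [Nat.mul_succ]
    omega

/-- Questions asked within polynomial time have polynomial length. This bounds the coins and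
messages that the lower levels need. -/
lemma length_query_iterate (C : Set (List α)) (l : List (Sym α)) (t : ℕ) :
    (query ((trueStep C)^[t] (T.start l))).length ≤ l.length + T.growth * t := by
  unfold query
  rw [List.length_map]
  exact (stk_le_csize _ _).trans (csize_iterate C l t)

/-- A machine without oracle. -/
def plain {Γ₁ : Type} (S : TM2ComputableAux Γ₁ Bool) (e : Sym α → Γ₁) (a₀ : α) :
    QueryTM (Sym α) α where
  tm := S.tm
  inp s := S.inputAlphabet.symm (e s)
  outBit := S.outputAlphabet
  isAsk _ := false
  yes := S.tm.main
  no := S.tm.main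
  qs := S.tm.k₀
  letter _ := a₀

lemma asks_plain {Γ₁ : Type} (S : TM2ComputableAux Γ₁ Bool) (e : Sym α → Γ₁) (a₀ : α)
    (c : (plain S e a₀).Config) : asks c = false := by
  rcases c with ⟨_ | l, v, S⟩ <;> rfl

/-- The translation `e` allows a machine with another input alphabet, such as one for words over
`α`, to be fed from a tape over `Sym α`. -/
lemma iterate_plain {Γ₁ : Type} (S : TM2ComputableAux Γ₁ Bool) (e : Sym α → Γ₁) (a₀ : α)
    {l : List (Sym α)} {b : Bool} {n t : ℕ} (h : StateTransition.EvalsToInTime S.tm.step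
      (initList S.tm ((l.map e).map S.inputAlphabet.symm)) (some (haltList S.tm
        ((Computability.encodeBool b).map S.outputAlphabet.symm))) n) (ht : n ≤ t) :
    idleStep^[t] ((plain S e a₀).start l) =
      haltList S.tm ((Computability.encodeBool b).map S.outputAlphabet.symm) := by
  have h2 := iterate_getD S.tm.step h.evals_in_steps rfl (h.steps_le_m.trans ht)
  rw [← h2, initList_eq]
  simp [start, plain]
  rfl

lemma output_haltList (T : QueryTM (Sym α) α) (e : T.tm.Γ T.tm.k₁ ≃ Bool) (he : T.outBit = e)
    (b : Bool) : output (T := T) (haltList T.tm ((Computability.encodeBool b).map e.symm)) = b := by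
  rw [haltList_eq]
  simp [output, Computability.encodeBool, he]

lemma exists_plain (a₀ : α) {B : Set (List α × List Bool)} (h : PolyTimeDecidable encPair B) :
    ∃ (T : QueryTM (Sym α) α) (p : Polynomial ℕ), (∀ c : T.Config, asks c = false) ∧
      ∀ C, T.Decides C p B := by
  classical
  obtain ⟨S⟩ := h
  refine ⟨plain S.toTM2ComputableAux id a₀, S.time, asks_plain _ _ _, fun C i t ht => ?_⟩
  refine ⟨asks_plain _ _ _ _, ?_⟩
  have h1 : (trueStep C : (plain S.toTM2ComputableAux id a₀).Config → _) = idleStep := by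
    funext c
    simp [trueStep, asks_plain]
  have h2 := S.outputsFun i
  rw [h1, iterate_plain S.toTM2ComputableAux id a₀ (b := decide (i ∈ B)) (n := S.time.eval (encPair i).length)
    (by rw [List.map_id]; convert h2; rfl) ht]
  exact output_haltList (plain S.toTM2ComputableAux id a₀) _ rfl _

open scoped Classical in
/-- An oracle machine. -/
def ofOracle (S : OracleTM (Sym α) α) : QueryTM (Sym α) α where
  tm := S.tm
  inp := S.inputAlphabet.symm
  outBit := S.outputAlphabet
  isAsk l := decide (l = S.ask)
  yes := S.yes
  no := S.no
  qs := S.queryStack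
  letter := S.queryAlphabet

open scoped Classical in
lemma trueStep_ofOracle (S : OracleTM (Sym α) α) (C : Set (List α)) (c : (ofOracle S).Config) :
    trueStep C c = (S.step C c).getD c := by
  rcases c with ⟨_ | l, v, k⟩
  · simp [trueStep, asks, OracleTM.step]
    rfl
  · by_cases hl : l = S.ask
    · have h1 : asks (T := ofOracle S) ⟨some l, v, k⟩ = true := decide_eq_true hl
      have h2 : S.step C ⟨some l, v, k⟩ = _ := if_pos (congrArg some hl)
      refine (if_pos h1).trans (Eq.trans ?_ (congrArg (fun o => Option.getD o _) h2.symm))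
      by_cases hq : List.map S.queryAlphabet (k S.queryStack) ∈ C
      · have : query (T := ofOracle S) ⟨some l, v, k⟩ ∈ C := hq
        simp only [this, hq, answer, if_true, decide_true]
        rfl
      · have : query (T := ofOracle S) ⟨some l, v, k⟩ ∉ C := hq
        simp only [this, hq, answer, if_false, decide_false]
        rfl
    · have h1 : ¬ asks (T := ofOracle S) ⟨some l, v, k⟩ = true := fun h => hl (of_decide_eq_true h)
      have h2 : S.step C ⟨some l, v, k⟩ = _ := if_neg fun h => hl (Option.some.inj h)
      exact (if_neg h1).trans (congrArg (fun o => Option.getD o _) h2.symm)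

lemma exists_ofOracle {B : Set (List α × List Bool)} {C : Set (List α)}
    (h : PolyTimeDecidableIn encPair C B) :
    ∃ (T : QueryTM (Sym α) α) (p : Polynomial ℕ), T.Decides C p B := by
  classical
  obtain ⟨S, p, h⟩ := h
  refine ⟨ofOracle S, p, fun i t ht => ?_⟩
  obtain ⟨h⟩ := h i
  have h2 := iterate_getD (S.step C) h.evals_in_steps (by
    rw [haltList_eq]; simp [OracleTM.step]; rfl) (h.steps_le_m.trans ht)
  have h1 : (trueStep C : (ofOracle S).Config → _) = fun c => (S.step C c).getD c :=
    funext (trueStep_ofOracle S C)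
  rw [initList_eq] at h2
  have h3 : (trueStep C)^[t] ((ofOracle S).start (encPair i)) = haltList S.tm
      ((Computability.encodeBool (decide (i ∈ B))).map S.outputAlphabet.symm) := by
    rw [h1, ← h2]
    rfl
  rw [h3]
  refine ⟨?_, ?_⟩
  · rw [haltList_eq]; rfl
  · exact output_haltList (ofOracle S) S.outputAlphabet rfl _

end QueryTM

end

section

open Turing Prog

variable {ι α β : Type} [DecidableEq ι] [Fintype ι] {M : ι → QueryTM (Sym α) α}

namespace Prog

/-- Run a machine until it halts. -/
def untilHalt (i : ι) : Prog M β := .loop (fun v => (v.2 i).2.isSome) (.act (Act.tick i))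

end Prog

/-- A halted configuration is a fixed point of `idleStep`, so stopping at the first halt gives the
same result as `t` steps. -/
lemma runs_untilHalt (i : ι) {c : (M i).Config} (hc : c.l = none) (t : ℕ) {s : PState M β}
    (h : QueryTM.idleStep^[t] (s.mach i) = c) :
    Runs (untilHalt i) s (2 * t + 1) (s.setMach i c) := by
  have hfix : ∀ {c : (M i).Config}, c.l = none → QueryTM.idleStep c = c := by
    rintro ⟨_ | l, v, S⟩ h
    · rfl
    · simp at h
  induction t generalizing s with
  | zero =>
    obtain rfl : s.mach i = c := h
    exact (Runs.loopF (by simp [PState.var, hc])).to (by omega) (by simp)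
  | succ t ih =>
    cases hs : (s.mach i).l with
    | none =>
      rw [Function.iterate_fixed (hfix hs)] at h
      subst h
      exact (Runs.loopF (by simp [PState.var, hc])).to (by omega) (by simp)
    | some l =>
      refine (Runs.loopT (by simp [PState.var, hs]) (Runs.act _ _)
        (ih (s := s.setMach i (QueryTM.idleStep (s.mach i))) ?_)).to (by omega) (by simp)
      rw [PState.setMach_mach_self]
      exact h

/-- The letters of an input. -/
def toLetter (a₀ : α) : Sym α → α
  | Sum.inl (some a) => a
  | _ => a₀

open scoped Classical in
/-- A language in `P` can be decided on the first component of the input. -/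
theorem membership_polyTime [Finite α] (a₀ : α) {A : Set (List α)} (hA : A ∈ classP α) :
    Nonempty (TM2ComputableInPolyTime encVal (fun w : List Bool => w)
      fun i => [decide (i.1 ∈ A)]) := by
  obtain ⟨S⟩ := hA
  let T := QueryTM.plain S.toTM2ComputableAux (toLetter a₀) a₀
  let M : Unit → QueryTM (Sym α) α := fun _ => T
  let halted : List α → T.Config := fun x =>
    haltList T.tm ((Computability.encodeBool (decide (x ∈ A))).map S.outputAlphabet.symm)
  have hhalt : ∀ x, (halted x).l = none := fun x => by simp [halted, haltList_eq]
  have hiter : ∀ x : List α, QueryTM.idleStep^[S.time.eval x.length]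
      (T.start (x.map letterSym)) = halted x := by
    intro x
    refine QueryTM.iterate_plain S.toTM2ComputableAux _ a₀ ?_ le_rfl
    have h2 := S.outputsFun x
    have h3 : (x.map letterSym).map (toLetter a₀) = x := by
      rw [List.map_map]; exact List.map_id x
    rw [h3]
    convert h2
    rfl
  have h : PolyTime (M := M) (β := Bool) (.seq (readWhile isLetter .z) (.seq (clear .tape)
      (.seq (feedAll () .z) (.seq (.act (Act.ctl () fun _ w _ => (w, some T.tm.main)))
      (.seq (untilHalt ()) (.seq (.act (Act.popMach () T.tm.k₁ fun v x =>
        { v with res := x.elim false T.outBit })) (.seq (.act (Act.out Reg.res))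
        (.act (Act.load fun _ => Reg.init α)))))))))
      (fun i : ValInput α => PState.initial M Bool (encVal i))
      (fun i => (PState.initial M Bool []).setOut [decide (i.1 ∈ A)]) := by
    refine PolyTime.seq (g := fun i => Shape.st Bool
      { z := (i.1.map letterSym).reverse, tape := i.2.flatMap encWord }) ?_
      (PolyTime.seq (g := fun i => Shape.st Bool { z := (i.1.map letterSym).reverse })
      (polyTime_clear .tape fun i => ?_) (PolyTime.seq
      (g := fun i => Shape.st Bool
        { mach := fun _ => ⟨none, T.tm.initialState, (T.start (i.1.map letterSym)).stk⟩ })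
      (polyTime_feedAll () .z fun i => ?_) (PolyTime.seq
      (g := fun i => Shape.st Bool { mach := fun _ => T.start (i.1.map letterSym) })
      (PolyTime.act _ fun i => ?_) (PolyTime.seq
      (g := fun i => Shape.st Bool { mach := fun _ => halted i.1 })
      ⟨2 * S.time + 1, fun i => ?_⟩ (PolyTime.seq (PolyTime.act _ fun i => rfl)
      (PolyTime.seq (PolyTime.act _ fun i => rfl) (PolyTime.act _ fun i => ?_)))))))
    · refine polyTime_readWhile (by decide) (l := fun i => i.1.map letterSym)
        (l' := fun i => Sum.inl none :: i.2.flatMap encWord) ?_ ?_ ?_ ?_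
      · intro i y hy
        obtain ⟨a, _, rfl⟩ := List.mem_map.1 hy
        rfl
      · exact fun i => rfl
      · intro i
        rw [PState.initial_eq]
        simp [encVal, encWord]
        exact fun _ _ => rfl
      · intro i
        rw [PState.initial_eq]
        refine PState.eq_of rfl (fun o => ?_) rfl rfl
        cases o <;> simp
    · refine PState.eq_of rfl (fun o => ?_) rfl rfl
      cases o <;> simp
    · refine PState.eq_of rfl (fun o => ?_) rfl ?_
      · cases o <;> simp
      · funext u
        simp [PState.setMach, M, QueryTM.start, QueryTM.rest]
    · refine PState.eq_of rfl (fun o => rfl) rfl ?_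
      funext u
      simp [Act.ctl, PState.setMach, M, QueryTM.start]
    · have hx : QueryTM.csize (T := T) (T.start (i.1.map letterSym)) = i.1.length := by
        have := QueryTM.csize_update T.rest (some T.tm.main) T.tm.initialState T.tm.k₀
          ((i.1.map letterSym).map T.inp)
        simpa [QueryTM.csize, QueryTM.rest, QueryTM.start] using this
      have h1 := PState.csize_le_size
        (Shape.st Bool ({ mach := fun _ => T.start (i.1.map letterSym) } : Shape M)) ()
      have h2 := eval_mono S.time (hx.symm.le.trans h1)
      refine (runs_untilHalt () (hhalt i.1) (S.time.eval i.1.length) (hiter i.1)).to ?_ ?_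
      · simp only [Polynomial.eval_add, Polynomial.eval_mul, Polynomial.eval_ofNat,
          Polynomial.eval_one]
        omega
      · exact PState.eq_of rfl (fun o => rfl) rfl (by funext u; simp [PState.setMach])
    · rw [PState.initial_eq]
      refine PState.eq_of rfl (fun o => ?_) ?_ ?_
      · cases o <;> rfl
      · simp [Act.load, Act.out, Act.popMach, halted, haltList_eq, Computability.encodeBool, T,
          QueryTM.plain]
        exact ⟨S.outputAlphabet.apply_symm_apply _, rfl⟩
      · funext u
        simp [Act.load, Act.out, Act.popMach, halted, haltList_eq, Computability.encodeBool,
          PState.setMach, QueryTM.rest]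
        exact ⟨rfl, Function.update_eq_self _ _⟩
  exact h.computable encVal (fun w : List Bool => w) _

end

section

/-! ### Averages over bit strings -/

/-- The average of a function over the bit strings of length `N`. -/
def avg : ℕ → (List Bool → ℝ) → ℝ
  | 0, f => f []
  | N + 1, f => (avg N (fun w => f (true :: w)) + avg N fun w => f (false :: w)) / 2

lemma avg_le_avg {N : ℕ} {f g : List Bool → ℝ} (h : ∀ w, w.length = N → f w ≤ g w) :
    avg N f ≤ avg N g := by
  induction N generalizing f g with
  | zero => exact h [] rfl
  | succ N ih =>
    have h1 := ih (f := fun w => f (true :: w)) (g := fun w => g (true :: w))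
      fun w hw => h _ (by simp [hw])
    have h2 := ih (f := fun w => f (false :: w)) (g := fun w => g (false :: w))
      fun w hw => h _ (by simp [hw])
    unfold avg
    linarith

lemma avg_congr {N : ℕ} {f g : List Bool → ℝ} (h : ∀ w, w.length = N → f w = g w) :
    avg N f = avg N g :=
  le_antisymm (avg_le_avg fun w hw => (h w hw).le) (avg_le_avg fun w hw => (h w hw).ge)

lemma avg_const (N : ℕ) (a : ℝ) : avg N (fun _ => a) = a := by
  induction N with
  | zero => rfl
  | succ N ih => unfold avg; rw [ih]; ring

lemma avg_add (N : ℕ) (f g : List Bool → ℝ) :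
    avg N (fun w => f w + g w) = avg N f + avg N g := by
  induction N generalizing f g with
  | zero => rfl
  | succ N ih => unfold avg; rw [ih, ih]; ring

lemma avg_mul (N : ℕ) (a : ℝ) (f : List Bool → ℝ) :
    avg N (fun w => a * f w) = a * avg N f := by
  induction N generalizing f with
  | zero => rfl
  | succ N ih => unfold avg; rw [ih, ih]; ring

lemma avg_append (N N' : ℕ) (f : List Bool → ℝ) :
    avg (N + N') f = avg N fun w => avg N' fun w' => f (w ++ w') := by
  induction N generalizing f with
  | zero => simp [avg]
  | succ N ih =>
    rw [Nat.succ_add]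
    unfold avg
    rw [ih, ih]
    rfl

lemma avg_all_false (N : ℕ) (a b : ℝ) :
    avg N (fun w => if w.all (!·) then a else b) = (1 / 2) ^ N * a + (1 - (1 / 2) ^ N) * b := by
  induction N with
  | zero => simp [avg]
  | succ N ih =>
    unfold avg
    simp only [List.all_cons, Bool.not_true, Bool.false_and, Bool.not_false, Bool.true_and, ih,
      avg_const, Bool.false_eq_true, if_false]
    ring

lemma avg_nonneg {N : ℕ} {f : List Bool → ℝ} (h : ∀ w, 0 ≤ f w) : 0 ≤ avg N f :=
  (avg_const N 0).ge.trans (avg_le_avg fun w _ => h w)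

lemma avg_le_one {N : ℕ} {f : List Bool → ℝ} (h : ∀ w, f w ≤ 1) : avg N f ≤ 1 :=
  (avg_le_avg fun w _ => h w).trans (avg_const N 1).le

lemma avg_eq_sum (N : ℕ) (f : List Bool → ℝ) :
    avg N f = 1 / 2 ^ N * ∑ w : Fin N → Bool, f (List.ofFn w) := by
  induction N generalizing f with
  | zero => simp [avg]
  | succ N ih =>
    unfold avg
    rw [ih, ih, ← (Fin.consEquiv fun _ => Bool).sum_comp, Fintype.sum_prod_type]
    simp [List.ofFn_succ]
    field_simp
    ring

/-- The indicator of a bit. -/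
def ind (b : Bool) : ℝ := if b then 1 else 0

lemma ind_nonneg (b : Bool) : 0 ≤ ind b := by cases b <;> simp [ind]
lemma ind_le_one (b : Bool) : ind b ≤ 1 := by cases b <;> simp [ind]

/-! ### Optimal values -/

variable {α : Type}

/-- The optimal expected reward in `j` further rounds, with random strings of length `N` and
messages of length at most `μ`. -/
def opt (N μ : ℕ) : ℕ → (Rounds α → ℝ) → ℝ
  | 0, F => F []
  | j + 1, F => ⨆ m : {m : List α // m.length ≤ μ}, avg N fun r => opt N μ j fun h => F ((m, r) :: h)

instance (μ : ℕ) : Nonempty {m : List α // m.length ≤ μ} := ⟨⟨[], Nat.zero_le _⟩⟩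

lemma opt_const (N μ j : ℕ) (a : ℝ) : opt (α := α) N μ j (fun _ => a) = a := by
  induction j with
  | zero => rfl
  | succ j ih => simp [opt, ih, avg_const]

lemma opt_mem (N μ j : ℕ) {F : Rounds α → ℝ} (h0 : ∀ h, 0 ≤ F h) (h1 : ∀ h, F h ≤ 1) :
    0 ≤ opt N μ j F ∧ opt N μ j F ≤ 1 := by
  induction j generalizing F with
  | zero => exact ⟨h0 _, h1 _⟩
  | succ j ih =>
    exact ⟨Real.iSup_nonneg fun m => avg_nonneg fun r => (ih (fun h => h0 _) fun h => h1 _).1,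
      ciSup_le fun m => avg_le_one fun r => (ih (fun h => h0 _) fun h => h1 _).2⟩

/-- The value of a claim. -/
def value (a₀ : α) (N μ : ℕ) (Ls : List (Level α)) (x : Claim α) : ℝ :=
  opt N μ (Ls.length - 1) fun h => ind (claimReward a₀ Ls x h)

lemma value_mem (a₀ : α) (N μ : ℕ) (Ls : List (Level α)) (x : Claim α) :
    0 ≤ value a₀ N μ Ls x ∧ value a₀ N μ Ls x ≤ 1 :=
  opt_mem _ _ _ (fun _ => ind_nonneg _) fun _ => ind_le_one _

/-- The last level has no round of its own, so the stage sees the default pair of empty words. -/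
lemma value_singleton (a₀ : α) (N μ : ℕ) (L : Level α) (x : Claim α) :
    value a₀ N μ [L] x = (L.stage a₀ x.1 x.2.1 x.2.2 ([], [])).elim ind fun _ => 0 := by
  simp only [value, List.length_singleton, Nat.sub_self, opt, claimReward, List.headD_nil]
  cases L.stage a₀ x.1 x.2.1 x.2.2 ([], []) with
  | inl b => rfl
  | inr x' => simp [ind]

lemma value_cons (a₀ : α) (N μ : ℕ) (L L' : Level α) (Ls : List (Level α)) (x : Claim α) :
    value a₀ N μ (L :: L' :: Ls) x = ⨆ m : {m : List α // m.length ≤ μ}, avg N fun r =>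
      (L.stage a₀ x.1 x.2.1 x.2.2 (m, r)).elim ind (value a₀ N μ (L' :: Ls)) := by
  simp only [value, List.length_cons, Nat.add_sub_cancel, opt]
  refine iSup_congr fun m => avg_congr fun r _ => ?_
  simp only [claimReward, List.headD_cons, List.tail_cons]
  cases L.stage a₀ x.1 x.2.1 x.2.2 (m.1, r) with
  | inl b => simp [opt_const]
  | inr x' => rfl

/-! ### The majority of the certificates -/

/-- Certificate, tie bits and unused bits are independent, and the tie bits force a positive test
with probability `(1 / 2) ^ D`. -/
lemma avg_certificates (q D n : ℕ) (P : List Bool → Bool) :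
    avg (q + (D + n)) (fun w => ind (P (w.take q) || ((w.drop q).take D).all (!·))) =
      (1 - (1 / 2) ^ D) * avg q (fun y => ind (P y)) + (1 / 2) ^ D := by
  rw [avg_append, ← avg_mul, ← avg_const q ((1 / 2 : ℝ) ^ D), ← avg_add, avg_const]
  refine avg_congr fun y hy => ?_
  rw [avg_append]
  have : ∀ t : List Bool, t.length = D → avg n (fun w => ind (P ((y ++ (t ++ w)).take q) ||
      (((y ++ (t ++ w)).drop q).take D).all (!·))) =
      if t.all (!·) then 1 else ind (P y) := by
    intro t ht
    rw [← avg_const n (if t.all (!·) then 1 else ind (P y))]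
    refine avg_congr fun w _ => ?_
    rw [List.take_left' hy, List.drop_left' hy, List.take_left' ht]
    cases P y <;> cases t.all (!·) <;> simp [ind]
  rw [avg_congr this, avg_all_false]
  ring

open scoped Classical in
/-- If `b` says whether the majority of the certificates satisfies `P`, then it is the more
likely outcome of the test. -/
lemma majority_gap (q D n : ℕ) (hD : q + 2 ≤ D) (P : List Bool → Bool) (A : Prop)
    (hA : A ↔ (1 / 2 : ℝ) ≤ avg q fun y => ind (P y)) :
    avg (q + (D + n)) (fun w => ind ((!decide A) == (P (w.take q) ||
        ((w.drop q).take D).all (!·)))) + (1 / 2) ^ D ≤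
      avg (q + (D + n)) (fun w => ind (decide A == (P (w.take q) ||
        ((w.drop q).take D).all (!·)))) := by
  have h1 := avg_certificates q D n P
  have h2 : avg (q + (D + n)) (fun w => ind (false == (P (w.take q) ||
      ((w.drop q).take D).all (!·)))) = 1 - avg (q + (D + n)) (fun w => ind ((P (w.take q) ||
      ((w.drop q).take D).all (!·)))) := by
    rw [eq_sub_iff_add_eq, ← avg_add, ← avg_const (q + (D + n)) 1]
    exact avg_congr fun w _ => by cases (P (w.take q) || ((w.drop q).take D).all (!·)) <;> simp [ind]
  have hD0 : (0 : ℝ) < (1 / 2) ^ D := by positivity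
  have hD2 : ((1 : ℝ) / 2) ^ D ≤ (1 / 2) ^ (q + 2) :=
    pow_le_pow_of_le_one (by norm_num) (by norm_num) hD
  have hq1 : ((1 : ℝ) / 2) ^ q ≤ 1 := pow_le_one₀ (by norm_num) (by norm_num)
  rw [pow_add] at hD2
  set u : ℝ := (1 / 2) ^ D
  by_cases hp : A
  -- Even at a share of exactly one half, the forced positive tests give an advantage of `u`.
  · have h3 := hA.1 hp
    simp only [hp, decide_true, Bool.not_true, h2, Bool.true_beq, h1]
    nlinarith
  -- The number `c` of accepted certificates is an integer, so `2 * c < 2 ^ q` leaves a margin of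
  -- half a certificate. As `D ≥ q + 2`, the forced positive tests have probability at most `(1 / 2)
  -- ^ q / 4` and cannot use it up.
  · have h3 : avg q (fun y => ind (P y)) ≤ 1 / 2 - (1 / 2) ^ q / 2 := by
      have h4 : avg q (fun y => ind (P y)) < 1 / 2 := not_le.1 fun h => hp (hA.2 h)
      rw [avg_eq_sum] at h4 ⊢
      simp only [ind, Finset.sum_boole] at h4 ⊢
      have h5 : ∀ c : ℕ, (1 / 2 ^ q * c : ℝ) < 1 / 2 → (1 / 2 ^ q * c : ℝ) ≤ 1 / 2 - (1 / 2) ^ q / 2 := by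
        intro c hc
        have hpos : (0 : ℝ) < 2 ^ q := by positivity
        rw [div_mul_eq_mul_div, div_lt_div_iff₀ hpos (by norm_num)] at hc
        have : 2 * c + 1 ≤ 2 ^ q := by
          have : c * 2 < 2 ^ q := by exact_mod_cast (by linarith : (c * 2 : ℝ) < 2 ^ q)
          omega
        have h6 : (2 * c + 1 : ℝ) ≤ 2 ^ q := by exact_mod_cast this
        rw [one_div_pow, div_mul_eq_mul_div, one_mul, div_le_iff₀ hpos]
        field_simp
        linarith
      exact h5 _ h4
    have h0 : 0 ≤ avg q (fun y => ind (P y)) := avg_nonneg fun _ => ind_nonneg _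
    simp only [hp, decide_false, Bool.not_false, h2, Bool.true_beq, h1]
    nlinarith

end

section

open QueryTM

variable {α : Type} (a₀ : α)

/-! ### The value of an examination -/

section

variable {T : QueryTM (Sym α) α} (W : Claim α → ℝ) (e : T.Config → ℝ) (C : Set (List α))
  (D N : ℕ)

/-- The value of a question that is answered according to a message. -/
def askValue (n : ℕ) (p : T.Config × List α) : ℝ :=
  if asks p.1 then avg n fun w => W (query p.1, headBit a₀ p.2, w) else 0

/-- The expected value of the examination of the remaining `d` steps. -/
def stepValue : ℕ → T.Config × List α → ℝ
  | 0, p => e p.1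
  | d + 1, p => (1 / 2) ^ D * stepValue d (tickWith a₀ p) +
      (1 - (1 / 2) ^ D) * askValue a₀ W (d * D + N) p

/-- The value of an examination for given random bits. -/
def examValue (p : T.Config × List α) (u : ℕ × Bool × List Bool) : ℝ :=
  let c := (tickWith a₀)^[u.1] p
  if u.2.1 then e c.1
  else if asks c.1 then W (query c.1, headBit a₀ c.2, u.2.2) else 0

/-- The first block consists of `false` with probability `(1 / 2) ^ D`, and then the examination
goes on at the next configuration. Otherwise it stops here, and the `d * D + N` unread bits are
passed on to the next claim. -/
lemma avg_examValue (d : ℕ) (p : T.Config × List α) :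
    avg (d * D + N) (fun r => examValue a₀ W e p (blocks D d r)) = stepValue a₀ W e D N d p := by
  induction d generalizing p with
  | zero => exact (avg_congr fun _ _ => rfl).trans (avg_const _ (e p.1))
  | succ d ih =>
    rw [Nat.succ_mul, Nat.add_right_comm, Nat.add_comm, avg_append, stepValue, ← avg_all_false]
    refine avg_congr fun w hw => ?_
    split_ifs with h
    · rw [← ih]
      refine avg_congr fun r _ => ?_
      simp [examValue, blocks, List.take_left' hw, List.drop_left' hw, h]
    · rw [askValue]
      split_ifs with h2
      · refine avg_congr fun r _ => ?_
        simp only [examValue, blocks, List.take_left' hw, List.drop_left' hw, h]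
        simp [h2]
      · rw [← avg_const (d * D + N) 0]
        refine avg_congr fun r _ => ?_
        simp only [examValue, blocks, List.take_left' hw, List.drop_left' hw, h]
        simp [h2]

/-- The value of a question that is answered truthfully. -/
def trueAskValue (n : ℕ) (c : T.Config) : ℝ :=
  open scoped Classical in
  if asks c then avg n fun w => W (query c, decide (query c ∈ C), w) else 0

/-- The expected value of the examination of the remaining `d` steps for a truthful message. -/
def trueStepValue : ℕ → T.Config → ℝ
  | 0, c => e c
  | d + 1, c => (1 / 2) ^ D * trueStepValue d (trueStep C c) +
      (1 - (1 / 2) ^ D) * trueAskValue W C (d * D + N) c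

/-- Only the final test looks at `e`, and it is reached with probability `((1 / 2) ^ D) ^ d`. In the
application `e` is the only place where the claimed bit enters. -/
lemma trueStepValue_eq (d : ℕ) (c : T.Config) :
    trueStepValue W e C D N d c =
      trueStepValue W (fun _ => 0) C D N d c + ((1 / 2) ^ D) ^ d * e ((trueStep C)^[d] c) := by
  induction d generalizing c with
  | zero => simp [trueStepValue]
  | succ d ih => rw [trueStepValue, trueStepValue, ih, Function.iterate_succ_apply]; ring

lemma half_pow_mem : (0 : ℝ) < (1 / 2) ^ D ∧ ((1 : ℝ) / 2) ^ D ≤ 1 :=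
  ⟨by positivity, pow_le_one₀ (by norm_num) (by norm_num)⟩

variable {W e}

lemma stepValue_le_one (hW : ∀ x, W x ≤ 1) (he : ∀ c, e c ≤ 1) (d : ℕ)
    (p : T.Config × List α) : stepValue a₀ W e D N d p ≤ 1 := by
  induction d generalizing p with
  | zero => exact he _
  | succ d ih =>
    have h1 : askValue a₀ W (d * D + N) p ≤ 1 := by
      unfold askValue
      split_ifs
      · exact avg_le_one fun w => hW _
      · exact zero_le_one
    have h2 := half_pow_mem D
    have h3 := ih (tickWith a₀ p)
    unfold stepValue
    nlinarith

lemma trueStepValue_nonneg (hW : ∀ x, 0 ≤ W x) (he : ∀ c, 0 ≤ e c) (d : ℕ)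
    (c : T.Config) : 0 ≤ trueStepValue W e C D N d c := by
  induction d generalizing c with
  | zero => exact he _
  | succ d ih =>
    have h1 : 0 ≤ trueAskValue W C (d * D + N) c := by
      unfold trueAskValue
      split_ifs
      · exact avg_nonneg fun w => hW _
      · exact le_rfl
    have h2 := half_pow_mem D
    have h3 := ih (trueStep C c)
    have h4 := sub_nonneg.2 h2.2
    unfold trueStepValue
    positivity

open scoped Classical in
/-- A truthful message is optimal. -/
lemma stepValue_le_trueStepValue (hW0 : ∀ x, 0 ≤ W x) (hW1 : ∀ x, W x ≤ 1) (he0 : ∀ c, 0 ≤ e c)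
    (he1 : ∀ c, e c ≤ 1) {γ : ℝ} (hγ : (1 / 2) ^ D ≤ (1 - (1 / 2) ^ D) * γ) (d : ℕ) (c : T.Config)
    (m : List α) (hgap : ∀ s < d, asks ((trueStep C)^[s] c) = true → ∀ n ≥ N,
      avg n (fun w => W (query ((trueStep C)^[s] c), !decide (query ((trueStep C)^[s] c) ∈ C), w)) +
        γ ≤ avg n (fun w => W (query ((trueStep C)^[s] c),
          decide (query ((trueStep C)^[s] c) ∈ C), w))) :
    stepValue a₀ W e D N d (c, m) ≤ trueStepValue W e C D N d c := by
  induction d generalizing c m with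
  | zero => exact le_rfl
  | succ d ih =>
    have h2 := half_pow_mem D
    have ih' := fun m => ih (trueStep C c) m fun s hs => hgap (s + 1) (by omega)
    unfold stepValue trueStepValue askValue trueAskValue
    by_cases ha : asks c = true
    · have h0 : avg (d * D + N) (fun w => W (query c, !decide (query c ∈ C), w)) + γ ≤
          avg (d * D + N) (fun w => W (query c, decide (query c ∈ C), w)) :=
        hgap 0 (by omega) ha (d * D + N) (by omega)
      simp only [ha, if_true]
      by_cases hm : headBit a₀ m = decide (query c ∈ C)
      · have ht : tickWith a₀ (c, m) = (trueStep C c, m.tail) := by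
          simp [tickWith, trueStep, ha, hm]
        rw [ht, hm]
        gcongr
        exact ih' _
      -- A false answer costs at least `(1 - (1 / 2) ^ D) * γ` now, while any continuation is worth
      -- at most `(1 / 2) ^ D`; by `hγ` nothing gained later can compensate the loss.
      · have hm' : headBit a₀ m = !decide (query c ∈ C) := by
          revert hm
          cases headBit a₀ m <;> cases decide (query c ∈ C) <;> simp
        rw [hm']
        have h3 := stepValue_le_one a₀ D N hW1 he1 d (tickWith a₀ (c, m))
        have h4 := trueStepValue_nonneg C D N hW0 he0 d (trueStep C c)
        have h5 := mul_le_mul_of_nonneg_left h0 (sub_nonneg.2 h2.2)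
        have h6 := mul_nonneg h2.1.le h4
        have h7 := mul_le_mul_of_nonneg_left h3 h2.1.le
        rw [mul_add] at h5
        linarith
    · have ht : tickWith a₀ (c, m) = (trueStep C c, m) := by
        simp [tickWith, trueStep, ha]
      rw [if_neg ha, if_neg ha, ht]
      have := mul_le_mul_of_nonneg_left (ih' m) h2.1.le
      linarith

/-- There is a short truthful message. -/
lemma exists_stepValue_eq {a₁ : α} (h01 : a₁ ≠ a₀) (d : ℕ) (c : T.Config) :
    ∃ m : List α, m.length ≤ d ∧
      stepValue a₀ W e D N d (c, m) = trueStepValue W e C D N d c := by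
  classical
  induction d generalizing c with
  | zero => exact ⟨[], le_rfl, rfl⟩
  | succ d ih =>
    obtain ⟨m, hm, h⟩ := ih (trueStep C c)
    by_cases ha : asks c = true
    -- Here a second letter is needed: a nonempty message must be able to express a negative answer.
    -- Each step uses at most one letter, so `d` letters suffice.
    · let a := if query c ∈ C then a₀ else a₁
      have hb : headBit a₀ (a :: m) = decide (query c ∈ C) := by
        by_cases hq : query c ∈ C <;> simp [headBit, a, hq, h01]
      have ht : tickWith a₀ (c, a :: m) = (trueStep C c, m) := by
        simp [tickWith, trueStep, ha, hb]
      refine ⟨a :: m, by simpa using hm, ?_⟩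
      rw [stepValue, trueStepValue, ht, h, askValue, trueAskValue]
      simp only [hb, ha, if_true]
    · have ht : tickWith a₀ (c, m) = (trueStep C c, m) := by
        simp [tickWith, trueStep, ha]
      refine ⟨m, by omega, ?_⟩
      rw [stepValue, trueStepValue, ht, h, askValue, trueAskValue]
      simp only [ha]
      simp

end

lemma stage_value (W : Claim α → ℝ) (L : Level α) (z : List α) (b : Bool) (w : List Bool)
    (m : List α) (r : List Bool) :
    (L.stage a₀ z b w (m, r)).elim ind W =
      examValue a₀ W (fun c => ind (b == (output c || L.tie z w)))
        (L.T.start (encPair (z, L.cert z w)), m)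
        (blocks (L.D.eval z.length) (L.D.eval z.length) r) := by
  have : ∀ (go ask b' : Bool) (x : Claim α),
      (if go then Sum.inl b' else if ask then Sum.inr x else Sum.inl false : Bool ⊕ Claim α).elim
        ind W = if go then ind b' else if ask then W x else 0 := by
    intro go ask b' x
    cases go <;> cases ask <;> simp [ind]
  exact this _ _ _ _

open scoped Classical in
/-- If wrong answers to the questions are punished, the value of a claim is obtained by means of a
truthful message. -/
lemma value_eq_trueStepValue {a₁ : α} (h01 : a₁ ≠ a₀) [Finite α] (N μ N₀ : ℕ) (L L' : Level α)
    (Ls : List (Level α)) (C : Set (List α)) (z : List α) (b : Bool) (w : List Bool)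
    (hN : N = L.D.eval z.length * L.D.eval z.length + N₀) (hμ : L.D.eval z.length ≤ μ) {γ : ℝ}
    (hγ : (1 / 2) ^ L.D.eval z.length ≤ (1 - (1 / 2) ^ L.D.eval z.length) * γ)
    (hgap : ∀ s, asks ((trueStep C)^[s] (L.T.start (encPair (z, L.cert z w)))) = true →
      ∀ n ≥ N₀, avg n (fun w' => value a₀ N μ (L' :: Ls)
        (query ((trueStep C)^[s] (L.T.start (encPair (z, L.cert z w)))),
          !decide (query ((trueStep C)^[s] (L.T.start (encPair (z, L.cert z w)))) ∈ C), w')) + γ ≤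
        avg n (fun w' => value a₀ N μ (L' :: Ls)
          (query ((trueStep C)^[s] (L.T.start (encPair (z, L.cert z w)))),
            decide (query ((trueStep C)^[s] (L.T.start (encPair (z, L.cert z w)))) ∈ C), w'))) :
    value a₀ N μ (L :: L' :: Ls) (z, b, w) =
      trueStepValue (value a₀ N μ (L' :: Ls)) (fun c => ind (b == (output c || L.tie z w))) C
        (L.D.eval z.length) N₀ (L.D.eval z.length) (L.T.start (encPair (z, L.cert z w))) := by
  have h1 : ∀ m : List α, avg N (fun r =>
      (L.stage a₀ z b w (m, r)).elim ind (value a₀ N μ (L' :: Ls))) =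
      stepValue a₀ (value a₀ N μ (L' :: Ls)) (fun c => ind (b == (output c || L.tie z w)))
        (L.D.eval z.length) N₀ (L.D.eval z.length)
        (L.T.start (encPair (z, L.cert z w)), m) := by
    intro m
    rw [← avg_examValue, hN]
    exact avg_congr fun r _ => stage_value a₀ _ L z b w m r
  rw [value_cons]
  simp only [h1]
  have h2 : ∀ m, stepValue a₀ (value a₀ N μ (L' :: Ls))
      (fun c => ind (b == (output c || L.tie z w))) (L.D.eval z.length) N₀ (L.D.eval z.length)
      (L.T.start (encPair (z, L.cert z w)), m) ≤ _ := fun m =>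
    stepValue_le_trueStepValue a₀ C (L.D.eval z.length) N₀ (fun x => (value_mem a₀ N μ _ x).1)
      (fun x => (value_mem a₀ N μ _ x).2) (fun c => ind_nonneg _) (fun c => ind_le_one _) hγ _ _ m
      fun s _ => hgap s
  -- The supremum is attained by the truthful message, which is short enough because of `hμ`.
  refine le_antisymm (ciSup_le fun m => h2 m) ?_
  obtain ⟨m, hm, h⟩ := exists_stepValue_eq a₀ (W := value a₀ N μ (L' :: Ls))
    (e := fun c => ind (b == (output c || L.tie z w))) C (L.D.eval z.length) N₀ h01
    (L.D.eval z.length) (L.T.start (encPair (z, L.cert z w)))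
  rw [← h]
  exact le_ciSup_of_le ⟨_, by rintro _ ⟨m, rfl⟩; exact h2 m⟩ ⟨m, hm.trans hμ⟩ le_rfl

end

/-! ### Gaps between true and false claims along the counting hierarchy. -/

section

open QueryTM

variable {α : Type} (a₀ : α)

open scoped Classical in
/-- True claims about membership in `A` are worth more than false ones, by an amount whose inverse
is at most exponential. -/
def Gap (Ls : List (Level α)) (A : Set (List α)) : Prop :=
  ∃ need g : Polynomial ℕ, ∀ (z : List α) (N N' μ : ℕ), need.eval z.length ≤ N →
    need.eval z.length ≤ N' → need.eval z.length ≤ μ →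
      avg N' (fun w => value a₀ N μ Ls (z, !decide (z ∈ A), w)) + (1 / 2) ^ g.eval z.length ≤
        avg N' fun w => value a₀ N μ Ls (z, decide (z ∈ A), w)

/-- The length of the instance of a machine. -/
def instLen (q : Polynomial ℕ) : Polynomial ℕ := .X + q + 2

lemma length_encPair_cert (L : Level α) (z : List α) {w : List Bool}
    (hw : L.q.eval z.length ≤ w.length) :
    (encPair (z, L.cert z w)).length = (instLen L.q).eval z.length := by
  simp [encPair, encWord, encBits, Level.cert, instLen, hw]
  ring

section

variable {A : Set (List α)} {B : Set (List α × List Bool)} {q : Polynomial ℕ}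

open scoped Classical in
/-- The definition of a majority class in terms of averages. -/
lemma majority_iff_avg (hA : ∀ x : List α, x ∈ A ↔ (1 / 2 : ℝ) ≤ 1 / 2 ^ q.eval x.length *
      ((Finset.univ.filter
        (fun y : Fin (q.eval x.length) → Bool => (x, List.ofFn y) ∈ B)).card : ℝ)) (x : List α) :
    x ∈ A ↔ (1 / 2 : ℝ) ≤ avg (q.eval x.length) fun y => ind (decide ((x, y) ∈ B)) := by
  rw [hA, avg_eq_sum]
  simp [ind]

-- The machine asks nothing and the level uses no further round, so the coin length `N` and the
-- message length `μ` of later rounds do not matter. Only the `N'` coins of the claim count, and the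
-- gap is that of the majority test.
open scoped Classical in
lemma gap_singleton (T : QueryTM (Sym α) α) (p : Polynomial ℕ) (hask : ∀ c : T.Config, asks c = false)
    (hT : T.Decides ∅ p B) (hA : ∀ x : List α,
      x ∈ A ↔ (1 / 2 : ℝ) ≤ avg (q.eval x.length) fun y => ind (decide ((x, y) ∈ B))) :
    Gap a₀ [⟨T, q, q + 2 + p.comp (instLen q)⟩] A := by
  set D : Polynomial ℕ := q + 2 + p.comp (instLen q) with hD
  set L : Level α := ⟨T, q, D⟩ with hL
  refine ⟨q + D, D, fun z N N' μ _ hN' _ => ?_⟩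
  -- When no round is left, the coins are the empty list, all of whose blocks count as free of
  -- `true`; hence the machine is always simulated for the full `D` steps.
  have hblocks : ∀ D d : ℕ, blocks D d [] = (d, true, []) := by
    intro D d
    induction d with
    | zero => rfl
    | succ d ih => simp [blocks, ih]
  have hD1 : q.eval z.length + 2 ≤ D.eval z.length := by simp [hD]
  have hD2 : p.eval ((instLen q).eval z.length) ≤ D.eval z.length := by
    simp [hD, Polynomial.eval_comp]
  have htick : ∀ (t : ℕ) (c : T.Config), ((tickWith a₀)^[t] (c, [])).1 = (trueStep ∅)^[t] c := by
    intro t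
    induction t with
    | zero => exact fun c => rfl
    | succ t ih =>
      intro c
      rw [Function.iterate_succ_apply, Function.iterate_succ_apply, ← ih]
      simp [tickWith, trueStep, hask]
  have key : ∀ (b : Bool) (w : List Bool), w.length = N' → value a₀ N μ [L] (z, b, w) =
      ind (b == (decide ((z, w.take (q.eval z.length)) ∈ B) ||
        ((w.drop (q.eval z.length)).take (D.eval z.length)).all (!·))) := by
    intro b w hw
    have hlen : (encPair (z, L.cert z w)).length = (instLen q).eval z.length :=
      length_encPair_cert L z (by
        simp only [Polynomial.eval_add] at hN'
        show q.eval z.length ≤ _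
        omega)
    have hfin := hT (z, L.cert z w) (D.eval z.length) (by rw [hlen]; exact hD2)
    have h1 : output (L.simulate a₀ z (L.cert z w) [] (D.eval z.length)).1 =
        decide ((z, L.cert z w) ∈ B) := by
      rw [← hfin.2, ← htick]
      rfl
    rw [value_singleton]
    simp only [Level.stage, hblocks, if_true, Sum.elim_inl]
    change ind (b == (output (L.simulate a₀ z (L.cert z w) [] (D.eval z.length)).1 || _)) = _
    rw [h1]
    rfl
  obtain ⟨n, rfl⟩ : ∃ n, N' = q.eval z.length + (D.eval z.length + n) :=
    ⟨N' - (q.eval z.length + D.eval z.length), by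
      simp only [Polynomial.eval_add] at hN'; omega⟩
  rw [avg_congr (key _), avg_congr (key _)]
  exact majority_gap _ _ n hD1 (fun y => decide ((z, y) ∈ B)) _ (hA z)

-- The gap of the lower level, taken at the longest possible question, enforces truthful answers.
-- What remains is the majority test scaled by the probability that the simulation reaches its end.
open scoped Classical in
lemma gap_cons [Finite α] {a₁ : α} (h01 : a₁ ≠ a₀) (T : QueryTM (Sym α) α) (p : Polynomial ℕ)
    {C : Set (List α)} (hT : T.Decides C p B) (hA : ∀ x : List α,
      x ∈ A ↔ (1 / 2 : ℝ) ≤ avg (q.eval x.length) fun y => ind (decide ((x, y) ∈ B)))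
    (L' : Level α) (Ls : List (Level α)) (hC : Gap a₀ (L' :: Ls) C) :
    ∃ D : Polynomial ℕ, Gap a₀ (⟨T, q, D⟩ :: L' :: Ls) A := by
  obtain ⟨need, g, hC⟩ := hC
  -- `P` bounds the running time in terms of the length of `z`, and `W` the length of the questions:
  -- the instance and what can be pushed in `P` steps.
  set P : Polynomial ℕ := p.comp (instLen q) with hP
  set W : Polynomial ℕ := instLen q + .C T.growth * P with hW
  -- The part `q + 2` serves `majority_gap`, `P` lets the simulation reach the output, and `g.comp
  -- W` makes one false answer cost at least as much as can be gained after it.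
  set D : Polynomial ℕ := q + 2 + P + g.comp W with hD
  refine ⟨D, ?_⟩
  set L : Level α := ⟨T, q, D⟩ with hL
  -- Coins are needed for the certificate and the tie bits (`q + D`), for `D` blocks of length `D`,
  -- and for the claim that follows (`need.comp W`). In the exponent of the gap, `D * D` comes from
  -- the probability of reaching the test and `D` from the majority test.
  refine ⟨q + D + D * D + need.comp W, D * D + D, fun z N N' μ hN hN' hμ => ?_⟩
  simp only [Polynomial.eval_add, Polynomial.eval_mul, Polynomial.eval_comp] at hN hN' hμ
  have hD1 : q.eval z.length + 2 ≤ D.eval z.length := by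
    simp [hD, add_assoc]
  have hD2 : p.eval ((instLen q).eval z.length) ≤ D.eval z.length := by
    simp [hD, hP, Polynomial.eval_comp]; omega
  have hD3 : g.eval (W.eval z.length) + 1 ≤ D.eval z.length := by
    simp [hD, Polynomial.eval_comp]
  have hPe : P.eval z.length = p.eval ((instLen q).eval z.length) := by
    simp [hP, Polynomial.eval_comp]
  clear_value D
  obtain ⟨N₀, hN₀⟩ : ∃ N₀, N = D.eval z.length * D.eval z.length + N₀ :=
    ⟨N - D.eval z.length * D.eval z.length, by omega⟩
  have key : ∀ (b : Bool) (w : List Bool), w.length = N' → value a₀ N μ (L :: L' :: Ls) (z, b, w) =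
      trueStepValue (value a₀ N μ (L' :: Ls)) (fun _ => 0) C (D.eval z.length) N₀ (D.eval z.length)
        (T.start (encPair (z, L.cert z w))) +
      ((1 / 2) ^ D.eval z.length) ^ D.eval z.length *
      ind (b == (decide ((z, w.take (q.eval z.length)) ∈ B) ||
        ((w.drop (q.eval z.length)).take (D.eval z.length)).all (!·))) := by
    intro b w hw
    have hlen : (encPair (z, L.cert z w)).length = (instLen q).eval z.length :=
      length_encPair_cert L z (by
        show q.eval z.length ≤ _
        omega)
    have hfin := hT (z, L.cert z w)
    rw [hlen] at hfin
    rw [value_eq_trueStepValue a₀ h01 N μ N₀ L L' Ls C z b w hN₀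
      (by show D.eval z.length ≤ μ; omega) (γ := (1 / 2) ^ g.eval (W.eval z.length)) ?_ ?_,
      trueStepValue_eq]
    · change _ + ((1 / 2) ^ D.eval z.length) ^ D.eval z.length *
        ind (b == (output ((trueStep C)^[D.eval z.length] (T.start (encPair (z, L.cert z w)))) ||
          _)) = _
      rw [(hfin _ hD2).2]
      rfl
    · show ((1 : ℝ) / 2) ^ D.eval z.length ≤ (1 - (1 / 2) ^ D.eval z.length) * _
      -- It suffices that `(1 / 2) ^ D` is at most half of the lower gap and `1 - (1 / 2) ^ D` is at
      -- least one half.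
      have h1 : ((1 : ℝ) / 2) ^ D.eval z.length ≤ (1 / 2) ^ (g.eval (W.eval z.length) + 1) :=
        pow_le_pow_of_le_one (by norm_num) (by norm_num) hD3
      have h2 : ((1 : ℝ) / 2) ^ D.eval z.length ≤ (1 / 2) ^ 1 :=
        pow_le_pow_of_le_one (by norm_num) (by norm_num) (by omega)
      have h3 : (0 : ℝ) < (1 / 2) ^ g.eval (W.eval z.length) := by positivity
      rw [pow_succ] at h1
      nlinarith
    · intro s hs n hn
      -- `Decides` excludes questions from time `P` on, so only early, hence short, questions occur.
      have hsP : s < P.eval z.length := by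
        by_contra h
        have := (hfin s (by omega)).1
        rw [show asks ((trueStep C)^[s] (L.T.start (encPair (z, L.cert z w)))) = false from this]
          at hs
        simp at hs
      have hquery : (query ((trueStep C)^[s] (L.T.start (encPair (z, L.cert z w))))).length ≤
          W.eval z.length := by
        refine (length_query_iterate C _ s).trans ?_
        simp only [hW, Polynomial.eval_add, Polynomial.eval_mul, Polynomial.eval_C]
        rw [hlen]
        exact Nat.add_le_add_left (Nat.mul_le_mul_left _ hsP.le) _
      have hneed := eval_mono need hquery
      have hpow : ((1 : ℝ) / 2) ^ g.eval (W.eval z.length) ≤ (1 / 2) ^ g.eval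
          (query ((trueStep C)^[s] (L.T.start (encPair (z, L.cert z w))))).length :=
        pow_le_pow_of_le_one (by norm_num) (by norm_num) (eval_mono g hquery)
      exact (add_le_add le_rfl hpow).trans (hC _ N n μ (by omega) (by omega) (by omega))
  obtain ⟨n, rfl⟩ : ∃ n, N' = q.eval z.length + (D.eval z.length + n) :=
    ⟨N' - (q.eval z.length + D.eval z.length), by omega⟩
  rw [avg_congr (key _), avg_congr (key _), avg_add, avg_add, avg_mul, avg_mul, add_assoc]
  have h := majority_gap _ _ n hD1 (fun y => decide ((z, y) ∈ B)) _ (hA z)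
  have h2 := mul_le_mul_of_nonneg_left h
    (by positivity : (0 : ℝ) ≤ ((1 / 2) ^ D.eval z.length) ^ D.eval z.length)
  rw [mul_add] at h2
  rw [Polynomial.eval_add, Polynomial.eval_mul, pow_add, pow_mul]
  -- The common summand is the value of the truthful answers; it does not depend on the claimed bit.
  exact add_le_add_right h2 _

end

end

section

/-! ### The protocol -/

lemma avg_eq_expect (N : ℕ) (f : List Bool → ℝ) :
    avg N f = 𝔼 w : Fin N → Bool, f (List.ofFn w) := by
  rw [avg_eq_sum, Fintype.expect_eq_sum_div_card]
  simp
  ring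

/-- Exchanging `r i` with an independent string `w` is an involution of `S ×ˢ univ`, because `S` is
closed under changes of the coordinate `i`. Hence `r i` is uniform on `S`. -/
lemma expect_coin {k N : ℕ} (i : Fin k) (g : (Fin N → Bool) → ℝ)
    {S : Finset (Fin k → Fin N → Bool)} (hS : S.Nonempty)
    (hu : ∀ r ∈ S, ∀ w, Function.update r i w ∈ S) :
    𝔼 r ∈ S, g (r i) = 𝔼 w : Fin N → Bool, g w := by
  calc 𝔼 r ∈ S, g (r i) = 𝔼 p ∈ S ×ˢ (Finset.univ : Finset (Fin N → Bool)), g (p.1 i) := by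
        rw [Finset.expect_product]
        refine Finset.expect_congr rfl fun r _ => ?_
        exact (Finset.expect_const (Finset.univ_nonempty (α := Fin N → Bool)) (g (r i))).symm
    _ = 𝔼 p ∈ S ×ˢ (Finset.univ : Finset (Fin N → Bool)), g p.2 := by
        refine Finset.expect_nbij' (fun p => (Function.update p.1 i p.2, p.1 i))
          (fun p => (Function.update p.1 i p.2, p.1 i)) ?_ ?_ ?_ ?_ ?_
        · rintro ⟨r, w⟩ hp
          simp only [Finset.mem_product, Finset.mem_univ, and_true] at hp ⊢
          exact hu r hp w
        · rintro ⟨r, w⟩ hp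
          simp only [Finset.mem_product, Finset.mem_univ, and_true] at hp ⊢
          exact hu r hp w
        · rintro ⟨r, w⟩ _; simp
        · rintro ⟨r, w⟩ _; simp
        · rintro ⟨r, w⟩ _; rfl
    _ = 𝔼 w : Fin N → Bool, g w := by
        rw [Finset.expect_product]
        exact Finset.expect_const hS (𝔼 w : Fin N → Bool, g w)

lemma zip_append_singleton {A B : Type*} {l : List A} {l' : List B} (a : A)
    (h : l.length < l'.length) : (l ++ [a]).zip l' = l.zip l' ++ [(a, l'[l.length])] := by
  induction l generalizing l' with
  | nil => obtain _ | ⟨b, t⟩ := l' <;> simp at h ⊢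
  | cons c l ih => obtain _ | ⟨b, t⟩ := l' <;> simp at h ⊢; exact ih h

lemma zip_take_length {A B : Type*} (l : List A) (l' : List B) :
    l.zip (l'.take l.length) = l.zip l' := by
  induction l generalizing l' with
  | nil => rfl
  | cons c l ih => cases l' <;> simp [ih]

namespace Protocol

variable {α β : Type} (Q : Protocol α β) {k : ℕ} {x : List α}

lemma length_coinList (r : Q.Coins k x) : (Q.coinList r).length = k := by simp [coinList]

lemma take_coinList_eq_iff {r r' : Q.Coins k x} {n : ℕ} :
    (Q.coinList r).take n = (Q.coinList r').take n ↔ ∀ l : Fin k, l < n → r l = r' l := by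
  constructor
  · intro h l hl
    have := congrArg (fun L => L[(l : ℕ)]?) h
    simpa [coinList, List.getElem?_take, hl, List.ofFn_inj] using this
  · intro h
    refine List.ext_getElem? fun n' => ?_
    by_cases h1 : n' < n
    · by_cases h2 : n' < k
      · simp [coinList, h1, h2, h ⟨n', h2⟩ h1]
      · simp [coinList, h1, h2]
    · simp [h1]

lemma play_append (r : Q.Coins k x) (ms : List (List α)) (m : List α) :
    Q.play r (ms ++ [m]) = Q.extend r (Q.play r ms) m := by
  simp [play, List.foldl_append]

lemma map_fst_play (r : Q.Coins k x) (ms : List (List α)) :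
    (Q.play r ms).map Prod.fst = ms := by
  induction ms using List.reverseRecOn with
  | nil => rfl
  | append_singleton ms m ih => rw [play_append, extend, List.map_append, ih]; rfl

lemma length_play (r : Q.Coins k x) (ms : List (List α)) :
    (Q.play r ms).length = ms.length := by
  rw [← List.length_map Prod.fst, map_fst_play]

lemma play_congr {r r' : Q.Coins k x} {ms : List (List α)}
    (h : ∀ l : Fin k, l < ms.length → r l = r' l) : Q.play r ms = Q.play r' ms := by
  induction ms using List.reverseRecOn with
  | nil => rfl
  | append_singleton ms m ih =>
    rw [play_append, play_append, ih fun l hl => h l (by simp; omega), extend, extend,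
      (Q.take_coinList_eq_iff).2 fun l hl => h l (by simpa [length_play] using hl)]

end Protocol

variable {α : Type} [Finite α] {a₀ a₁ : α}

/-- The protocol in which Arthur publishes his random strings, and Merlin's claim is expressed by
the first letter of his first message. -/
def claimProtocol (a₀ a₁ : α) (Ls : List (Level α)) (need : Polynomial ℕ) : Protocol α Bool where
  V := publish a₀ a₁
  R i := [rewardBit a₀ Ls i]
  φ := firstBit a₀
  V_polyTime := publish_polyTime a₀ a₁
  R_polyTime := rewardBit_polyTime a₀ Ls
  φ_polyTime := firstBit_polyTime a₀
  R_le_one i := by simp [binFrac]; split_ifs <;> norm_num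
  msgLen := need
  coinLen := need

section

variable {Ls : List (Level α)} {need : Polynomial ℕ} {k : ℕ} {x : List α}

local notation "Q" => claimProtocol a₀ a₁ Ls need

/-- Two different letters encode the bits, and a concatenation of strings of known lengths can be
cut again. -/
lemma publish_injective (h01 : a₁ ≠ a₀) {x x' : List α} {ms ms' : List (List α)}
    {rs rs' : List (List Bool)} (hl : rs.map List.length = rs'.map List.length)
    (h : publish a₀ a₁ (x, ms, rs) = publish a₀ a₁ (x', ms', rs')) : rs = rs' := by
  refine (List.eq_iff_flatten_eq).2 ⟨?_, hl⟩
  refine List.map_injective_iff.2 ?_ h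
  intro b b'
  cases b <;> cases b' <;> simp [h01, h01.symm]

/-- Arthur's last answer contains all his random strings so far, so a transcript that occurs
determines them and leaves the later ones free. -/
lemma mem_compatible_play (h01 : a₁ ≠ a₀) (r r' : (Q).Coins k x) (ms : List (List α)) :
    r' ∈ (Q).compatible k x ((Q).play r ms) ↔ ∀ l : Fin k, l < ms.length → r' l = r l := by
  simp only [Protocol.compatible, Finset.mem_filter, Finset.mem_univ, true_and,
    Protocol.map_fst_play]
  refine ⟨fun h => ?_, fun h => (Q).play_congr h⟩
  rcases List.eq_nil_or_concat' ms with rfl | ⟨ms, m, rfl⟩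
  · simp
  · rw [Protocol.play_append, Protocol.play_append, Protocol.extend, Protocol.extend] at h
    have h2 := (List.append_inj' h rfl).2
    simp only [List.cons.injEq, Prod.mk.injEq, true_and, and_true, Protocol.length_play] at h2
    have h3 := publish_injective h01 (by
      simp only [Protocol.coinList]
      refine List.ext_getElem? fun n => ?_
      by_cases h1 : n < ms.length + 1 <;> by_cases h2 : n < k <;>
        simp [h1, h2]) h2
    intro l hl
    exact (Q).take_coinList_eq_iff.1 h3 l (by simpa using hl)

/-- Compatibility restricts only the strings of past rounds, so the next string is uniform. -/
lemma expect_compatible_play (h01 : a₁ ≠ a₀) (r : (Q).Coins k x) (ms : List (List α))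
    (hk : ms.length < k) (g : List Bool → ℝ) :
    𝔼 r' ∈ (Q).compatible k x ((Q).play r ms), g (List.ofFn (r' ⟨ms.length, hk⟩)) =
      avg (need.eval x.length) g := by
  rw [avg_eq_expect]
  refine expect_coin ⟨ms.length, hk⟩ (fun w => g (List.ofFn w))
    ⟨r, (mem_compatible_play h01 r r ms).2 fun _ _ => rfl⟩ fun r' hr' w => ?_
  rw [mem_compatible_play h01] at hr' ⊢
  intro l hl
  rw [Function.update_of_ne, hr' l hl]
  rintro rfl
  exact lt_irrefl _ hl

/-- The past strings are known from the transcript and may be put into the history, and each further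
round averages over one fresh string; this is the recursion of `opt`. -/
lemma expectedReward_play (h01 : a₁ ≠ a₀) (j : ℕ) (r : (Q).Coins k x) (ms : List (List α))
    (hj : ms.length + j = k) :
    (Q).expectedReward k x j ((Q).play r ms) =
      opt (need.eval x.length) (need.eval x.length) j fun h =>
        ind (rewardBit a₀ Ls (x, ms.zip ((Q).coinList r) ++ h)) := by
  induction j generalizing r ms with
  | zero =>
    -- After the last round every random string is known, so the innermost expectation has a single
    -- term.
    have : (Q).compatible k x ((Q).play r ms) = {r} := by
      ext r'
      rw [mem_compatible_play h01, Finset.mem_singleton]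
      exact ⟨fun h => funext fun l => h l (by omega), fun h _ _ => by rw [h]⟩
    rw [Protocol.expectedReward, this, Finset.expect_singleton, Protocol.map_fst_play, opt,
      List.append_nil]
    simp only [claimProtocol, binFrac, zero_div, add_zero, ind]
    rfl
  | succ j ih =>
    rw [Protocol.expectedReward, opt]
    refine iSup_congr fun m => ?_
    rw [← expect_compatible_play h01 r ms (by omega)]
    refine Finset.expect_congr rfl fun r' hr' => ?_
    rw [mem_compatible_play h01] at hr'
    rw [← (Q).play_congr hr', ← Protocol.play_append, ih _ _ (by simp; omega),
      zip_append_singleton m.1 (by rw [Protocol.length_coinList]; omega), ← zip_take_length ms,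
      (Q).take_coinList_eq_iff.2 hr', zip_take_length]
    simp [Protocol.coinList]

/-- The first message enters the reward only through the bit it claims, and the first random string
is the one with which this claim is examined. -/
lemma expectedRewardOf_nil (h01 : a₁ ≠ a₀) (hk : 0 < k) (hLs : Ls.length = k) (m : List α) :
    (Q).expectedRewardOf k x [] m = avg (need.eval x.length) fun w =>
      value a₀ (need.eval x.length) (need.eval x.length) Ls (x, headBit a₀ m, w) := by
  have r₀ : (Q).Coins k x := fun _ _ => false
  rw [← expect_compatible_play (Ls := Ls) h01 r₀ [] hk]
  refine Finset.expect_congr rfl fun r _ => ?_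
  rw [show (Q).extend r [] m = (Q).play r [m] from rfl,
    expectedReward_play h01 _ r [m] (by simp; omega)]
  rw [← List.nil_append [m], zip_append_singleton m (by rw [Protocol.length_coinList]; exact hk)]
  subst hLs
  simp [Protocol.coinList, value, rewardBit]

/-- If true claims are worth more than false ones, the protocol decides the language. -/
theorem mem_DRMA_of_gap (h01 : a₁ ≠ a₀) {Ls : List (Level α)} (hk : Ls ≠ []) {A : Set (List α)}
    (h : Gap a₀ Ls A) : A ∈ DRMA α Ls.length := by
  classical
  obtain ⟨need, g, h⟩ := h
  have hpos : 0 < Ls.length := List.length_pos_iff.2 hk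
  -- The `+ 1` ensures that a message of one letter is allowed.
  refine ⟨claimProtocol a₀ a₁ Ls (need + 1), fun x r ms hms hr => ?_⟩
  obtain ⟨m, ms, rfl⟩ := List.exists_cons_of_length_pos (hms ▸ hpos)
  -- Only the rationality of the first message is used: the value computed depends on no other, and
  -- optimal continuations are built into its expected reward.
  obtain ⟨_, h1⟩ := hr 0 (by simp)
  simp only [List.take_zero, List.getElem_cons_zero] at h1
  have hφ : (claimProtocol a₀ a₁ Ls (need + 1)).φ
      (x, (Protocol.flatten ((claimProtocol a₀ a₁ Ls (need + 1)).play r (m :: ms))).dropLast) =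
      [headBit a₀ m] := by
    have h2 := (claimProtocol a₀ a₁ Ls (need + 1)).map_fst_play r (m :: ms)
    obtain ⟨⟨m', a⟩, τ, hτ⟩ : ∃ p τ, (claimProtocol a₀ a₁ Ls (need + 1)).play r (m :: ms) = p :: τ :=
      List.exists_cons_of_length_pos (by rw [Protocol.length_play]; simp)
    rw [hτ] at h2 ⊢
    obtain rfl : m' = m := (List.cons.inj h2).1
    simp [Protocol.flatten, claimProtocol, firstBit]
  rw [hφ]
  set N := (need + 1).eval x.length with hN
  have hneed : need.eval x.length ≤ N := by simp [hN]
  have hgap := h x N N N hneed hneed hneed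
  have hg : (0 : ℝ) < (1 / 2) ^ g.eval x.length := by positivity
  by_contra hne
  have hb : headBit a₀ m = !decide (x ∈ A) := by
    refine Bool.eq_not_of_ne fun hb => hne ?_
    rw [hb]
  -- The one-letter message with the true claim would earn strictly more than `m`.
  let a := if x ∈ A then a₀ else a₁
  have ha : headBit a₀ [a] = decide (x ∈ A) := by
    by_cases hq : x ∈ A <;> simp [headBit, a, hq, h01]
  have h2 := h1 ⟨[a], by simp [claimProtocol]⟩
  change (claimProtocol a₀ a₁ Ls (need + 1)).expectedRewardOf Ls.length x [] [a] ≤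
    (claimProtocol a₀ a₁ Ls (need + 1)).expectedRewardOf Ls.length x [] m at h2
  rw [expectedRewardOf_nil h01 hpos rfl, expectedRewardOf_nil h01 hpos rfl, hb, ha] at h2
  linarith

end

/-- A protocol without rounds. -/
theorem classP_subset (a₀ a₁ : α) : classP α ⊆ DRMA α 0 := by
  classical
  intro A hA
  -- Without rounds only `φ` matters; the other components merely have to be admissible.
  let Q₀ : Protocol α Bool :=
    { claimProtocol a₀ a₁ [] 0 with
      φ := fun i => [decide (i.1 ∈ A)]
      φ_polyTime := membership_polyTime a₀ hA }
  exact ⟨Q₀, fun x r ms _ _ => rfl⟩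

/-- Languages in the counting hierarchy have protocols with a gap. -/
lemma exists_gap (h01 : a₁ ≠ a₀) (k : ℕ) {A : Set (List α)}
    (hA : A ∈ countingHierarchy α (k + 1)) :
    ∃ (L : Level α) (Ls : List (Level α)), Ls.length = k ∧ Gap a₀ (L :: Ls) A := by
  induction k generalizing A with
  | zero =>
    obtain ⟨B, hB, q, hA⟩ := hA
    obtain ⟨T, p, hask, hT⟩ := QueryTM.exists_plain a₀ hB
    -- A machine that asks nothing decides the same set with every oracle, so the empty one will do.
    exact ⟨_, [], rfl, gap_singleton a₀ T p hask (hT ∅) (majority_iff_avg hA)⟩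
  | succ k ih =>
    obtain ⟨B, ⟨C, hC, hB⟩, q, hA⟩ := hA
    obtain ⟨L', Ls, hLs, hgap⟩ := ih hC
    obtain ⟨T, p, hT⟩ := QueryTM.exists_ofOracle hB
    obtain ⟨D, hD⟩ := gap_cons a₀ h01 T p hT (majority_iff_avg hA) L' Ls hgap
    exact ⟨_, L' :: Ls, by simp [hLs], hD⟩

end

end RationalProofs

end

theorem mainTheorem10 {α : Type} [Finite α] [Nontrivial α] (k : ℕ) :
    RationalProofs.countingHierarchy α k ⊆ RationalProofs.DRMA α k := by
  obtain ⟨a₁, a₀, h01⟩ := exists_pair_ne α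
  cases k with
  | zero => exact RationalProofs.classP_subset a₀ a₁
  | succ k =>
    intro A hA
    obtain ⟨L, Ls, hLs, h⟩ := RationalProofs.exists_gap h01 k hA
    have := RationalProofs.mem_DRMA_of_gap h01 (List.cons_ne_nil L Ls) h
    rwa [List.length_cons, hLs] at this
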